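/- Let $n\ge 2$. For every prime power $q\equiv 1 \pmod 4$ let $\mathbb F_q$ be a field with $q$ elements, and let $\left(\frac{f}{g}\right)$ denote the quadratic residue symbol in $\mathbb F_q[t]$. Suppose that for every such $q$ we are given complex weights $H(f_0,\dots,f_n)$, for $f_0,\dots,f_n\in\mathbb F_q[t]$ monic, and that for all integers $a_0,\dots,a_n\ge 0$ we are given a polynomial $c_{a_0,\dots,a_n}$ in one variable over $\mathbb C$ (independent of $q$), such that $c_{a_0,\dots,a_n}(q)=\sum_{\deg f_i=a_i}H(f_0,\dots,f_n)$ for every $q$, and the following four axioms hold, indices being taken modulo $n+1$. (1) Twisted multiplicativity: if $\gcd(f_0\cdots f_n,g_0\cdots g_n)=1$, then $$H(f_0g_0,\dots,f_ng_n)=H(f_0,\dots,f_n)H(g_0,\dots,g_n)\prod_{i \bmod n+1}\left(\frac{f_i}{g_{i+1}}\right)\left(\frac{g_i}{f_{i+1}}\right).$$ (2) Local-to-global principle: $c_{a_0,\dots,a_n}$ has degree at most $a_0+\cdots+a_n$, and for every monic irreducible $p\in\mathbb F_q[t]$, with $|p|=q^{\deg p}$, $H(p^{a_0},\dots,p^{a_n})=|p|^{a_0+\cdots+a_n}c_{a_0,\dots,a_n}(|p|^{-1})$.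 (3) Dominance: if $a_0+\cdots+a_n\ge 2$, then all terms of $c_{a_0,\dots,a_n}$ have degree greater than $\frac12(a_0+\cdots+a_n+1)$ (equivalently, $H(p^{a_0},\dots,p^{a_n})$, as a polynomial in $|p|$, has degree less than $\frac12(a_0+\cdots+a_n-1)$). (4) Initial conditions: $H(1,\dots,1,f_i,1,\dots,1)=1$ for every $i$ and every monic $f_i$, and $c_{0,\dots,0,a_i,0,\dots,0}(q)=q^{a_i}$. Fix $q$ and let $Z(x_0,\dots,x_n)=\sum_{f_0,\dots,f_n}H(f_0,\dots,f_n)x_0^{\deg f_0}\cdots x_n^{\deg f_n}$, a formal power series; here and below sums are over monic polynomials in $\mathbb F_q[t]$. Put $$R(x_0,x_2,\dots,x_{n-1})=(-q)^{(n+1)/2}\operatorname{Res}_{x_1=x_3=\cdots=x_n=q^{-1}}Z(x_0,\dots,x_n)\quad(n\text{ odd}),$$ $$R(x_0,x_2,\dots,x_n)=(-q)^{n/2}\operatorname{Res}_{x_1=x_3=\cdots=x_{n-1}=q^{-1}}Z(q^{-1/4}x_0,x_1,\dots,x_{n-1},q^{-1/4}x_n)\quad(n\text{ even}),$$ where $(-q)^k\operatorname{Res}$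 means: multiply the series by $\prod_{i\text{ odd}}(1-qx_i)$ and evaluate at $x_i=q^{-1}$ for all odd $i\le n$. Then: (a) $R$ is a well-defined formal power series: for fixed exponents of the even-indexed variables, only finitely many coefficients enter the evaluation. (b) For $n$ odd, $$R(x_0,x_2,\dots,x_{n-1})=\sum_{f_0,f_2,\dots,f_{n-1}}\frac{H(f_0,f_0f_2,f_2,f_2f_4,\dots,f_{n-1},f_{n-1}f_0)}{q^{\deg f_0+\deg f_2+\cdots+\deg f_{n-1}}}\,x_0^{\deg f_0}x_2^{\deg f_2}\cdots x_{n-1}^{\deg f_{n-1}},$$ and for $n$ even, $$R(x_0,x_2,\dots,x_n)=\sum_{f_0,f_2,\dots,f_n}\frac{H(f_0,f_0f_2,f_2,f_2f_4,\dots,f_{n-2}f_n,f_n)}{q^{\frac34\deg f_0+\deg f_2+\cdots+\deg f_{n-2}+\frac34\deg f_n}}\,x_0^{\deg f_0}x_2^{\deg f_2}\cdots x_n^{\deg f_n}.$$ (c) If $H(f_0,f_0f_2,f_2,f_2f_4,\dots)\ne 0$, then every product $f_if_{i+2}$ occurring in this tuple is a perfect square, and all of $f_0,f_2,f_4,\dots$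 have the same squarefree part: there is a monic squarefree $s$ such that each $f_i$ is $s$ times the square of a monic polynomial. (d) The coefficients are multiplicative: if $\gcd(f_0f_2f_4\cdots,\,g_0g_2g_4\cdots)=1$, then $$H(f_0g_0,f_0f_2g_0g_2,f_2g_2,\dots)=H(f_0,f_0f_2,f_2,\dots)\,H(g_0,g_0g_2,g_2,\dots),$$ and the same holds after dividing each of the three weights by the corresponding power of $q$ from (b). (e) $R$ has an Euler product: $R=\prod_p R_p$ over all monic irreducible $p\in\mathbb F_q[t]$, where $R_p$ is the sum of those terms of the series in (b) in which all $f_i$ are powers of $p$. The product is one of formal power series: each coefficient of the product over a finite set of primes equals that of $R$ once the set contains a suitable finite set. -/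

import Mathlib

open Polynomial

noncomputable section

namespace AffineMDS

/-- The prime powers `q` with `q ≡ 1 mod 4`. -/
abbrev PrimePowerOneModFour : Type := {q : ℕ // IsPrimePow q ∧ q % 4 = 1}

/-- The monic irreducible polynomials ("primes") of `F[t]`. -/
abbrev PrimePoly (F : Type*) [Field F] : Type _ := {p : F[X] // p.Monic ∧ Irreducible p}

open Classical in
/-- The quadratic residue symbol `(f / p)` for a prime `p` of `F[t]`. -/
def primeResidueSymbol {F : Type*} [Field F] (f p : F[X]) : ℤ :=
  if p ∣ f then 0 else if ∃ h : F[X], p ∣ f - h ^ 2 then 1 else -1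

open Classical in
/-- The quadratic residue symbol `(f / g)`, for `g` monic: the product of the `(f / p)` over the
prime factors `p` of `g`, counted with multiplicity. -/
def residueSymbol {F : Type*} [Field F] (f g : F[X]) : ℤ :=
  ((UniqueFactorizationMonoid.normalizedFactors g).map (primeResidueSymbol f)).prod

/-- There are finitely many tuples of monic polynomials of prescribed degrees over a finite
field. -/
theorem finite_monicTuples (F : Type*) [Field F] [Finite F] {m : ℕ} (a : Fin m → ℕ) :
    {f : Fin m → F[X] | ∀ i, (f i).Monic ∧ (f i).natDegree = a i}.Finite := by
  have key : ∀ d : ℕ, {f : F[X] | f.Monic ∧ f.natDegree = d}.Finite := by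
    intro d
    refine Set.Finite.of_injOn (f := fun f : F[X] => fun k : Fin (d + 1) => f.coeff k)
      (t := Set.univ) (fun _ _ => Set.mem_univ _) ?_ Set.finite_univ
    intro f hf g hg hfg
    ext k
    by_cases hk : k < d + 1
    · exact congrFun hfg ⟨k, hk⟩
    · rw [coeff_eq_zero_of_natDegree_lt (by have := hf.2; omega),
        coeff_eq_zero_of_natDegree_lt (by have := hg.2; omega)]
  refine (Set.Finite.pi' fun i => key (a i)).subset fun f hf => ?_
  exact hf

/-- The tuples `(f_i)` of monic polynomials with `deg f_i = a_i` for all `i`. -/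
def monicTuples (F : Type*) [Field F] [Finite F] {m : ℕ} (a : Fin m → ℕ) :
    Finset (Fin m → F[X]) :=
  (finite_monicTuples F a).toFinset

/-- The four axioms for the local weights `H` and the global coefficients `c` of type `Ã_n`. The
field with `q` elements is `𝔽 q`, the weight `H(f_0, …, f_n)` over `𝔽_q[t]` is `H q f` (only its
values on monic tuples matter), and `c a` is `c_{a_0, …, a_n}` as a polynomial in `q`, the same
for all `q`. Indices `i : Fin (n + 1)` are taken modulo `n + 1`. -/
structure SatisfiesAxioms {n : ℕ} {𝔽 : PrimePowerOneModFour → Type*} [∀ q, Field (𝔽 q)]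
    [∀ q, Finite (𝔽 q)] (H : ∀ q, (Fin (n + 1) → (𝔽 q)[X]) → ℂ)
    (c : (Fin (n + 1) → ℕ) → ℂ[X]) : Prop where
  /-- Twisted multiplicativity. -/
  twisted_mul : ∀ (q : PrimePowerOneModFour) (f g : Fin (n + 1) → (𝔽 q)[X]),
    (∀ i, (f i).Monic) → (∀ i, (g i).Monic) → IsCoprime (∏ i, f i) (∏ i, g i) →
    H q (fun i => f i * g i) = H q f * H q g *
      ∏ i, ((residueSymbol (f i) (g (i + 1)) * residueSymbol (g i) (f (i + 1)) : ℤ) : ℂ)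
  /-- The degree bound of the local-to-global principle. -/
  natDegree_le : ∀ a : Fin (n + 1) → ℕ, (c a).natDegree ≤ ∑ i, a i
  /-- The global coefficients are the sums of the weights over tuples of fixed degrees. -/
  global_coeff : ∀ (q : PrimePowerOneModFour) (a : Fin (n + 1) → ℕ),
    ∑ f ∈ monicTuples (𝔽 q) a, H q f = (c a).eval (q.1 : ℂ)
  /-- The local-to-global principle, with `|p| = q ^ deg p`. -/
  local_global : ∀ (q : PrimePowerOneModFour) (p : PrimePoly (𝔽 q)) (a : Fin (n + 1) → ℕ),
    H q (fun i => p.1 ^ a i) =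
      ((q.1 : ℂ) ^ p.1.natDegree) ^ (∑ i, a i) *
        (c a).eval (((q.1 : ℂ) ^ p.1.natDegree)⁻¹)
  /-- The dominance principle: `c_a(q)` only has terms in degrees greater than
  `(a_0 + ⋯ + a_n + 1) / 2`, except when `a_0 + ⋯ + a_n ≤ 1`. -/
  dominance : ∀ a : Fin (n + 1) → ℕ, 2 ≤ ∑ i, a i → ∀ k : ℕ, (c a).coeff k ≠ 0 →
    ((∑ i, a i : ℕ) + 1 : ℝ) / 2 < k
  /-- The initial conditions for the weights. -/
  weight_initial : ∀ (q : PrimePowerOneModFour) (i : Fin (n + 1)) (f : (𝔽 q)[X]), f.Monic →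
    H q (fun j => if j = i then f else 1) = 1
  /-- The initial conditions for the global coefficients. -/
  coeff_initial : ∀ (q : PrimePowerOneModFour) (i : Fin (n + 1)) (d : ℕ),
    (c (fun j => if j = i then d else 0)).eval (q.1 : ℂ) = (q.1 : ℂ) ^ d

/-- The multiple Dirichlet series `Z(x_0, …, x_n) = ∑ H(f_0, …, f_n) ∏ x_i ^ deg f_i`, as a formal
power series. -/
def dirichletSeries {n : ℕ} {F : Type*} [Field F] [Finite F]
    (H : (Fin (n + 1) → F[X]) → ℂ) : MvPowerSeries (Fin (n + 1)) ℂ :=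
  fun a => ∑ f ∈ monicTuples F (fun i => a i), H f

/-- The `j`-th even index `2j ∈ {0, …, n}`. The even indices are parametrised by
`j = 0, …, ⌊n/2⌋`. -/
def evenIndex {n : ℕ} (j : Fin (n / 2 + 1)) : Fin (n + 1) := ⟨2 * j.1, by omega⟩

/-- The odd indices in `{0, …, n}`. -/
def oddIndices (n : ℕ) : Finset (Fin (n + 1)) := Finset.univ.filter fun i => Odd i.1

/-- `Z` multiplied by `1 - q x_i` for each odd `i ≤ n`. -/
def clearPoles {n : ℕ} (q : ℕ) (Z : MvPowerSeries (Fin (n + 1)) ℂ) :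
    MvPowerSeries (Fin (n + 1)) ℂ :=
  (∏ i ∈ oddIndices n, (1 - MvPowerSeries.C (q : ℂ) * MvPowerSeries.X i)) * Z

/-- The exponents of `x_0, …, x_n` whose even-indexed part is `e` and for which the coefficient of
`∏_{i odd} (1 - q x_i) · Z` does not vanish. -/
def residueSupport {n : ℕ} (q : ℕ) (Z : MvPowerSeries (Fin (n + 1)) ℂ)
    (e : Fin (n / 2 + 1) →₀ ℕ) : Set (Fin (n + 1) →₀ ℕ) :=
  {a | (∀ j, a (evenIndex j) = e j) ∧ MvPowerSeries.coeff a (clearPoles q Z) ≠ 0}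

/-- The formal residue of `Z` at `x_1 = x_3 = ⋯ = q⁻¹` exists: evaluating
`∏_{i odd} (1 - q x_i) · Z` at `x_i = q⁻¹` for all odd `i` only involves finite sums of
coefficients. -/
def HasFormalResidue {n : ℕ} (q : ℕ) (Z : MvPowerSeries (Fin (n + 1)) ℂ) : Prop :=
  ∀ e : Fin (n / 2 + 1) →₀ ℕ, (residueSupport q Z e).Finite

/-- The value of `∏_{i odd} (1 - q x_i) · Z` at `x_i = q⁻¹` for all odd `i`, a formal power series
in `x_0, x_2, …`. This is `(-q) ^ k · Res_{x_1 = x_3 = ⋯ = q⁻¹} Z`, with `k` the number of odd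
indices. It is meaningful when `HasFormalResidue q Z` holds. -/
def formalResidue {n : ℕ} (q : ℕ) (Z : MvPowerSeries (Fin (n + 1)) ℂ) :
    MvPowerSeries (Fin (n / 2 + 1)) ℂ :=
  fun e => ∑ᶠ a ∈ residueSupport q Z e,
    MvPowerSeries.coeff a (clearPoles q Z) * ∏ i ∈ oddIndices n, ((q : ℂ)⁻¹) ^ a i

/-- The series whose residue is taken: `Z` itself for `n` odd, and
`Z(q^{-1/4} x_0, x_1, …, x_{n-1}, q^{-1/4} x_n)` for `n` even. -/
def normalizedSeries {n : ℕ} (q : ℕ) (Z : MvPowerSeries (Fin (n + 1)) ℂ) :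
    MvPowerSeries (Fin (n + 1)) ℂ :=
  MvPowerSeries.rescale
    (fun i => if Even n ∧ (i = 0 ∨ i = Fin.last n) then (((q : ℝ) ^ (-(1 / 4) : ℝ) : ℝ) : ℂ) else 1)
    Z

/-- The residue `R(x_0, x_2, …)`. -/
def residueSeries {n : ℕ} (q : ℕ) (Z : MvPowerSeries (Fin (n + 1)) ℂ) :
    MvPowerSeries (Fin (n / 2 + 1)) ℂ :=
  formalResidue q (normalizedSeries q Z)

/-- For `g = (f_0, f_2, f_4, …)`, the tuple `(f_0, f_0 f_2, f_2, f_2 f_4, …)` of length `n + 1`,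
which ends in `f_{n-1}, f_{n-1} f_0` for `n` odd and in `f_{n-2} f_n, f_n` for `n` even. -/
def residueTuple {M : Type*} [Mul M] {n : ℕ} (g : Fin (n / 2 + 1) → M) : Fin (n + 1) → M :=
  fun i =>
    if Even i.1 then g (Fin.ofNat _ (i.1 / 2))
    else g (Fin.ofNat _ (i.1 / 2)) * g (Fin.ofNat _ (i.1 / 2 + 1))

/-- The weight of `f_{2j}` in the exponent of `q`: it is `3/4` for the end variables when `n` is
even, and `1` otherwise. -/
def endWeight {n : ℕ} (j : Fin (n / 2 + 1)) : ℝ :=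
  if Even n ∧ (j = 0 ∨ j = Fin.last (n / 2)) then 3 / 4 else 1

/-- The term `H(f_0, f_0 f_2, f_2, …) / q ^ (w_0 deg f_0 + w_2 deg f_2 + ⋯)`. -/
def residueTerm {n : ℕ} {F : Type*} [Field F] (q : ℕ) (H : (Fin (n + 1) → F[X]) → ℂ)
    (f : Fin (n / 2 + 1) → F[X]) : ℂ :=
  H (residueTuple f) / (((q : ℝ) ^ (∑ j, endWeight j * ((f j).natDegree : ℝ)) : ℝ) : ℂ)

/-- The formal power series `∑ residueTerm (f_0, f_2, …) · x_0 ^ deg f_0 · x_2 ^ deg f_2 ⋯`, over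
all tuples of monic polynomials. -/
def residueSum {n : ℕ} {F : Type*} [Field F] [Finite F] (q : ℕ)
    (H : (Fin (n + 1) → F[X]) → ℂ) : MvPowerSeries (Fin (n / 2 + 1)) ℂ :=
  fun e => ∑ f ∈ monicTuples F (fun j => e j), residueTerm q H f

open Classical in
/-- The Euler factor `R_p`: the formal power series
`∑_a residueTerm (p ^ a_0, p ^ a_2, …) · x_0 ^ (a_0 deg p) · x_2 ^ (a_2 deg p) ⋯`. -/
def eulerFactor {n : ℕ} {F : Type*} [Field F] (q : ℕ) (H : (Fin (n + 1) → F[X]) → ℂ)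
    (p : PrimePoly F) : MvPowerSeries (Fin (n / 2 + 1)) ℂ :=
  fun e =>
    if ∀ j, p.1.natDegree ∣ e j then
      residueTerm q H (fun j => p.1 ^ (e j / p.1.natDegree))
    else 0

/-- `R` is the formal product of the power series `P i`: each coefficient of the finite partial
products is eventually equal to that of `R`. -/
def IsFormalProduct {ι σ : Type*} (P : ι → MvPowerSeries σ ℂ) (R : MvPowerSeries σ ℂ) : Prop :=
  ∀ e : σ →₀ ℕ, ∀ᶠ S : Finset ι in Filter.atTop,
    MvPowerSeries.coeff e (∏ i ∈ S, P i) = MvPowerSeries.coeff e R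

end AffineMDS

end

open Polynomial

noncomputable section

set_option linter.unusedSectionVars false

namespace AffineMDS

/-! ### Polynomials of bounded degree and monic polynomials. -/

section Enumeration

/-! Everything rests on functional equations in one variable `x_i`, the other arguments being fixed.
By twisted multiplicativity a sum over `f_i` alone is the `L`-series of a quadratic character times
finitely many local factors, one for each prime dividing the fixed entries
(`IsWeight.sliceSeries_step`).

Global functional equation (`SatisfiesAxioms.globalDual`). Let `M = a_{i-1} + a_{i+1}` and let `T`
be the generating series of the `c_a` in `x_i`, multiplied by `1 - q x_i` when `M` is even. Then `T`
is a polynomial of degree at most `2⌊M/2⌋`, symmetric under `x -> 1/(qx)`. The proof is an induction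
on the sum of the other exponents. The slice of a fixed tuple inherits its functional equation from
its local factors, which are known by induction unless the tuple consists of powers of a single
linear prime. The `q` exceptional tuples contribute, by the local-to-global principle, a reflection
of `T` under `q -> 1/q`. So the defect of the functional equation of `T` equals its own reflection,
while dominance puts all its terms strictly above the centre of reflection: it vanishes. The inputs
are quadratic reciprocity and the functional equation of quadratic `L`-series, both derived from a
Gauss sum that depends only on the degree of the modulus (`sum_residueChar_sq`).

Residue. It follows that the coefficients of `Z` are geometric in `a_i` once `a_i ≥ a_{i-1} +
a_{i+1}`. The residue is then well defined, and up to a power of `q` its coefficients are those of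
`Z` with `a_i = a_{i-1} + a_{i+1}` for all odd `i` (`formalResidue_eq`). To evaluate such a
coefficient, the functional equation replaces the pole `1/q` by the point `1`. There the trivial
zeros of `L`-series kill every nontrivial modulus, and what survives is the one weight with `f_i =
f_{i-1} f_{i+1}` (`IsWeight.sum_update_eq`). Odd indices are never cyclically adjacent, so this
applies to all of them in turn.

Multiplicativity. A local polynomial has degree less than `M` when `M` is odd, so a nonzero weight
on the diagonal forces every `f_{i-1} f_{i+1}` to be a square. The symbols in twisted
multiplicativity then cancel (`residueTuple_weight_mul`), and the Euler product follows from unique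
factorization. -/

theorem finite_polysLT (F : Type*) [Field F] [Finite F] (k : ℕ) :
    {f : F[X] | f.degree < k}.Finite := by
  have : Finite (Polynomial.degreeLT F k) := Finite.of_equiv _ (degreeLTEquiv F k).symm.toEquiv
  refine (Polynomial.degreeLT F k : Set F[X]).toFinite.subset fun f hf => ?_
  exact mem_degreeLT.2 hf

/-- The polynomials of degree less than `k`. -/
def polysLT (F : Type*) [Field F] [Finite F] (k : ℕ) : Finset F[X] :=
  (finite_polysLT F k).toFinset

theorem finite_monicPolys (F : Type*) [Field F] [Finite F] (k : ℕ) :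
    {f : F[X] | f.Monic ∧ f.natDegree = k}.Finite :=
  (finite_polysLT F (k + 1)).subset fun f hf =>
    lt_of_le_of_lt (natDegree_le_iff_degree_le.1 hf.2.le) (by exact_mod_cast Nat.lt_succ_self k)

/-- The monic polynomials of degree `k`. -/
def monicPolys (F : Type*) [Field F] [Finite F] (k : ℕ) : Finset F[X] :=
  (finite_monicPolys F k).toFinset

variable {F : Type*} [Field F] [Fintype F]

theorem mem_polysLT {k : ℕ} {f : F[X]} : f ∈ polysLT F k ↔ f.degree < k := by
  simp [polysLT]

theorem mem_monicPolys {k : ℕ} {f : F[X]} :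
    f ∈ monicPolys F k ↔ f.Monic ∧ f.natDegree = k := by
  simp [monicPolys]

theorem sum_polysLT_add {M : Type*} [AddCommMonoid M] (m k : ℕ) (φ : F[X] → M) :
    ∑ y ∈ polysLT F (m + k), φ y =
      ∑ w ∈ polysLT F k, ∑ v ∈ polysLT F m, φ (v + X ^ m * w) := by
  have hX : (X ^ m : F[X]).Monic := monic_X_pow m
  have hdX : (X ^ m : F[X]).degree = m := by simp
  rw [← Finset.sum_product']
  refine Finset.sum_nbij' (fun y => (y /ₘ X ^ m, y %ₘ X ^ m)) (fun z => z.2 + X ^ m * z.1)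
    ?_ ?_ ?_ ?_ ?_
  · intro y hy
    rw [mem_polysLT] at hy
    simp only [Finset.mem_product, mem_polysLT]
    constructor
    · by_cases h0 : y /ₘ X ^ m = 0
      · simp [h0]
      · have h1 : (X ^ m : F[X]).degree ≤ y.degree := by
          by_contra h
          exact h0 ((divByMonic_eq_zero_iff hX).2 (not_le.1 h))
        have h2 := degree_add_divByMonic hX h1
        rw [hdX] at h2
        rw [← h2, Nat.cast_add] at hy
        exact lt_of_add_lt_add_left hy
    · simpa [hdX] using degree_modByMonic_lt y hX
  · rintro ⟨w, v⟩ hz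
    simp only [Finset.mem_product, mem_polysLT] at hz ⊢
    refine lt_of_le_of_lt (degree_add_le _ _) (max_lt ?_ ?_)
    · exact lt_of_lt_of_le hz.2 (by exact_mod_cast Nat.le_add_right m k)
    · rw [degree_mul, hdX, Nat.cast_add]
      exact WithBot.add_lt_add_left (by simp) hz.1
  · intro y _
    exact modByMonic_add_div y _
  · rintro ⟨w, v⟩ hz
    simp only [Finset.mem_product, mem_polysLT] at hz
    have := div_modByMonic_unique (f := v + X ^ m * w) w v hX ⟨rfl, by rw [hdX]; exact hz.2⟩
    simp [this.1, this.2]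
  · intro y _
    rw [modByMonic_add_div y _]

theorem sum_polysLT_one {M : Type*} [AddCommMonoid M] (φ : F[X] → M) :
    ∑ y ∈ polysLT F 1, φ y = ∑ c : F, φ (C c) := by
  refine (Finset.sum_nbij' (fun c : F => C c) (fun y => y.coeff 0) ?_ ?_ ?_ ?_ ?_).symm
  · intro c _
    rw [mem_polysLT]
    exact lt_of_le_of_lt degree_C_le (by simp)
  · simp
  · simp
  · intro y hy
    rw [mem_polysLT] at hy
    refine (eq_C_of_natDegree_le_zero ?_).symm
    by_cases h0 : y = 0
    · simp [h0]
    · rw [degree_eq_natDegree h0] at hy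
      exact Nat.lt_succ_iff.1 (by exact_mod_cast hy)
  · simp

theorem polysLT_zero : polysLT F 0 = {0} := by
  ext f
  simp [mem_polysLT]

theorem card_polysLT (k : ℕ) : (polysLT F k).card = Fintype.card F ^ k := by
  induction k with
  | zero => simp [polysLT_zero]
  | succ k ih =>
    have := sum_polysLT_add (F := F) k 1 (fun _ => 1)
    rw [sum_polysLT_one] at this
    simp only [Finset.sum_const, smul_eq_mul, mul_one, ih, Finset.card_univ] at this
    rw [this]; ring

theorem sum_monicPolys {M : Type*} [AddCommMonoid M] (k : ℕ) (φ : F[X] → M) :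
    ∑ f ∈ monicPolys F k, φ f = ∑ r ∈ polysLT F k, φ (X ^ k + r) := by
  refine Finset.sum_nbij' (fun f => f - X ^ k) (fun r => X ^ k + r) ?_ ?_ ?_ ?_ ?_
  · intro f hf
    rw [mem_monicPolys] at hf
    rw [mem_polysLT]
    have hd : f.degree = k := by rw [degree_eq_natDegree hf.1.ne_zero, hf.2]
    rw [← hd]
    exact degree_sub_lt_left (by rw [hd]; simp) hf.1.ne_zero (by simp [hf.1.leadingCoeff])
  · intro r hr
    rw [mem_polysLT] at hr
    rw [mem_monicPolys]
    refine ⟨monic_X_pow_add hr, ?_⟩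
    rw [natDegree_add_eq_left_of_degree_lt (by simpa using hr), natDegree_X_pow]
  all_goals simp

/-- The new polynomials, of degree exactly `m`, are sorted by leading coefficient. Since `φ 0 = 0`,
the sum over `c` may include `c = 0`. -/
theorem sum_polysLT_succ {M : Type*} [AddCommMonoid M] (m : ℕ) {φ : F[X] → M} (h0 : φ 0 = 0) :
    ∑ y ∈ polysLT F (m + 1), φ y =
      ∑ y ∈ polysLT F m, φ y + ∑ c : F, ∑ f ∈ monicPolys F m, φ (C c * f) := by
  classical
  rw [sum_polysLT_add, sum_polysLT_one]
  rw [← Finset.add_sum_erase _ _ (Finset.mem_univ (0 : F))]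
  congr 1
  · simp
  · rw [← Finset.add_sum_erase _ _ (Finset.mem_univ (0 : F))]
    simp only [C_0, zero_mul, h0, Finset.sum_const_zero, zero_add]
    refine Finset.sum_congr rfl fun c hc => ?_
    have hc0 : c ≠ 0 := Finset.ne_of_mem_erase hc
    rw [sum_monicPolys]
    refine Finset.sum_nbij' (fun v => C c⁻¹ * v) (fun v => C c * v) ?_ ?_ ?_ ?_ ?_
    · intro v hv
      rw [mem_polysLT] at hv ⊢
      rwa [degree_C_mul (inv_ne_zero hc0)]
    · intro v hv
      rw [mem_polysLT] at hv ⊢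
      rwa [degree_C_mul hc0]
    · intro v _
      rw [← mul_assoc, ← C_mul, mul_inv_cancel₀ hc0, C_1, one_mul]
    · intro v _
      rw [← mul_assoc, ← C_mul, inv_mul_cancel₀ hc0, C_1, one_mul]
    · intro v _
      congr 1
      simp only [mul_add]
      rw [← mul_assoc (C c), ← C_mul, mul_inv_cancel₀ hc0, C_1, one_mul]
      ring

end Enumeration

/-! ### Additive characters of `F[t]` and the Gauss sum of squares. -/

section Characters

variable {F : Type*} [Field F] [Fintype F]

/-- The additive character `h ↦ ψ (coefficient of t⁻¹ in h / D)` of `F[t]`, trivial on multiples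
of `D`. -/
def residueChar (ψ : AddChar F ℂ) (D : F[X]) : AddChar F[X] ℂ :=
  ψ.compAddMonoidHom
    ((lcoeff F (D.natDegree - 1)).comp (Polynomial.modByMonicHom D)).toAddMonoidHom

theorem residueChar_apply (ψ : AddChar F ℂ) (D h : F[X]) :
    residueChar ψ D h = ψ ((h %ₘ D).coeff (D.natDegree - 1)) := rfl

theorem residueChar_of_dvd (ψ : AddChar F ℂ) {D h : F[X]} (hD : D.Monic) (hdvd : D ∣ h) :
    residueChar ψ D h = 1 := by
  rw [residueChar_apply, (modByMonic_eq_zero_iff_dvd hD).2 hdvd]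
  simp

theorem residueChar_of_degree_lt (ψ : AddChar F ℂ) {D h : F[X]} (hD : D.Monic)
    (h1 : h.degree < D.degree) : residueChar ψ D h = ψ (h.coeff (D.natDegree - 1)) := by
  rw [residueChar_apply, (modByMonic_eq_self_iff hD).2 h1]

theorem residueChar_eq_one (ψ : AddChar F ℂ) {D h : F[X]} (hD : D.Monic)
    (h1 : h.degree + 1 < D.degree) : residueChar ψ D h = 1 := by
  by_cases h0 : h = 0
  · rw [h0, AddChar.map_zero_eq_one]
  rw [degree_eq_natDegree h0, degree_eq_natDegree hD.ne_zero] at h1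
  have h2 : h.natDegree + 1 < D.natDegree := by exact_mod_cast h1
  rw [residueChar_of_degree_lt ψ hD (degree_lt_degree (by omega)),
    coeff_eq_zero_of_natDegree_lt (by omega), AddChar.map_zero_eq_one]

/-- The character depends only on the fraction, and `h E / (D E) = h / D`. -/
theorem residueChar_mul_mul (ψ : AddChar F ℂ) {D E : F[X]} (hD : D.Monic) (hE : E.Monic)
    (h : F[X]) : residueChar ψ (D * E) (h * E) = residueChar ψ D h := by
  by_cases hD1 : D = 1
  · rw [residueChar_of_dvd ψ (hD.mul hE) (by simp [hD1]), residueChar_of_dvd ψ hD (by simp [hD1])]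
  have hN : D.natDegree ≠ 0 := fun h => hD1 (hD.natDegree_eq_zero.1 h)
  have hmod : (h * E) %ₘ (D * E) = (h %ₘ D) * E := by
    refine (div_modByMonic_unique (h /ₘ D) _ (hD.mul hE) ⟨?_, ?_⟩).2
    · conv_rhs => rw [← modByMonic_add_div h D]
      ring
    · rw [degree_mul, degree_mul]
      refine WithBot.add_lt_add_right ?_ (degree_modByMonic_lt h hD)
      simpa using hE.ne_zero
  rw [residueChar_apply, residueChar_apply, hmod, hD.natDegree_mul hE]
  congr 1
  have hr : (h %ₘ D).natDegree ≤ D.natDegree - 1 := by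
    have := natDegree_modByMonic_lt h hD hD1
    omega
  rw [show D.natDegree + E.natDegree - 1 = (D.natDegree - 1) + E.natDegree by omega,
    coeff_mul_add_eq_of_natDegree_le hr le_rfl, hE.coeff_natDegree, mul_one]

theorem sum_residueChar_eq_pow (ψ : AddChar F ℂ) {D h : F[X]} (hD : D.Monic) {k : ℕ}
    (h1 : h = 0 ∨ h.natDegree + k < D.natDegree) :
    ∑ r ∈ polysLT F k, residueChar ψ D (r * h) = (Fintype.card F : ℂ) ^ k := by
  rw [Finset.sum_congr rfl (g := fun _ => (1 : ℂ))]
  · simp [card_polysLT]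
  · intro r hr
    rw [mem_polysLT] at hr
    rcases h1 with rfl | h1
    · simp
    by_cases hr0 : r = 0
    · simp [hr0]
    by_cases hh0 : h = 0
    · simp [hh0]
    refine residueChar_eq_one ψ hD ?_
    rw [degree_eq_natDegree hr0] at hr
    have hr' : r.natDegree < k := by exact_mod_cast hr
    rw [degree_mul, degree_eq_natDegree hr0, degree_eq_natDegree hh0,
      degree_eq_natDegree hD.ne_zero]
    norm_cast
    omega

theorem exists_apply_mul_ne_one {ψ : AddChar F ℂ} (hψ : ψ ≠ 1) {a : F} (ha : a ≠ 0) :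
    ∃ c, ψ (c * a) ≠ 1 := by
  obtain ⟨x, hx⟩ := (AddChar.ne_one_iff).1 hψ
  exact ⟨x * a⁻¹, by rwa [inv_mul_cancel_right₀ ha]⟩

/-- Orthogonality: the range of `r` is wide enough to contain a shift that multiplies the sum by a
value other than `1`. -/
theorem sum_residueChar_eq_zero {ψ : AddChar F ℂ} (hψ : ψ ≠ 1) {D h : F[X]} (hD : D.Monic)
    {k : ℕ} (h0 : h ≠ 0) (h1 : h.natDegree < D.natDegree) (h2 : D.natDegree ≤ h.natDegree + k) :
    ∑ r ∈ polysLT F k, residueChar ψ D (r * h) = 0 := by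
  obtain ⟨c, hc⟩ := exists_apply_mul_ne_one hψ (leadingCoeff_ne_zero.2 h0)
  -- With this exponent `r₀ * h` has degree at most `D.natDegree - 1`, exactly the coefficient that
  -- the character reads.
  set j := D.natDegree - 1 - h.natDegree with hj
  set r₀ : F[X] := C c * X ^ j with hr₀
  have hmem : r₀ ∈ polysLT F k := by
    rw [mem_polysLT]
    refine lt_of_le_of_lt (degree_C_mul_X_pow_le _ _) ?_
    exact_mod_cast (by omega : j < k)
  have hval : residueChar ψ D (r₀ * h) ≠ 1 := by
    have hdeg : (r₀ * h).natDegree < D.natDegree := by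
      refine lt_of_le_of_lt (natDegree_mul_le) ?_
      have : r₀.natDegree ≤ j := natDegree_C_mul_X_pow_le c j
      omega
    rw [residueChar_of_degree_lt ψ hD (degree_lt_degree hdeg), hr₀, mul_assoc, coeff_C_mul,
      show D.natDegree - 1 = h.natDegree + j by omega, coeff_X_pow_mul]
    exact hc
  have hshift : ∑ r ∈ polysLT F k, residueChar ψ D (r * h) =
      residueChar ψ D (r₀ * h) * ∑ r ∈ polysLT F k, residueChar ψ D (r * h) := by
    rw [Finset.mul_sum]
    refine Finset.sum_nbij' (fun r => r - r₀) (fun r => r + r₀) ?_ ?_ ?_ ?_ ?_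
    · intro r hr
      rw [mem_polysLT] at *
      exact lt_of_le_of_lt (degree_sub_le _ _) (max_lt hr hmem)
    · intro r hr
      rw [mem_polysLT] at *
      exact lt_of_le_of_lt (degree_add_le _ _) (max_lt hr hmem)
    · simp
    · simp
    · intro r _
      rw [← AddChar.map_add_eq_mul]
      congr 1
      ring
  have h3 : (1 - residueChar ψ D (r₀ * h)) *
      ∑ r ∈ polysLT F k, residueChar ψ D (r * h) = 0 := by
    rw [sub_mul, one_mul, ← hshift, sub_self]
  exact (mul_eq_zero.1 h3).resolve_left (sub_ne_zero.2 (Ne.symm hval))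

/-- The quadratic Gauss sum of a monic polynomial of degree `N`. -/
def gaussValue (ψ : AddChar F ℂ) (N : ℕ) : ℂ :=
  (Fintype.card F : ℂ) ^ (N / 2) * if Even N then 1 else ∑ c : F, ψ (c ^ 2)

/-- Let `N = 2m + ε` be the degree of `D` and write `y = v + X ^ m * w` with `deg v < m`. The square
of `v` is too small to be seen by the character, so `y ^ 2` is effectively affine in `v`. Summing
over `v` then kills every `w` of degree at least `ε`. No coefficient of `D` below the leading one
enters what remains. -/
theorem sum_residueChar_sq {ψ : AddChar F ℂ} (hψ : ψ ≠ 1) (h2 : (2 : F) ≠ 0) {D : F[X]}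
    (hD : D.Monic) :
    ∑ y ∈ polysLT F D.natDegree, residueChar ψ D (y ^ 2) = gaussValue ψ D.natDegree := by
  obtain ⟨m, ε, hε, hN⟩ : ∃ m ε, ε < 2 ∧ D.natDegree = m + (ε + m) :=
    ⟨D.natDegree / 2, D.natDegree % 2, Nat.mod_lt _ two_pos, by omega⟩
  have hinner : ∀ w ∈ polysLT F (ε + m),
      ∑ v ∈ polysLT F m, residueChar ψ D ((v + X ^ m * w) ^ 2) =
        residueChar ψ D ((X ^ m * w) ^ 2) *
          ∑ v ∈ polysLT F m, residueChar ψ D (v * (C 2 * X ^ m * w)) := by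
    intro w _
    rw [Finset.mul_sum]
    refine Finset.sum_congr rfl fun v hv => ?_
    rw [show (v + X ^ m * w) ^ 2 = v ^ 2 + ((X ^ m * w) ^ 2 + v * (C 2 * X ^ m * w)) by
      rw [show (C 2 : F[X]) = 2 from rfl]; ring, AddChar.map_add_eq_mul, AddChar.map_add_eq_mul]
    rw [residueChar_eq_one ψ hD, one_mul]
    by_cases hv0 : v = 0
    · rw [hv0]
      simp [hD.ne_zero, bot_lt_iff_ne_bot]
    rw [mem_polysLT, degree_eq_natDegree hv0] at hv
    have hv' : v.natDegree < m := by exact_mod_cast hv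
    rw [degree_pow, degree_eq_natDegree hv0, degree_eq_natDegree hD.ne_zero, hN]
    simp only [nsmul_eq_mul]
    norm_cast
    omega
  have hnd : ∀ w : F[X], w ≠ 0 → (C 2 * X ^ m * w).natDegree = m + w.natDegree := by
    intro w hw
    rw [mul_assoc, natDegree_C_mul h2, natDegree_mul (pow_ne_zero _ X_ne_zero) hw, natDegree_X_pow]
  rw [gaussValue]
  conv_lhs => rw [hN]
  rw [sum_polysLT_add, Finset.sum_congr rfl hinner, sum_polysLT_add]
  have hzero : ∀ w ∈ polysLT F m, w ≠ 0 → ∀ v ∈ polysLT F ε,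
      residueChar ψ D ((X ^ m * (v + X ^ ε * w)) ^ 2) *
          ∑ x ∈ polysLT F m, residueChar ψ D (x * (C 2 * X ^ m * (v + X ^ ε * w))) = 0 := by
    intro w hw hw0 v hv
    rw [mem_polysLT] at hw hv
    rw [degree_eq_natDegree hw0] at hw
    have hw' : w.natDegree < m := by exact_mod_cast hw
    have hlt : v.degree < (X ^ ε * w).degree := by
      refine lt_of_lt_of_le hv ?_
      rw [degree_mul, degree_X_pow, degree_eq_natDegree hw0]
      exact_mod_cast Nat.le_add_right _ _
    have hne : v + X ^ ε * w ≠ 0 := by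
      intro h
      have := degree_add_eq_right_of_degree_lt hlt
      rw [h, degree_zero] at this
      rw [← this] at hlt
      exact not_lt_bot hlt
    have hdeg : (v + X ^ ε * w).natDegree = ε + w.natDegree := by
      rw [natDegree_add_eq_right_of_degree_lt hlt, natDegree_mul (pow_ne_zero _ X_ne_zero) hw0,
        natDegree_X_pow]
    rw [sum_residueChar_eq_zero hψ hD, mul_zero]
    · exact mul_ne_zero (mul_ne_zero (by simpa using h2) (pow_ne_zero _ X_ne_zero)) hne
    · rw [hnd _ hne, hdeg, hN]; omega
    · rw [hnd _ hne, hdeg, hN]; omega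
  rw [Finset.sum_eq_single_of_mem 0 (by simp [mem_polysLT, bot_lt_iff_ne_bot])
    (fun w hw hw0 => Finset.sum_eq_zero (hzero w hw hw0))]
  -- Only `w` of degree less than `ε` is left: zero when the degree of `D` is even, the constants
  -- when it is odd, which give the Gauss sum of the field `F`.
  interval_cases ε
  · have : Even D.natDegree := ⟨m, by omega⟩
    rw [if_pos this, polysLT_zero, Finset.sum_singleton, show D.natDegree / 2 = m by omega]
    simp [card_polysLT]
  · have : ¬ Even D.natDegree := by rw [Nat.even_iff]; omega
    rw [if_neg this, show D.natDegree / 2 = m by omega, sum_polysLT_one, Finset.mul_sum]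
    refine Finset.sum_congr rfl fun c _ => ?_
    rw [mul_zero, add_zero, sum_residueChar_eq_pow ψ hD, mul_comm]
    · congr 1
      have hle : ((X ^ m * C c : F[X]) ^ 2).natDegree < D.natDegree := by
        rw [show (X ^ m * C c : F[X]) ^ 2 = C (c ^ 2) * X ^ (2 * m) by rw [C_pow]; ring]
        exact lt_of_le_of_lt (natDegree_C_mul_X_pow_le _ _) (by omega)
      rw [residueChar_of_degree_lt ψ hD (degree_lt_degree hle),
        show (X ^ m * C c : F[X]) ^ 2 = C (c ^ 2) * X ^ (2 * m) by rw [C_pow]; ring,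
        coeff_C_mul_X_pow, if_pos (by omega)]
    · by_cases hc : c = 0
      · left; simp [hc]
      · right
        rw [hnd _ (by simpa using hc), natDegree_C]
        omega

end Characters

/-! ### Quadratic Gauss sums over a finite field. -/

section FiniteFieldSums

variable {K : Type*} [Field K] [Fintype K] [DecidableEq K]

/-- An element `a` has `1 + χ(a)` square roots, and the values of a nontrivial `ψ` sum to zero. -/
theorem sum_addChar_sq (hK : ringChar K ≠ 2) {ψ : AddChar K ℂ} (hψ : ψ ≠ 1) :
    ∑ z, ψ (z ^ 2) = ∑ z, (quadraticChar K z : ℂ) * ψ z := by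
  have h1 : ∑ z, ψ (z ^ 2) = ∑ a, ∑ z ∈ Finset.univ.filter (fun z : K => z ^ 2 = a), ψ (z ^ 2) :=
    (Finset.sum_fiberwise_of_maps_to (fun _ _ => Finset.mem_univ _) _).symm
  have h2 : ∀ a, ∑ z ∈ Finset.univ.filter (fun z : K => z ^ 2 = a), ψ (z ^ 2) =
      (quadraticChar K a : ℂ) * ψ a + ψ a := by
    intro a
    have hc := quadraticChar_card_sqrts hK a
    have hs : {x : K | x ^ 2 = a}.toFinset = Finset.univ.filter (fun z : K => z ^ 2 = a) := by
      ext; simp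
    rw [hs] at hc
    rw [Finset.sum_congr rfl (g := fun _ => ψ a)
      (fun z hz => by rw [(Finset.mem_filter.1 hz).2])]
    rw [Finset.sum_const, nsmul_eq_mul, ← Int.cast_natCast, hc]
    push_cast
    ring
  rw [h1, Finset.sum_congr rfl fun a _ => h2 a, Finset.sum_add_distrib,
    AddChar.sum_eq_zero_of_ne_one hψ, add_zero]

theorem sum_quadraticChar_mul_addChar (hK : ringChar K ≠ 2) (ψ : AddChar K ℂ) (a : K) :
    ∑ z, (quadraticChar K z : ℂ) * ψ (a * z) =
      (quadraticChar K a : ℂ) * ∑ z, (quadraticChar K z : ℂ) * ψ z := by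
  by_cases ha : a = 0
  · have := quadraticChar_sum_zero hK
    simp only [ha, zero_mul, AddChar.map_zero_eq_one, mul_one, quadraticChar_zero, Int.cast_zero]
    exact_mod_cast this
  · rw [Finset.mul_sum]
    refine Finset.sum_bij' (fun z _ => a * z) (fun z _ => a⁻¹ * z) ?_ ?_ ?_ ?_ ?_
    · simp
    · simp
    · intro z _; exact inv_mul_cancel_left₀ ha z
    · intro z _; exact mul_inv_cancel_left₀ ha z
    · intro z _
      have h1 := quadraticChar_sq_one ha
      rw [map_mul (quadraticChar K)]
      push_cast
      have h1' : (quadraticChar K a : ℂ) ^ 2 = 1 := by exact_mod_cast h1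
      linear_combination (-(quadraticChar K z : ℂ) * ψ (a * z)) * h1'

theorem mulShift_ne_one {ψ : AddChar K ℂ} (hψ : ψ ≠ 1) {a : K} (ha : a ≠ 0) :
    ψ.mulShift a ≠ 1 := by
  obtain ⟨x, hx⟩ := (AddChar.ne_one_iff).1 hψ
  exact AddChar.ne_one_iff.2 ⟨a⁻¹ * x, by rwa [AddChar.mulShift_apply, mul_inv_cancel_left₀ ha]⟩

theorem sum_addChar_mul_sq (hK : ringChar K ≠ 2) {ψ : AddChar K ℂ} (hψ : ψ ≠ 1) {a : K}
    (ha : a ≠ 0) : ∑ z, ψ (a * z ^ 2) = (quadraticChar K a : ℂ) * ∑ z, ψ (z ^ 2) := by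
  have h1 := sum_addChar_sq hK (mulShift_ne_one hψ ha)
  simp only [AddChar.mulShift_apply] at h1
  rw [h1, sum_addChar_sq hK hψ, sum_quadraticChar_mul_addChar hK]

theorem ringChar_ne_two (h2 : (2 : K) ≠ 0) : ringChar K ≠ 2 := by
  intro h
  have := ringChar.Nat.cast_ringChar (R := K)
  rw [h] at this
  exact h2 (by exact_mod_cast this)

theorem two_ne_zero_of_card (hK : Fintype.card K % 4 = 1) : (2 : K) ≠ 0 := by
  refine Ring.two_ne_zero fun h => ?_
  have := FiniteField.even_card_iff_char_two.1 h
  omega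

/-- The square of the Gauss sum is `χ(-1) q`, and `-1` is a square because `q ≡ 1 mod 4`. -/
theorem sq_sum_addChar_sq (hK : Fintype.card K % 4 = 1) {ψ : AddChar K ℂ} (hψ : ψ ≠ 1) :
    (∑ z, ψ (z ^ 2)) ^ 2 = Fintype.card K := by
  have hc := ringChar_ne_two (two_ne_zero_of_card hK)
  have hne : (quadraticChar K).ringHomComp (Int.castRingHom ℂ) ≠ 1 := by
    rw [MulChar.ringHomComp_ne_one_iff (RingHom.injective_int _)]
    exact quadraticChar_ne_one hc
  have hq : ((quadraticChar K).ringHomComp (Int.castRingHom ℂ)).IsQuadratic :=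
    (quadraticChar_isQuadratic K).comp _
  have h := gaussSum_sq hne hq (AddChar.IsPrimitive.of_ne_one hψ)
  rw [sum_addChar_sq hc hψ]
  rw [gaussSum] at h
  simp only [MulChar.ringHomComp_apply, Int.coe_castRingHom] at h
  rw [h]
  have h1 : quadraticChar K (-1) = 1 := by
    rw [quadraticChar_one_iff_isSquare (neg_ne_zero.2 one_ne_zero),
      FiniteField.isSquare_neg_one_iff]
    omega
  rw [h1]
  simp

/-- Only two odd degrees need an argument: there the square of the Gauss sum of the field supplies
the missing `q`. This sign-free identity is what makes reciprocity hold without a sign. -/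
theorem gaussValue_mul (hK : Fintype.card K % 4 = 1) {ψ : AddChar K ℂ} (hψ : ψ ≠ 1) (M N : ℕ) :
    gaussValue ψ M * gaussValue ψ N = gaussValue ψ (M + N) := by
  have hs := sq_sum_addChar_sq hK hψ
  unfold gaussValue
  set τ := ∑ c : K, ψ (c ^ 2)
  rcases Nat.even_or_odd M with hM | hM <;> rcases Nat.even_or_odd N with hN | hN
  · rw [if_pos hM, if_pos hN, if_pos (hM.add hN)]
    rw [Nat.even_iff] at hM hN
    rw [show (M + N) / 2 = M / 2 + N / 2 by omega, pow_add]; ring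
  · rw [if_pos hM, if_neg (Nat.not_even_iff_odd.2 hN), if_neg (Nat.not_even_iff_odd.2 (hM.add_odd hN))]
    rw [Nat.even_iff] at hM; rw [Nat.odd_iff] at hN
    rw [show (M + N) / 2 = M / 2 + N / 2 by omega, pow_add]; ring
  · rw [if_pos hN, if_neg (Nat.not_even_iff_odd.2 hM), if_neg (Nat.not_even_iff_odd.2 (hM.add_even hN))]
    rw [Nat.even_iff] at hN; rw [Nat.odd_iff] at hM
    rw [show (M + N) / 2 = M / 2 + N / 2 by omega, pow_add]; ring
  · rw [if_neg (Nat.not_even_iff_odd.2 hM), if_neg (Nat.not_even_iff_odd.2 hN), if_pos (hM.add_odd hN)]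
    rw [Nat.odd_iff] at hM hN
    rw [show (M + N) / 2 = M / 2 + N / 2 + 1 by omega, pow_add, pow_add, pow_one, ← hs]; ring

theorem gaussValue_ne_zero (hK : Fintype.card K % 4 = 1) {ψ : AddChar K ℂ} (hψ : ψ ≠ 1) (N : ℕ) :
    gaussValue ψ N ≠ 0 := by
  intro h
  have := gaussValue_mul hK hψ N N
  rw [h, zero_mul, gaussValue, if_pos ⟨N, rfl⟩, mul_one] at this
  exact pow_ne_zero _ (by simp) this.symm

end FiniteFieldSums

/-! ### The quadratic symbol: Gauss sums and reciprocity. -/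

section ResidueSymbol

open scoped Classical

variable {F : Type*} [Field F] [Fintype F]

theorem monic_irreducible_of_mem {p g : F[X]}
    (hp : p ∈ UniqueFactorizationMonoid.normalizedFactors g) : p.Monic ∧ Irreducible p := by
  have h1 := UniqueFactorizationMonoid.irreducible_of_normalized_factor p hp
  have h2 := UniqueFactorizationMonoid.normalize_normalized_factor p hp
  exact ⟨h2 ▸ monic_normalize h1.ne_zero, h1⟩

theorem monic_induction {P : F[X] → Prop} (h1 : P 1)
    (hmul : ∀ p f : F[X], p.Monic → Irreducible p → f.Monic → P f → P (p * f)) (f : F[X])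
    (hf : f.Monic) : P f := by
  induction hd : f.natDegree using Nat.strong_induction_on generalizing f with
  | _ d ih =>
    by_cases hu : IsUnit f
    · rwa [hf.eq_one_of_isUnit hu]
    · obtain ⟨p, hpm, hpi, g, rfl⟩ := exists_monic_irreducible_factor f hu
      have hg : g.Monic := hpm.of_mul_monic_left hf
      refine hmul p g hpm hpi hg (ih g.natDegree ?_ g hg rfl)
      rw [← hd, hpm.natDegree_mul hg]
      have := hpi.natDegree_pos
      omega

theorem residueSymbol_one_right (f : F[X]) : residueSymbol f 1 = 1 := by
  simp [residueSymbol]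

theorem residueSymbol_mul_right (f : F[X]) {g h : F[X]} (hg : g ≠ 0) (hh : h ≠ 0) :
    residueSymbol f (g * h) = residueSymbol f g * residueSymbol f h := by
  rw [residueSymbol, UniqueFactorizationMonoid.normalizedFactors_mul hg hh, Multiset.map_add,
    Multiset.prod_add]
  rfl

theorem residueSymbol_prime (f : F[X]) {p : F[X]} (hp : p.Monic) (hi : Irreducible p) :
    residueSymbol f p = primeResidueSymbol f p := by
  rw [residueSymbol, UniqueFactorizationMonoid.normalizedFactors_irreducible hi,
    hp.normalize_eq_self]
  simp

section Prime

variable {p : F[X]} [Fact (Irreducible p)]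

theorem exists_polysLT_mk (hp : p.Monic) (z : AdjoinRoot p) :
    ∃ y ∈ polysLT F p.natDegree, AdjoinRoot.mk p y = z := by
  refine ⟨AdjoinRoot.modByMonicHom hp z, ?_, AdjoinRoot.mk_leftInverse hp z⟩
  obtain ⟨f, rfl⟩ := AdjoinRoot.mk_surjective z
  rw [AdjoinRoot.modByMonicHom_mk, mem_polysLT, ← degree_eq_natDegree hp.ne_zero]
  exact degree_modByMonic_lt f hp

theorem finite_adjoinRoot (hp : p.Monic) : Finite (AdjoinRoot p) := by
  refine Finite.of_surjective (fun y : polysLT F p.natDegree => AdjoinRoot.mk p y.1) fun z => ?_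
  obtain ⟨y, hy, hz⟩ := exists_polysLT_mk hp z
  exact ⟨⟨y, hy⟩, hz⟩

theorem sum_polysLT_mk [Fintype (AdjoinRoot p)] (hp : p.Monic) (φ : AdjoinRoot p → ℂ) :
    ∑ y ∈ polysLT F p.natDegree, φ (AdjoinRoot.mk p y) = ∑ z, φ z := by
  refine Finset.sum_bij (fun y _ => AdjoinRoot.mk p y) (fun _ _ => Finset.mem_univ _) ?_ ?_
    (fun _ _ => rfl)
  · intro a ha b hb hab
    rw [mem_polysLT, ← degree_eq_natDegree hp.ne_zero] at ha hb
    rw [AdjoinRoot.mk_eq_mk] at hab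
    exact sub_eq_zero.1 (eq_zero_of_dvd_of_degree_lt hab
      (lt_of_le_of_lt (degree_sub_le _ _) (max_lt ha hb)))
  · intro z _
    obtain ⟨y, hy, hz⟩ := exists_polysLT_mk hp z
    exact ⟨y, hy, hz⟩

theorem primeResidueSymbol_eq_quadraticChar [Fintype (AdjoinRoot p)]
    (f : F[X]) : primeResidueSymbol f p = quadraticChar (AdjoinRoot p) (AdjoinRoot.mk p f) := by
  rw [primeResidueSymbol]
  by_cases h0 : p ∣ f
  · rw [if_pos h0, AdjoinRoot.mk_eq_zero.2 h0, quadraticChar_zero]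
  · have hne : AdjoinRoot.mk p f ≠ 0 := fun h => h0 (AdjoinRoot.mk_eq_zero.1 h)
    have hiff : (∃ h : F[X], p ∣ f - h ^ 2) ↔ IsSquare (AdjoinRoot.mk p f) := by
      constructor
      · rintro ⟨h, hh⟩
        refine ⟨AdjoinRoot.mk p h, ?_⟩
        rw [← map_mul, ← pow_two]
        exact AdjoinRoot.mk_eq_mk.2 hh
      · rintro ⟨z, hz⟩
        obtain ⟨h, rfl⟩ := AdjoinRoot.mk_surjective z
        rw [← map_mul, ← pow_two] at hz
        exact ⟨h, AdjoinRoot.mk_eq_mk.1 hz⟩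
    rw [if_neg h0]
    by_cases hs : IsSquare (AdjoinRoot.mk p f)
    · rw [if_pos (hiff.2 hs), (quadraticChar_one_iff_isSquare hne).2 hs]
    · rw [if_neg (fun h => hs (hiff.1 h)), quadraticChar_neg_one_iff_not_isSquare.2 hs]

/-- The additive character of `F[t]/p` induced by `residueChar ψ p`. -/
def adjoinRootChar (ψ : AddChar F ℂ) (hp : p.Monic) : AddChar (AdjoinRoot p) ℂ :=
  ψ.compAddMonoidHom
    ((lcoeff F (p.natDegree - 1)).comp (AdjoinRoot.modByMonicHom hp)).toAddMonoidHom

theorem adjoinRootChar_mk (ψ : AddChar F ℂ) (hp : p.Monic) (h : F[X]) :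
    adjoinRootChar ψ hp (AdjoinRoot.mk p h) = residueChar ψ p h := rfl

theorem adjoinRootChar_ne_one {ψ : AddChar F ℂ} (hψ : ψ ≠ 1) (hp : p.Monic)
    (hi : Irreducible p) : adjoinRootChar ψ hp ≠ 1 := by
  obtain ⟨c, hc⟩ := AddChar.ne_one_iff.1 hψ
  have hd := hi.natDegree_pos
  refine AddChar.ne_one_iff.2 ⟨AdjoinRoot.mk p (C c * X ^ (p.natDegree - 1)), ?_⟩
  rw [adjoinRootChar_mk, residueChar_of_degree_lt ψ hp (degree_lt_degree
    (lt_of_le_of_lt (natDegree_C_mul_X_pow_le _ _) (by omega)))]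
  simpa using hc

theorem two_ne_zero_adjoinRoot (h2 : (2 : F) ≠ 0) : (2 : AdjoinRoot p) ≠ 0 := by
  have := (map_ne_zero (AdjoinRoot.of p)).2 h2
  rwa [map_ofNat] at this

end Prime

variable (hq : Fintype.card F % 4 = 1) {ψ : AddChar F ℂ} (hψ : ψ ≠ 1)

include hψ hq

/-- In the finite field `F[t]/p` the sum against the quadratic character is a sum of `ψ` over
squares, and `sum_residueChar_sq` evaluates the latter. -/
theorem sum_symbol_mul_residueChar_prime {p : F[X]} (hp : p.Monic) (hi : Irreducible p)
    (f : F[X]) :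
    ∑ h ∈ polysLT F p.natDegree, (residueSymbol h p : ℂ) * residueChar ψ p (f * h) =
      residueSymbol f p * gaussValue ψ p.natDegree := by
  have h2 := two_ne_zero_of_card hq
  have : Fact (Irreducible p) := ⟨hi⟩
  have := finite_adjoinRoot hp
  let := Fintype.ofFinite (AdjoinRoot p)
  have hc := ringChar_ne_two (two_ne_zero_adjoinRoot (p := p) h2)
  have hne := adjoinRootChar_ne_one hψ hp hi
  have hs := sum_addChar_sq hc hne
  rw [← sum_polysLT_mk hp fun z => adjoinRootChar ψ hp (z ^ 2)] at hs
  simp only [← map_pow, adjoinRootChar_mk] at hs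
  rw [sum_residueChar_sq hψ h2 hp] at hs
  rw [residueSymbol_prime f hp hi, primeResidueSymbol_eq_quadraticChar, hs,
    ← sum_quadraticChar_mul_addChar hc, ← sum_polysLT_mk hp]
  refine Finset.sum_congr rfl fun h _ => ?_
  rw [residueSymbol_prime h hp hi, primeResidueSymbol_eq_quadraticChar, ← map_mul,
    adjoinRootChar_mk]

theorem sum_residueChar_mul_sq {p : F[X]} (hp : p.Monic) (hi : Irreducible p)
    {f : F[X]} (hf : ¬ p ∣ f) :
    ∑ y ∈ polysLT F p.natDegree, residueChar ψ p (f * y ^ 2) =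
      residueSymbol f p * gaussValue ψ p.natDegree := by
  have h2 := two_ne_zero_of_card hq
  have : Fact (Irreducible p) := ⟨hi⟩
  have := finite_adjoinRoot hp
  let := Fintype.ofFinite (AdjoinRoot p)
  have hc := ringChar_ne_two (two_ne_zero_adjoinRoot (p := p) h2)
  have hne := adjoinRootChar_ne_one hψ hp hi
  have hf' : AdjoinRoot.mk p f ≠ 0 := fun h => hf (AdjoinRoot.mk_eq_zero.1 h)
  have hs := sum_addChar_mul_sq hc hne hf'
  rw [← sum_polysLT_mk hp fun z => adjoinRootChar ψ hp (z ^ 2),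
    ← sum_polysLT_mk hp fun z => adjoinRootChar ψ hp (AdjoinRoot.mk p f * z ^ 2)] at hs
  simp only [← map_pow, ← map_mul, adjoinRootChar_mk] at hs
  rw [hs, residueSymbol_prime f hp hi, primeResidueSymbol_eq_quadraticChar,
    sum_residueChar_sq hψ h2 hp]

omit hψ hq

/-- The Chinese remainder theorem in the form of partial fractions, `a / D + b / E = (a E + b D) /
(D E)`: the map is injective and both sides have the same cardinality. -/
theorem sum_polysLT_coprime {D E : F[X]} (hD : D.Monic) (hE : E.Monic) (hDE : IsCoprime D E)
    (φ : F[X] → ℂ) :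
    ∑ y ∈ polysLT F (D * E).natDegree, φ y =
      ∑ a ∈ polysLT F D.natDegree, ∑ b ∈ polysLT F E.natDegree, φ (a * E + b * D) := by
  have hinj : Set.InjOn (fun z : F[X] × F[X] => z.1 * E + z.2 * D)
      (polysLT F D.natDegree ×ˢ polysLT F E.natDegree : Finset (F[X] × F[X])) := by
    rintro ⟨a, b⟩ h1 ⟨a', b'⟩ h2 h
    simp only [Finset.coe_product, Set.mem_prod, Finset.mem_coe, mem_polysLT,
      ← degree_eq_natDegree hD.ne_zero, ← degree_eq_natDegree hE.ne_zero] at h1 h2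
    simp only at h
    have ha : D ∣ (a - a') * E := ⟨b' - b, by linear_combination h⟩
    have hb : E ∣ (b - b') * D := ⟨a' - a, by linear_combination h⟩
    have ha' := eq_zero_of_dvd_of_degree_lt (hDE.dvd_of_dvd_mul_right ha)
      (lt_of_le_of_lt (degree_sub_le _ _) (max_lt h1.1 h2.1))
    have hb' := eq_zero_of_dvd_of_degree_lt (hDE.symm.dvd_of_dvd_mul_right hb)
      (lt_of_le_of_lt (degree_sub_le _ _) (max_lt h1.2 h2.2))
    rw [sub_eq_zero.1 ha', sub_eq_zero.1 hb']
  have himg : (polysLT F D.natDegree ×ˢ polysLT F E.natDegree).image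
      (fun z : F[X] × F[X] => z.1 * E + z.2 * D) = polysLT F (D * E).natDegree := by
    refine Finset.eq_of_subset_of_card_le ?_ ?_
    · intro y hy
      obtain ⟨⟨a, b⟩, h, rfl⟩ := Finset.mem_image.1 hy
      simp only [Finset.mem_product, mem_polysLT, ← degree_eq_natDegree hD.ne_zero,
        ← degree_eq_natDegree hE.ne_zero] at h
      rw [mem_polysLT, ← degree_eq_natDegree (hD.mul hE).ne_zero]
      refine lt_of_le_of_lt (degree_add_le _ _) (max_lt ?_ ?_)
      · rw [degree_mul, degree_mul]
        exact WithBot.add_lt_add_right (by simpa using hE.ne_zero) h.1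
      · rw [degree_mul, degree_mul, add_comm D.degree]
        exact WithBot.add_lt_add_right (by simpa using hD.ne_zero) h.2
    · rw [Finset.card_image_of_injOn hinj, Finset.card_product]
      simp only [card_polysLT, hD.natDegree_mul hE, pow_add, le_refl]
  rw [← himg, Finset.sum_image hinj, Finset.sum_product]

theorem residueChar_coprime (ψ : AddChar F ℂ) {D E : F[X]} (hD : D.Monic) (hE : E.Monic)
    (a b : F[X]) : residueChar ψ (D * E) (a * E + b * D) =
      residueChar ψ D a * residueChar ψ E b := by
  rw [AddChar.map_add_eq_mul, residueChar_mul_mul ψ hD hE, mul_comm D E,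
    residueChar_mul_mul ψ hE hD]

theorem exists_addChar_ne_one (F : Type*) [Field F] [Fintype F] : ∃ ψ : AddChar F ℂ, ψ ≠ 1 := by
  obtain ⟨ψ, hψ⟩ := (AddChar.exists_apply_ne_zero (α := F) (a := 1)).2 one_ne_zero
  exact ⟨ψ, AddChar.ne_one_iff.2 ⟨1, hψ⟩⟩

theorem primeResidueSymbol_mul (f g : F[X]) {p : F[X]} (hp : p.Monic) (hi : Irreducible p) :
    primeResidueSymbol (f * g) p = primeResidueSymbol f p * primeResidueSymbol g p := by
  have : Fact (Irreducible p) := ⟨hi⟩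
  have := finite_adjoinRoot hp
  let := Fintype.ofFinite (AdjoinRoot p)
  simp only [primeResidueSymbol_eq_quadraticChar, map_mul]

theorem residueSymbol_mul_left (f g h : F[X]) :
    residueSymbol (f * g) h = residueSymbol f h * residueSymbol g h := by
  rw [residueSymbol, residueSymbol, residueSymbol, ← Multiset.prod_map_mul]
  refine congrArg Multiset.prod (Multiset.map_congr rfl fun p hp => ?_)
  obtain ⟨h1, h2⟩ := monic_irreducible_of_mem hp
  exact primeResidueSymbol_mul f g h1 h2

theorem residueSymbol_congr {f g h : F[X]} (hdvd : h ∣ f - g) :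
    residueSymbol f h = residueSymbol g h := by
  rw [residueSymbol, residueSymbol]
  refine congrArg Multiset.prod (Multiset.map_congr rfl fun p hp => ?_)
  obtain ⟨h1, hi⟩ := monic_irreducible_of_mem hp
  have : Fact (Irreducible p) := ⟨hi⟩
  have := finite_adjoinRoot h1
  let := Fintype.ofFinite (AdjoinRoot p)
  simp only [primeResidueSymbol_eq_quadraticChar]
  rw [AdjoinRoot.mk_eq_mk.2
    ((UniqueFactorizationMonoid.dvd_of_mem_normalizedFactors hp).trans hdvd)]

theorem primeResidueSymbol_sq {f p : F[X]} (h : ¬ p ∣ f) : primeResidueSymbol f p ^ 2 = 1 := by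
  rw [primeResidueSymbol, if_neg h]
  split_ifs <;> norm_num

theorem residueSymbol_one_left (g : F[X]) : residueSymbol 1 g = 1 := by
  rw [residueSymbol]
  refine Multiset.prod_eq_one fun x hx => ?_
  obtain ⟨p, hp, rfl⟩ := Multiset.mem_map.1 hx
  obtain ⟨h1, hi⟩ := monic_irreducible_of_mem hp
  rw [primeResidueSymbol, if_neg (fun h => hi.not_isUnit (isUnit_of_dvd_one h)),
    if_pos ⟨1, by simp⟩]

theorem residueSymbol_pow_left (f g : F[X]) (k : ℕ) :
    residueSymbol (f ^ k) g = residueSymbol f g ^ k := by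
  induction k with
  | zero => simp [residueSymbol_one_left]
  | succ k ih => rw [pow_succ, residueSymbol_mul_left, ih, pow_succ]

theorem residueSymbol_pow_right (f : F[X]) {g : F[X]} (hg : g ≠ 0) (k : ℕ) :
    residueSymbol f (g ^ k) = residueSymbol f g ^ k := by
  induction k with
  | zero => simp [residueSymbol_one_right]
  | succ k ih => rw [pow_succ, residueSymbol_mul_right _ (pow_ne_zero _ hg) hg, ih, pow_succ]

theorem residueSymbol_eq_zero {f p g : F[X]} (hp : p.Monic) (hi : Irreducible p) (hg : g ≠ 0)
    (h1 : p ∣ f) (h2 : p ∣ g) : residueSymbol f g = 0 := by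
  obtain ⟨h, rfl⟩ := h2
  rw [residueSymbol_mul_right f hp.ne_zero (right_ne_zero_of_mul hg), residueSymbol_prime f hp hi,
    primeResidueSymbol, if_pos h1, zero_mul]

theorem residueSymbol_sq {f g : F[X]} (h : IsCoprime f g) :
    residueSymbol f g ^ 2 = 1 := by
  rw [residueSymbol, ← Multiset.prod_map_pow]
  refine Multiset.prod_eq_one fun x hx => ?_
  obtain ⟨p, hp, rfl⟩ := Multiset.mem_map.1 hx
  obtain ⟨h1, hi⟩ := monic_irreducible_of_mem hp
  refine primeResidueSymbol_sq fun hd => hi.not_isUnit ?_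
  exact h.isUnit_of_dvd' hd (UniqueFactorizationMonoid.dvd_of_mem_normalizedFactors hp)

theorem isCoprime_of_irreducible {p f : F[X]} (hi : Irreducible p) (h : ¬ p ∣ f) :
    IsCoprime p f :=
  (hi.coprime_iff_not_dvd).2 h

include hq

/-- The Gauss sum of squares modulo `p r` is computed twice. Directly it is the value for the degree
of `p r`. By partial fractions it is `(r/p) (p/r)` times the product of the values for `p` and `r`.
Multiplicativity of `gaussValue` then gives `(r/p) (p/r) = 1`. -/
theorem residueSymbol_comm_prime {p r : F[X]} (hp : p.Monic) (hi : Irreducible p) (hr : r.Monic)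
    (hir : Irreducible r) : residueSymbol p r = residueSymbol r p := by
  by_cases hpr : p = r
  · rw [hpr]
  obtain ⟨ψ, hψ⟩ := exists_addChar_ne_one F
  have hnd : ¬ p ∣ r := fun h => hpr (eq_of_monic_of_associated hp hr
    ((hi.dvd_irreducible_iff_associated hir).1 h))
  have hnd' : ¬ r ∣ p := fun h => hpr (eq_of_monic_of_associated hr hp
    ((hir.dvd_irreducible_iff_associated hi).1 h)).symm
  have hcop := isCoprime_of_irreducible hi hnd
  have h2 := two_ne_zero_of_card hq
  have key := sum_residueChar_sq hψ h2 (hp.mul hr)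
  rw [sum_polysLT_coprime hp hr hcop] at key
  have hterm : ∀ a b : F[X], residueChar ψ (p * r) ((a * r + b * p) ^ 2) =
      residueChar ψ p (r * a ^ 2) * residueChar ψ r (p * b ^ 2) := by
    intro a b
    rw [show (a * r + b * p) ^ 2 = ((r * a ^ 2) * r + (p * b ^ 2) * p) + (p * r) * (2 * a * b) by
      ring, AddChar.map_add_eq_mul, residueChar_of_dvd ψ (hp.mul hr) (dvd_mul_right _ _), mul_one,
      residueChar_coprime ψ hp hr]
  simp only [hterm, ← Finset.mul_sum, ← Finset.sum_mul] at key
  rw [sum_residueChar_mul_sq hq hψ hp hi hnd, sum_residueChar_mul_sq hq hψ hr hir hnd',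
    hp.natDegree_mul hr, ← gaussValue_mul hq hψ] at key
  have hne := mul_ne_zero (gaussValue_ne_zero hq hψ p.natDegree)
    (gaussValue_ne_zero hq hψ r.natDegree)
  have h1 : (residueSymbol r p : ℂ) * residueSymbol p r = 1 := by
    refine mul_right_cancel₀ hne ?_
    linear_combination key
  have h1' : residueSymbol r p * residueSymbol p r = 1 := by exact_mod_cast h1
  have h3 := residueSymbol_sq hcop.symm
  calc residueSymbol p r = residueSymbol r p ^ 2 * residueSymbol p r := by rw [h3, one_mul]
    _ = residueSymbol r p * (residueSymbol r p * residueSymbol p r) := by ring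
    _ = residueSymbol r p := by rw [h1', mul_one]

/-- Quadratic reciprocity in `F[t]`, for a finite field with `q ≡ 1 mod 4` elements. -/
theorem residueSymbol_comm {f g : F[X]} (hf : f.Monic) (hg : g.Monic) :
    residueSymbol f g = residueSymbol g f := by
  refine monic_induction (P := fun f => residueSymbol f g = residueSymbol g f) ?_ ?_ f hf
  · rw [residueSymbol_one_left, residueSymbol_one_right]
  · intro p f hp hi hf ih
    rw [residueSymbol_mul_left, residueSymbol_mul_right _ hp.ne_zero hf.ne_zero, ih]
    congr 1
    refine monic_induction (P := fun g => residueSymbol p g = residueSymbol g p) ?_ ?_ g hg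
    · rw [residueSymbol_one_left, residueSymbol_one_right]
    · intro r g hr hir hg ih
      rw [residueSymbol_mul_left, residueSymbol_mul_right _ hr.ne_zero hg.ne_zero, ih,
        residueSymbol_comm_prime hq hp hi hr hir]

/-- Replacing `ψ` by `ψ (c ·)` multiplies the Gauss sum modulo a prime `p` by `(c/p)`. On the other
hand, its explicit value depends on `ψ` only through the Gauss sum of `F`, present in odd degree,
which changes by `χ(c)`. -/
theorem residueSymbol_C {D : F[X]} (hD : D.Monic) (c : F) (hc : c ≠ 0) :
    residueSymbol (C c) D = quadraticChar F c ^ D.natDegree := by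
  obtain ⟨ψ, hψ⟩ := exists_addChar_ne_one F
  have h2 := two_ne_zero_of_card hq
  refine monic_induction (P := fun D => residueSymbol (C c) D = quadraticChar F c ^ D.natDegree)
    ?_ ?_ D hD
  · simp [residueSymbol_one_right]
  · intro p D hp hi hD ih
    rw [residueSymbol_mul_right _ hp.ne_zero hD.ne_zero, ih, hp.natDegree_mul hD, pow_add]
    congr 1
    have hnd : ¬ p ∣ C c := fun h => hi.not_isUnit
      (isUnit_of_dvd_unit h (isUnit_C.2 hc.isUnit))
    have key := sum_residueChar_mul_sq hq hψ hp hi hnd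
    have hsh : ∀ h : F[X], residueChar ψ p (C c * h) = residueChar (ψ.mulShift c) p h := by
      intro h
      rw [residueChar_apply, residueChar_apply, AddChar.mulShift_apply, ← smul_eq_C_mul,
        smul_modByMonic, coeff_smul, smul_eq_mul]
    simp only [hsh] at key
    rw [sum_residueChar_sq (mulShift_ne_one hψ hc) h2 hp] at key
    have hval : gaussValue (ψ.mulShift c) p.natDegree =
        ((quadraticChar F c ^ p.natDegree : ℤ) : ℂ) * gaussValue ψ p.natDegree := by
      have hsq := quadraticChar_sq_one hc
      unfold gaussValue
      by_cases he : Even p.natDegree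
      · obtain ⟨m, hm⟩ := he
        rw [if_pos ⟨m, hm⟩, if_pos ⟨m, hm⟩, hm, ← two_mul, pow_mul, hsq]
        simp
      · rw [if_neg he, if_neg he]
        obtain ⟨m, hm⟩ := Nat.not_even_iff_odd.1 he
        simp only [AddChar.mulShift_apply]
        rw [sum_addChar_mul_sq (ringChar_ne_two h2) hψ hc]
        have : quadraticChar F c ^ p.natDegree = quadraticChar F c := by
          rw [hm, pow_succ, pow_mul, hsq]; simp
        rw [this]; ring
    rw [hval] at key
    exact_mod_cast (mul_right_cancel₀ (gaussValue_ne_zero hq hψ p.natDegree) key).symm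

include hψ

/-- Primes are added one at a time by partial fractions. The cross symbols `(D/p)` and `(p/D)` agree
by reciprocity and cancel. -/
theorem sum_symbol_mul_residueChar {D : F[X]} (hD : D.Monic) (hs : Squarefree D) (f : F[X]) :
    ∑ h ∈ polysLT F D.natDegree, (residueSymbol h D : ℂ) * residueChar ψ D (f * h) =
      residueSymbol f D * gaussValue ψ D.natDegree := by
  revert hs
  refine monic_induction (P := fun D => Squarefree D →
    ∑ h ∈ polysLT F D.natDegree, (residueSymbol h D : ℂ) * residueChar ψ D (f * h) =
      residueSymbol f D * gaussValue ψ D.natDegree) ?_ ?_ D hD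
  · intro _
    simp [polysLT_zero, residueSymbol_one_right, gaussValue]
  · intro p D hp hi hD ih hs
    have hnd : ¬ p ∣ D := fun h => hi.not_isUnit (hs p (mul_dvd_mul_left p h))
    have hcop := isCoprime_of_irreducible hi hnd
    rw [sum_polysLT_coprime hp hD hcop]
    have hterm : ∀ a b : F[X], (residueSymbol (a * D + b * p) (p * D) : ℂ) *
        residueChar ψ (p * D) (f * (a * D + b * p)) =
        ((residueSymbol a p : ℂ) * residueChar ψ p (f * a)) *
          ((residueSymbol b D : ℂ) * residueChar ψ D (f * b)) := by
      intro a b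
      have h1 : residueSymbol (a * D + b * p) p = residueSymbol a p * residueSymbol D p := by
        rw [← residueSymbol_mul_left]
        exact residueSymbol_congr ⟨b, by ring⟩
      have h2 : residueSymbol (a * D + b * p) D = residueSymbol b D * residueSymbol p D := by
        rw [← residueSymbol_mul_left]
        exact residueSymbol_congr ⟨a, by ring⟩
      have h3 := residueSymbol_sq hcop.symm
      have h3' : (residueSymbol D p : ℂ) ^ 2 = 1 := by exact_mod_cast h3
      rw [residueSymbol_mul_right _ hp.ne_zero hD.ne_zero, h1, h2, residueSymbol_comm hq hp hD,
        show f * (a * D + b * p) = (f * a) * D + (f * b) * p by ring,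
        residueChar_coprime ψ hp hD]
      push_cast
      linear_combination ((residueSymbol a p : ℂ) * residueChar ψ p (f * a) *
          ((residueSymbol b D : ℂ) * residueChar ψ D (f * b))) * h3'
    simp only [hterm, ← Finset.mul_sum, ← Finset.sum_mul]
    rw [sum_symbol_mul_residueChar_prime hq hψ hp hi, ih (hs.squarefree_of_dvd (dvd_mul_left _ _)),
      residueSymbol_mul_right _ hp.ne_zero hD.ne_zero, hp.natDegree_mul hD,
      ← gaussValue_mul hq hψ]
    push_cast
    ring

end ResidueSymbol

/-! ### Polynomials with a functional equation, and their values at `1`. -/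

section SelfDual

variable {R : Type*} [CommRing R]

/-- The power series `Q` is a polynomial of degree at most `2m` satisfying the functional equation
`Q(x) = (√q x) ^ (2m) Q(1 / (q x))`. -/
def SelfDual (q : R) (m : ℕ) (Q : PowerSeries R) : Prop :=
  (∀ k, 2 * m < k → PowerSeries.coeff k Q = 0) ∧
    ∀ k ≤ 2 * m, q ^ m * PowerSeries.coeff k Q = q ^ k * PowerSeries.coeff (2 * m - k) Q

namespace SelfDual

variable {q : R} {m n : ℕ} {P Q : PowerSeries R}

theorem zero : SelfDual q m (0 : PowerSeries R) := by simp [SelfDual]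

theorem add (hP : SelfDual q m P) (hQ : SelfDual q m Q) : SelfDual q m (P + Q) := by
  refine ⟨fun k hk => ?_, fun k hk => ?_⟩
  · rw [map_add, hP.1 k hk, hQ.1 k hk, add_zero]
  · rw [map_add, map_add, mul_add, mul_add, hP.2 k hk, hQ.2 k hk]

theorem C_mul (c : R) (hP : SelfDual q m P) : SelfDual q m (PowerSeries.C c * P) := by
  refine ⟨fun k hk => ?_, fun k hk => ?_⟩
  · rw [PowerSeries.coeff_C_mul, hP.1 k hk, mul_zero]
  · rw [PowerSeries.coeff_C_mul, PowerSeries.coeff_C_mul]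
    linear_combination c * hP.2 k hk

theorem sum {ι : Type*} (s : Finset ι) {f : ι → PowerSeries R}
    (h : ∀ i ∈ s, SelfDual q m (f i)) : SelfDual q m (∑ i ∈ s, f i) := by
  classical
  induction s using Finset.induction_on with
  | empty => simpa using zero
  | insert a s ha ih =>
    rw [Finset.sum_insert ha]
    exact (h a (Finset.mem_insert_self a s)).add
      (ih fun i hi => h i (Finset.mem_insert_of_mem hi))

theorem one : SelfDual q 0 (1 : PowerSeries R) := by
  refine ⟨fun k hk => ?_, fun k hk => ?_⟩
  · rw [PowerSeries.coeff_one, if_neg (by omega)]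
  · simp at hk; simp [hk]

theorem eq_coe_trunc (hP : SelfDual q m P) :
    P = ((PowerSeries.trunc (2 * m + 1) P : R[X]) : PowerSeries R) := by
  ext k
  rw [Polynomial.coeff_coe, PowerSeries.coeff_trunc]
  split_ifs with h
  · rfl
  · exact hP.1 k (by omega)

/-- Written with the reversed polynomial, the functional equation is `q ^ m P(x) = P_rev(q x)`, and
reversal in a fixed degree bound is multiplicative. -/
theorem mul (hP : SelfDual q m P) (hQ : SelfDual q n Q) : SelfDual q (m + n) (P * Q) := by
  have key : ∀ {m : ℕ} {P : PowerSeries R}, SelfDual q m P →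
      C (q ^ m) * PowerSeries.trunc (2 * m + 1) P =
        ((PowerSeries.trunc (2 * m + 1) P).reflect (2 * m)).comp (C q * X) := by
    intro m P hP
    ext k
    rw [coeff_C_mul, comp_C_mul_X_coeff, coeff_reflect, PowerSeries.coeff_trunc,
      PowerSeries.coeff_trunc]
    by_cases hk : k ≤ 2 * m
    · rw [if_pos (by omega), revAt_le hk, if_pos (by omega), hP.2 k hk, mul_comm]
    · rw [if_neg (by omega), revAt_eq_self_of_lt (by omega), if_neg (by omega)]
      simp
  have hdeg : ∀ (m : ℕ) (P : PowerSeries R), (PowerSeries.trunc (2 * m + 1) P).natDegree ≤ 2 * m :=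
    fun m P => Nat.lt_succ_iff.1 (PowerSeries.natDegree_trunc_lt P (2 * m))
  have hPQ : P * Q = ((PowerSeries.trunc (2 * m + 1) P * PowerSeries.trunc (2 * n + 1) Q : R[X]) :
      PowerSeries R) := by
    conv_lhs => rw [hP.eq_coe_trunc, hQ.eq_coe_trunc]
    simp
  have hmul := congrArg₂ (· * ·) (key hP) (key hQ)
  simp only [← mul_comp] at hmul
  rw [← reflect_mul _ _ (hdeg m P) (hdeg n Q)] at hmul
  rw [hPQ]
  set T := PowerSeries.trunc (2 * m + 1) P * PowerSeries.trunc (2 * n + 1) Q with hT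
  have hTdeg : T.natDegree ≤ 2 * m + 2 * n :=
    natDegree_mul_le.trans (add_le_add (hdeg m P) (hdeg n Q))
  refine ⟨fun k hk => ?_, fun k hk => ?_⟩
  · rw [Polynomial.coeff_coe]
    exact coeff_eq_zero_of_natDegree_lt (by omega)
  · rw [Polynomial.coeff_coe, Polynomial.coeff_coe]
    have h := congrArg (fun p => coeff p k) hmul
    rw [show C (q ^ m) * PowerSeries.trunc (2 * m + 1) P *
      (C (q ^ n) * PowerSeries.trunc (2 * n + 1) Q) = C (q ^ (m + n)) * T by
        rw [hT, pow_add, Polynomial.C_mul]; ring, coeff_C_mul, comp_C_mul_X_coeff, coeff_reflect,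
      revAt_le (by omega)] at h
    rw [h, mul_comm, show 2 * (m + n) - k = 2 * m + 2 * n - k by omega]

theorem map {S : Type*} [CommRing S] (φ : R →+* S) (hP : SelfDual q m P) :
    SelfDual (φ q) m (PowerSeries.map φ P) := by
  refine ⟨fun k hk => ?_, fun k hk => ?_⟩
  · rw [PowerSeries.coeff_map, hP.1 k hk, map_zero]
  · rw [PowerSeries.coeff_map, PowerSeries.coeff_map, ← map_pow, ← map_pow, ← map_mul, ← map_mul,
      hP.2 k hk]

/-- The substitution `x -> η x ^ d` turns a local functional equation at a prime of degree `d` into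
one for `q`. As `η = ±1`, the powers `η ^ (2m - k)` and `η ^ k` agree. -/
theorem rescale_expand {d : ℕ} (hd : d ≠ 0) {η : R} (hη : η ^ 2 = 1)
    (hP : SelfDual (q ^ d) m P) :
    SelfDual q (d * m) (PowerSeries.expand d hd (PowerSeries.rescale η P)) := by
  have hd' : 0 < d := Nat.pos_of_ne_zero hd
  refine ⟨fun k hk => ?_, fun k hk => ?_⟩
  · rw [PowerSeries.coeff_expand]
    split_ifs with h
    · obtain ⟨j, rfl⟩ := h
      rw [Nat.mul_div_cancel_left _ hd', PowerSeries.coeff_rescale, hP.1 j, mul_zero]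
      by_contra hj
      have := Nat.mul_le_mul_left d (not_lt.1 hj)
      lia
    · rfl
  · rw [PowerSeries.coeff_expand, PowerSeries.coeff_expand]
    have h2 : d ∣ 2 * (d * m) := ⟨2 * m, by ring⟩
    by_cases h : d ∣ k
    · rw [if_pos h, if_pos (Nat.dvd_sub h2 h)]
      obtain ⟨j, rfl⟩ := h
      have hj : j ≤ 2 * m := by
        by_contra hj
        have := Nat.mul_lt_mul_of_pos_left (not_le.1 hj) hd'
        lia
      rw [show 2 * (d * m) - d * j = d * (2 * m - j) by rw [Nat.mul_sub]; congr 1; ring,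
        Nat.mul_div_cancel_left _ hd', Nat.mul_div_cancel_left _ hd', PowerSeries.coeff_rescale,
        PowerSeries.coeff_rescale]
      have h1 := hP.2 j hj
      rw [← pow_mul, ← pow_mul] at h1
      have h3 : η ^ (2 * m - j) = η ^ j := by
        have h4 : η ^ (2 * m - j) * (η ^ j * η ^ j) = η ^ j := by
          rw [← mul_assoc, ← pow_add, Nat.sub_add_cancel hj, pow_mul, hη, one_pow, one_mul]
        rwa [← mul_pow, ← pow_two, hη, one_pow, mul_one] at h4
      rw [h3]
      linear_combination η ^ j * h1
    · rw [if_neg h, if_neg (fun h' => h ((Nat.dvd_sub_iff_right hk h2).1 h')), mul_zero, mul_zero]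

/-- Substituting `u x` inverts the parameter of the functional equation. The local-to-global
principle passes from `q` to `1/|p|`, and this brings the parameter back to `|p|`. -/
theorem rescale_inv {K : Type*} [Field K] {u : K} (hu : u ≠ 0) {P : PowerSeries K}
    (hP : SelfDual u⁻¹ m P) : SelfDual u m (PowerSeries.rescale u P) := by
  refine ⟨fun k hk => ?_, fun k hk => ?_⟩
  · rw [PowerSeries.coeff_rescale, hP.1 k hk, mul_zero]
  · rw [PowerSeries.coeff_rescale, PowerSeries.coeff_rescale]
    have h := hP.2 k hk
    rw [inv_pow, inv_pow, inv_mul_eq_iff_eq_mul₀ (pow_ne_zero _ hu)] at h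
    have h' : u ^ k * PowerSeries.coeff k P = u ^ m * PowerSeries.coeff (2 * m - k) P := by
      rw [h]; field_simp
    rw [h', ← mul_assoc, ← mul_assoc, ← pow_add, ← pow_add]
    congr 2
    omega

theorem eq_one (hP : SelfDual q 0 P) (h : PowerSeries.coeff 0 P = 1) : P = 1 := by
  ext k
  by_cases hk : k = 0
  · rw [hk, h]; simp
  · rw [hP.1 k (by omega), PowerSeries.coeff_one, if_neg hk]

end SelfDual

/-- The factor that clears the pole of the `L`-function of a quadratic character of degree `N`: it is
`1 - r x` when `N` is even, and `1` otherwise. -/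
def poleFactor (r : R) (N : ℕ) : PowerSeries R :=
  if Even N then 1 - PowerSeries.C r * PowerSeries.X else 1

theorem poleFactor_of_even (r : R) {N : ℕ} (h : Even N) :
    poleFactor r N = 1 - PowerSeries.C r * PowerSeries.X := if_pos h

theorem poleFactor_of_odd (r : R) {N : ℕ} (h : ¬ Even N) : poleFactor r N = 1 := if_neg h

theorem coeff_zero_mul_one_sub (r : R) (A : PowerSeries R) :
    PowerSeries.coeff 0 (A * (1 - PowerSeries.C r * PowerSeries.X)) = PowerSeries.coeff 0 A := by
  simp

theorem coeff_succ_mul_one_sub (r : R) (A : PowerSeries R) (k : ℕ) :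
    PowerSeries.coeff (k + 1) (A * (1 - PowerSeries.C r * PowerSeries.X)) =
      PowerSeries.coeff (k + 1) A - r * PowerSeries.coeff k A := by
  rw [mul_sub, mul_one, map_sub, ← mul_assoc, PowerSeries.coeff_succ_mul_X, mul_comm A,
    PowerSeries.coeff_C_mul]

theorem map_poleFactor {S : Type*} [CommRing S] (φ : R →+* S) (r : R) (N : ℕ) :
    PowerSeries.map φ (poleFactor r N) = poleFactor (φ r) N := by
  unfold poleFactor
  split_ifs <;> simp

theorem rescale_poleFactor (u r : R) (N : ℕ) :
    PowerSeries.rescale u (poleFactor r N) = poleFactor (u * r) N := by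
  unfold poleFactor
  split_ifs
  · rw [map_sub, map_one, map_mul, PowerSeries.rescale_X]
    congr 1
    have : PowerSeries.rescale u (PowerSeries.C r) = PowerSeries.C r := by
      ext k
      rw [PowerSeries.coeff_rescale, PowerSeries.coeff_C]
      split_ifs with h <;> simp [h]
    rw [this, map_mul]
    ring
  · simp

/-- The power series `Q` is a polynomial with value `v` at `1`. -/
def HasValueOne (Q : PowerSeries R) (v : R) : Prop :=
  ∃ P : R[X], (P : PowerSeries R) = Q ∧ P.eval 1 = v

namespace HasValueOne

variable {P Q : PowerSeries R} {v w : R}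

theorem mul (hP : HasValueOne P v) (hQ : HasValueOne Q w) : HasValueOne (P * Q) (v * w) := by
  obtain ⟨p, rfl, rfl⟩ := hP
  obtain ⟨r, rfl, rfl⟩ := hQ
  exact ⟨p * r, by simp, by simp⟩

theorem C (c : R) : HasValueOne (PowerSeries.C c) c := ⟨Polynomial.C c, by simp, by simp⟩

theorem one : HasValueOne (1 : PowerSeries R) 1 := ⟨1, by simp, by simp⟩

theorem expand {d : ℕ} (hd : d ≠ 0) (hP : HasValueOne P v) :
    HasValueOne (PowerSeries.expand d hd P) v := by
  obtain ⟨p, rfl, rfl⟩ := hP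
  refine ⟨Polynomial.expand R d p, ?_, ?_⟩
  · ext k
    rw [Polynomial.coeff_coe, PowerSeries.coeff_expand, Polynomial.coeff_expand
      (Nat.pos_of_ne_zero hd), Polynomial.coeff_coe]
  · rw [Polynomial.expand_eval, one_pow]

theorem unique (hP : HasValueOne P v) (hP' : HasValueOne P w) : v = w := by
  obtain ⟨p, rfl, rfl⟩ := hP
  obtain ⟨r, h, rfl⟩ := hP'
  rw [Polynomial.coe_inj.1 h]

end HasValueOne

theorem SelfDual.hasValueOne {q : R} {m : ℕ} {P : PowerSeries R} (hP : SelfDual q m P) :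
    HasValueOne P (∑ k ∈ Finset.range (2 * m + 1), PowerSeries.coeff k P) := by
  refine ⟨PowerSeries.trunc (2 * m + 1) P, hP.eq_coe_trunc.symm, ?_⟩
  have := PowerSeries.eval₂_trunc_eq_sum_range (1 : R) (RingHom.id R) (2 * m + 1) P
  rw [Polynomial.eval₂_id] at this
  simpa using this

/-- For a self-dual `A(x) (1 - x)`, the value at `1` is the eventual value of the coefficients
of `A`. -/
theorem SelfDual.hasValueOne_one_sub {q : R} {m : ℕ} {A : PowerSeries R}
    (hA : SelfDual q m (A * (1 - PowerSeries.C 1 * PowerSeries.X))) :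
    HasValueOne (A * (1 - PowerSeries.C 1 * PowerSeries.X)) (PowerSeries.coeff (2 * m) A) := by
  have h : ∀ n, ∑ k ∈ Finset.range (n + 1),
      PowerSeries.coeff k (A * (1 - PowerSeries.C 1 * PowerSeries.X)) = PowerSeries.coeff n A := by
    intro n
    induction n with
    | zero => simp
    | succ n ih =>
      rw [Finset.sum_range_succ, ih, coeff_succ_mul_one_sub]
      ring
  rw [← h (2 * m)]
  exact hA.hasValueOne

/-- For a self-dual `A(x) (1 - q x)`, the coefficient of `A` in the degree of the polynomial is
given by the value at `1`. -/
theorem SelfDual.coeff_eq_of_hasValueOne {q : R} {m : ℕ} {A : PowerSeries R} {v : R}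
    (hA : SelfDual q m (A * (1 - PowerSeries.C q * PowerSeries.X)))
    (hv : HasValueOne (A * (1 - PowerSeries.C q * PowerSeries.X)) v) :
    PowerSeries.coeff (2 * m) A = q ^ m * v := by
  have h : ∀ n, PowerSeries.coeff n A = ∑ k ∈ Finset.range (n + 1),
      q ^ (n - k) * PowerSeries.coeff k (A * (1 - PowerSeries.C q * PowerSeries.X)) := by
    intro n
    induction n with
    | zero => simp
    | succ n ih =>
      rw [Finset.sum_range_succ, coeff_succ_mul_one_sub]
      have : ∑ k ∈ Finset.range (n + 1), q ^ (n + 1 - k) *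
          PowerSeries.coeff k (A * (1 - PowerSeries.C q * PowerSeries.X)) =
          q * PowerSeries.coeff n A := by
        rw [ih, Finset.mul_sum]
        refine Finset.sum_congr rfl fun k hk => ?_
        have := Finset.mem_range.1 hk
        rw [show n + 1 - k = (n - k) + 1 by omega, pow_succ]
        ring
      rw [this]
      simp
  -- After `k` is replaced by `2m - k`, the functional equation turns each term into `q ^ m` times
  -- the `k`-th coefficient of the polynomial, and these add up to its value at `1`.
  rw [h, ← Finset.sum_range_reflect, hv.unique hA.hasValueOne, Finset.mul_sum]
  refine Finset.sum_congr rfl fun k hk => ?_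
  have hk' := Finset.mem_range.1 hk
  rw [hA.2 k (by omega), show 2 * m + 1 - 1 - k = 2 * m - k by omega,
    show 2 * m - (2 * m - k) = k by omega]

end SelfDual

/-! ### `L`-series of quadratic characters. -/

section LFunction

variable {F : Type*} [Field F] [Fintype F]

/-- The sum of the values of the quadratic symbol modulo `D` over monic polynomials of degree
`k`. -/
def symbolSum (D : F[X]) (k : ℕ) : ℂ := ∑ f ∈ monicPolys F k, (residueSymbol f D : ℂ)

theorem card_monicPolys (k : ℕ) : (monicPolys F k).card = Fintype.card F ^ k := by
  rw [Finset.card_eq_sum_ones, sum_monicPolys, ← Finset.card_eq_sum_ones, card_polysLT]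

theorem monicPolys_zero : monicPolys F 0 = {1} := by
  ext f
  rw [mem_monicPolys, Finset.mem_singleton]
  exact ⟨fun h => h.1.natDegree_eq_zero.1 h.2, by rintro rfl; simp⟩

theorem symbolSum_zero (D : F[X]) : symbolSum D 0 = 1 := by
  simp [symbolSum, monicPolys_zero, residueSymbol_one_left]

open scoped Classical

variable (hq : Fintype.card F % 4 = 1)

include hq

/-- Nonzero polynomials are scalars times monic ones. By `residueSymbol_C` the scalars all have
symbol `1` in even degree and cancel in odd degree. -/
theorem sum_polysLT_symbol {D : F[X]} (hD : D.Monic) (h0 : residueSymbol 0 D = 0) (m : ℕ) :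
    ∑ y ∈ polysLT F m, (residueSymbol y D : ℂ) =
      if Even D.natDegree then ((Fintype.card F : ℂ) - 1) * ∑ j ∈ Finset.range m, symbolSum D j
      else 0 := by
  have hc : ∑ c : F, ((residueSymbol (C c) D : ℤ) : ℂ) =
      if Even D.natDegree then (Fintype.card F : ℂ) - 1 else 0 := by
    rw [← Finset.add_sum_erase _ _ (Finset.mem_univ (0 : F)), C_0, h0]
    rw [Finset.sum_congr rfl (g := fun c : F => ((quadraticChar F c ^ D.natDegree : ℤ) : ℂ))
      (fun c hc => by rw [residueSymbol_C hq hD c (Finset.ne_of_mem_erase hc)])]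
    split_ifs with he
    · obtain ⟨n, hn⟩ := he
      rw [Finset.sum_congr rfl (g := fun _ => (1 : ℂ)) (fun c hc => by
        rw [hn, ← two_mul, pow_mul, quadraticChar_sq_one (Finset.ne_of_mem_erase hc)]; simp)]
      simp [Finset.card_erase_of_mem, Nat.cast_sub Fintype.card_pos]
    · obtain ⟨n, hn⟩ := Nat.not_even_iff_odd.1 he
      have hsum := quadraticChar_sum_zero (ringChar_ne_two (two_ne_zero_of_card hq))
      rw [← Finset.add_sum_erase _ _ (Finset.mem_univ (0 : F)), quadraticChar_zero] at hsum
      rw [Finset.sum_congr rfl (g := fun c : F => ((quadraticChar F c : ℤ) : ℂ)) (fun c hc => by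
        rw [hn, pow_succ, pow_mul, quadraticChar_sq_one (Finset.ne_of_mem_erase hc)]; simp)]
      exact_mod_cast hsum
  induction m with
  | zero => simp [polysLT_zero, h0]
  | succ m ih =>
    rw [sum_polysLT_succ m (by rw [h0]; simp), ih]
    have : ∑ c : F, ∑ f ∈ monicPolys F m, ((residueSymbol (C c * f) D : ℤ) : ℂ) =
        (∑ c : F, ((residueSymbol (C c) D : ℤ) : ℂ)) * symbolSum D m := by
      rw [Finset.sum_mul]
      refine Finset.sum_congr rfl fun c _ => ?_
      rw [symbolSum, Finset.mul_sum]
      refine Finset.sum_congr rfl fun f _ => ?_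
      rw [residueSymbol_mul_left]
      push_cast; ring
    rw [this, hc]
    split_ifs
    · rw [Finset.sum_range_succ]; ring
    · ring

theorem residueSymbol_zero_left {D : F[X]} (hD : D.Monic) (h1 : D ≠ 1) : residueSymbol 0 D = 0 := by
  obtain ⟨p, hp, hi, hd⟩ := exists_monic_irreducible_factor D
    (fun h => h1 (hD.eq_one_of_isUnit h))
  exact residueSymbol_eq_zero hp hi hD.ne_zero (dvd_zero p) hd

/-- Poisson summation: the symbol `(f/D)` is expanded in additive characters by the Gauss sum modulo
`D`, leaving an orthogonality sum over the lower part `r` of `f = X ^ k + r`. -/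
theorem gaussValue_mul_symbolSum {ψ : AddChar F ℂ} (hψ : ψ ≠ 1) {D : F[X]} (hD : D.Monic)
    (hs : Squarefree D) (k : ℕ) :
    gaussValue ψ D.natDegree * symbolSum D k =
      ∑ h ∈ polysLT F D.natDegree, (residueSymbol h D : ℂ) * (residueChar ψ D (X ^ k * h) *
        ∑ r ∈ polysLT F k, residueChar ψ D (r * h)) := by
  rw [symbolSum, Finset.mul_sum]
  rw [Finset.sum_congr rfl fun f _ => by
    rw [mul_comm, ← sum_symbol_mul_residueChar hq hψ hD hs f], Finset.sum_comm]
  refine Finset.sum_congr rfl fun h _ => ?_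
  rw [← Finset.mul_sum]
  congr 1
  rw [sum_monicPolys, Finset.mul_sum]
  refine Finset.sum_congr rfl fun r _ => ?_
  rw [add_mul, AddChar.map_add_eq_mul]

theorem symbolSum_eq_zero {D : F[X]} (hD : D.Monic) (hs : Squarefree D) (h1 : D ≠ 1) {k : ℕ}
    (hk : D.natDegree ≤ k) : symbolSum D k = 0 := by
  obtain ⟨ψ, hψ⟩ := exists_addChar_ne_one F
  refine (mul_eq_zero.1 ((gaussValue_mul_symbolSum hq hψ hD hs k).trans ?_)).resolve_left
    (gaussValue_ne_zero hq hψ _)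
  refine Finset.sum_eq_zero fun h hh => ?_
  by_cases h0 : h = 0
  · rw [h0, residueSymbol_zero_left hq hD h1]; simp
  · rw [mem_polysLT, degree_eq_natDegree h0] at hh
    have hh' : h.natDegree < D.natDegree := by exact_mod_cast hh
    rw [sum_residueChar_eq_zero hψ hD h0 hh' (by omega), mul_zero, mul_zero]

/-- Orthogonality leaves the dual variable `h` of degree at most `m = N - 1 - k`, and on these the
character sees only the coefficient of `X ^ m`. -/
theorem gaussValue_mul_symbolSum_of_lt {ψ : AddChar F ℂ} (hψ : ψ ≠ 1) {D : F[X]} (hD : D.Monic)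
    (hs : Squarefree D) {k m : ℕ} (hkm : D.natDegree = m + 1 + k) :
    gaussValue ψ D.natDegree * symbolSum D k = (Fintype.card F : ℂ) ^ k *
      (∑ y ∈ polysLT F m, (residueSymbol y D : ℂ) +
        (∑ c : F, (residueSymbol (C c) D : ℂ) * ψ c) * symbolSum D m) := by
  have h0 : residueSymbol 0 D = 0 := residueSymbol_zero_left hq hD (by rintro rfl; rw [natDegree_one] at hkm; omega)
  rw [gaussValue_mul_symbolSum hq hψ hD hs k]
  have hsub : polysLT F (m + 1) ⊆ polysLT F D.natDegree := by
    intro h hh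
    rw [mem_polysLT] at *
    exact lt_of_lt_of_le hh (by exact_mod_cast (by omega))
  rw [← Finset.sum_subset hsub]
  · have hterm : ∀ h ∈ polysLT F (m + 1), (residueSymbol h D : ℂ) * (residueChar ψ D (X ^ k * h) *
        ∑ r ∈ polysLT F k, residueChar ψ D (r * h)) =
        (Fintype.card F : ℂ) ^ k * ((residueSymbol h D : ℂ) * ψ (h.coeff m)) := by
      intro h hh
      by_cases hz : h = 0
      · rw [hz, h0]; simp
      rw [mem_polysLT, degree_eq_natDegree hz] at hh
      have hh' : h.natDegree < m + 1 := by exact_mod_cast hh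
      rw [sum_residueChar_eq_pow ψ hD (Or.inr (by omega)), residueChar_of_degree_lt ψ hD
        (degree_lt_degree (by
          rw [natDegree_mul (pow_ne_zero _ X_ne_zero) hz, natDegree_X_pow]; omega)),
        show D.natDegree - 1 = m + k by omega, coeff_X_pow_mul]
      ring
    rw [Finset.sum_congr rfl hterm, ← Finset.mul_sum, sum_polysLT_succ m (by rw [h0]; simp)]
    congr 2
    · refine Finset.sum_congr rfl fun y hy => ?_
      rw [coeff_eq_zero_of_degree_lt (mem_polysLT.1 hy), AddChar.map_zero_eq_one, mul_one]
    · rw [Finset.sum_mul]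
      refine Finset.sum_congr rfl fun c _ => ?_
      rw [symbolSum, Finset.mul_sum]
      refine Finset.sum_congr rfl fun f hf => ?_
      rw [mem_monicPolys] at hf
      rw [residueSymbol_mul_left, coeff_C_mul, ← hf.2, hf.1.coeff_natDegree, mul_one]
      push_cast
      ring
  · intro h hh hnot
    have hz : h ≠ 0 := by
      rintro rfl
      exact hnot (by rw [mem_polysLT, degree_zero]; exact WithBot.bot_lt_coe _)
    rw [mem_polysLT, degree_eq_natDegree hz] at hh hnot
    have hh' : h.natDegree < D.natDegree := by exact_mod_cast hh
    have hnot' : ¬ h.natDegree < m + 1 := fun h => hnot (by exact_mod_cast h)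
    rw [sum_residueChar_eq_zero hψ hD hz hh' (by omega), mul_zero, mul_zero]

/-- In odd degree `(c/D) = χ(c)`: the `h` of degree below `m` cancel, and the leading coefficients
produce the same Gauss sum of `F` as on the left-hand side. -/
theorem symbolSum_odd {D : F[X]} (hD : D.Monic) (hs : Squarefree D) (ho : ¬ Even D.natDegree)
    {k m : ℕ} (hkm : D.natDegree = m + 1 + k) :
    (Fintype.card F : ℂ) ^ (D.natDegree / 2) * symbolSum D k =
      (Fintype.card F : ℂ) ^ k * symbolSum D m := by
  obtain ⟨ψ, hψ⟩ := exists_addChar_ne_one F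
  have h := gaussValue_mul_symbolSum_of_lt hq hψ hD hs hkm
  have h0 : residueSymbol 0 D = 0 := residueSymbol_zero_left hq hD (by rintro rfl; rw [natDegree_one] at hkm; omega)
  have hchar := ringChar_ne_two (two_ne_zero_of_card hq)
  have hτ : ∑ c : F, (residueSymbol (C c) D : ℂ) * ψ c = ∑ c : F, ψ (c ^ 2) := by
    rw [sum_addChar_sq hchar hψ]
    refine Finset.sum_congr rfl fun c _ => ?_
    by_cases hc : c = 0
    · rw [hc, C_0, h0, quadraticChar_zero]
    · obtain ⟨n, hn⟩ := Nat.not_even_iff_odd.1 ho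
      rw [residueSymbol_C hq hD c hc, hn, pow_succ, pow_mul, quadraticChar_sq_one hc]
      simp
  have hne := gaussValue_ne_zero hq hψ D.natDegree
  rw [sum_polysLT_symbol hq hD h0, if_neg ho, hτ, gaussValue, if_neg ho] at h
  rw [gaussValue, if_neg ho] at hne
  refine mul_left_cancel₀ (right_ne_zero_of_mul hne) ?_
  linear_combination h

/-- In even degree `(c/D) = 1` for `c ≠ 0`, and the values `ψ c` with `c ≠ 0` sum to `-1`. -/
theorem symbolSum_even {D : F[X]} (hD : D.Monic) (hs : Squarefree D) (he : Even D.natDegree)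
    {k m : ℕ} (hkm : D.natDegree = m + 1 + k) :
    (Fintype.card F : ℂ) ^ (D.natDegree / 2) * symbolSum D k =
      (Fintype.card F : ℂ) ^ k *
        (((Fintype.card F : ℂ) - 1) * ∑ j ∈ Finset.range m, symbolSum D j - symbolSum D m) := by
  obtain ⟨ψ, hψ⟩ := exists_addChar_ne_one F
  have h := gaussValue_mul_symbolSum_of_lt hq hψ hD hs hkm
  have h0 : residueSymbol 0 D = 0 := residueSymbol_zero_left hq hD (by rintro rfl; rw [natDegree_one] at hkm; omega)
  have hτ : ∑ c : F, (residueSymbol (C c) D : ℂ) * ψ c = -1 := by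
    have h1 := AddChar.sum_eq_zero_of_ne_one hψ
    rw [← Finset.add_sum_erase _ _ (Finset.mem_univ (0 : F)), AddChar.map_zero_eq_one] at h1
    rw [← Finset.add_sum_erase _ _ (Finset.mem_univ (0 : F)), C_0, h0,
      Finset.sum_congr rfl (g := fun c : F => ψ c)]
    · simp only [Int.cast_zero, zero_mul, zero_add]
      linear_combination h1
    · intro c hc
      obtain ⟨n, hn⟩ := he
      rw [residueSymbol_C hq hD c (Finset.ne_of_mem_erase hc), hn, ← two_mul, pow_mul,
        quadraticChar_sq_one (Finset.ne_of_mem_erase hc)]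
      simp
  rw [sum_polysLT_symbol hq hD h0, if_pos he, hτ, gaussValue, if_pos he] at h
  linear_combination h

/-- The trivial zero at `x = 1`. The symbols of all residues modulo `D` sum to zero (the Gauss sum
with `f = 0`), and each monic one is counted `q - 1` times. -/
theorem sum_symbolSum_eq_zero {D : F[X]} (hD : D.Monic) (hs : Squarefree D)
    (he : Even D.natDegree) (h1 : D ≠ 1) :
    ∑ j ∈ Finset.range D.natDegree, symbolSum D j = 0 := by
  obtain ⟨ψ, hψ⟩ := exists_addChar_ne_one F
  have h0 := residueSymbol_zero_left hq hD h1
  have h := sum_symbol_mul_residueChar hq hψ hD hs 0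
  simp only [zero_mul, AddChar.map_zero_eq_one, mul_one] at h
  rw [sum_polysLT_symbol hq hD h0, if_pos he, h0, Int.cast_zero, zero_mul] at h
  refine (mul_eq_zero.1 h).resolve_left (sub_ne_zero.2 ?_)
  have : 1 < Fintype.card F := Fintype.one_lt_card
  exact_mod_cast this.ne'

/-- The `L`-series of the quadratic character modulo `D`. -/
def lSeries (D : F[X]) : PowerSeries ℂ := PowerSeries.mk (symbolSum D)

theorem lSeries_one : lSeries (1 : F[X]) *
    (1 - PowerSeries.C (Fintype.card F : ℂ) * PowerSeries.X) = 1 := by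
  have hS : ∀ k, symbolSum (1 : F[X]) k = (Fintype.card F : ℂ) ^ k := by
    intro k
    simp [symbolSum, residueSymbol_one_right, card_monicPolys]
  ext k
  cases k with
  | zero => rw [coeff_zero_mul_one_sub, lSeries, PowerSeries.coeff_mk, hS]; simp
  | succ k =>
    rw [coeff_succ_mul_one_sub, lSeries, PowerSeries.coeff_mk, PowerSeries.coeff_mk, hS, hS,
      PowerSeries.coeff_one, if_neg (by omega), pow_succ]
    ring

/-- The functional equation of the `L`-series of a quadratic character. -/
theorem lSeries_selfDual {D : F[X]} (hD : D.Monic) (hs : Squarefree D) :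
    SelfDual (Fintype.card F : ℂ) (D.natDegree / 2)
      (lSeries D * poleFactor (Fintype.card F : ℂ) D.natDegree) := by
  by_cases h1 : D = 1
  · subst h1
    rw [poleFactor_of_even _ (by simp), lSeries_one hq]
    simpa using SelfDual.one
  have hN : 0 < D.natDegree := Nat.pos_of_ne_zero fun h => h1 (hD.natDegree_eq_zero.1 h)
  by_cases he : Even D.natDegree
  · rw [poleFactor_of_even _ he]
    obtain ⟨n, hn⟩ := he
    have hn2 : D.natDegree / 2 = n := by omega
    have he : Even D.natDegree := ⟨n, hn⟩
    have hz := fun k => symbolSum_eq_zero hq hD hs h1 (k := k)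
    have hfe := fun k m => symbolSum_even hq hD hs he (k := k) (m := m)
    have hsum := sum_symbolSum_eq_zero hq hD hs he h1
    rw [hn2] at hfe ⊢
    have hq0 : (Fintype.card F : ℂ) ≠ 0 := by simp
    set q : ℂ := (Fintype.card F : ℂ)
    -- The extreme coefficients are matched separately: the trivial zero turns the partial sum of
    -- the symbol sums into minus its last term.
    have hend : q ^ n * PowerSeries.coeff 0
        (lSeries D * (1 - PowerSeries.C q * PowerSeries.X)) =
        PowerSeries.coeff (2 * n) (lSeries D * (1 - PowerSeries.C q * PowerSeries.X)) := by
      obtain ⟨N, hN'⟩ : ∃ N, D.natDegree = N + 1 := ⟨D.natDegree - 1, by omega⟩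
      have h := hfe 0 N hN'
      rw [hN', Finset.sum_range_succ] at hsum
      rw [show 2 * n = N + 1 by omega, coeff_zero_mul_one_sub, coeff_succ_mul_one_sub, lSeries,
        PowerSeries.coeff_mk, PowerSeries.coeff_mk, PowerSeries.coeff_mk, hz (N + 1) (by omega), h]
      linear_combination (q - 1) * hsum
    refine ⟨fun k hk => ?_, fun k hk => ?_⟩
    · obtain ⟨k, rfl⟩ : ∃ j, k = j + 1 := ⟨k - 1, by omega⟩
      rw [coeff_succ_mul_one_sub, lSeries, PowerSeries.coeff_mk, PowerSeries.coeff_mk,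
        hz _ (by omega), hz _ (by omega)]
      simp
    · rcases Nat.eq_zero_or_pos k with rfl | hk0
      · simpa using hend
      · rcases hk.lt_or_eq with hk1 | rfl
        · obtain ⟨k, rfl⟩ : ∃ j, k = j + 1 := ⟨k - 1, by omega⟩
          obtain ⟨l, hl⟩ : ∃ l, D.natDegree = (l + 1) + 1 + k := ⟨D.natDegree - k - 2, by omega⟩
          rw [show 2 * n - (k + 1) = l + 1 by omega, coeff_succ_mul_one_sub,
            coeff_succ_mul_one_sub]
          simp only [lSeries, PowerSeries.coeff_mk]
          -- The equation for `k + 1` minus `q` times the equation for `k` removes the partial sums.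
          have e1 := hfe (k + 1) l (by omega)
          have e2 := hfe k (l + 1) (by omega)
          rw [Finset.sum_range_succ] at e2
          rw [pow_succ] at e1 ⊢
          linear_combination e1 - q * e2
        · rw [Nat.sub_self, ← hend, ← mul_assoc, ← pow_add, ← two_mul]
  · rw [poleFactor_of_odd _ he, mul_one]
    obtain ⟨n, hn⟩ := Nat.not_even_iff_odd.1 he
    refine ⟨fun k hk => ?_, fun k hk => ?_⟩
    · rw [lSeries, PowerSeries.coeff_mk]
      exact symbolSum_eq_zero hq hD hs h1 (by omega)
    · rw [lSeries, PowerSeries.coeff_mk, PowerSeries.coeff_mk]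
      exact symbolSum_odd hq hD hs he (by omega)

theorem lSeries_hasValueOne {D : F[X]} (hD : D.Monic) (hs : Squarefree D) (h1 : D ≠ 1)
    (he : Even D.natDegree) :
    HasValueOne (lSeries D * (1 - PowerSeries.C (Fintype.card F : ℂ) * PowerSeries.X)) 0 := by
  have hz : HasValueOne (lSeries D) 0 := by
    refine ⟨PowerSeries.trunc D.natDegree (lSeries D), ?_, ?_⟩
    · ext k
      rw [Polynomial.coeff_coe, PowerSeries.coeff_trunc]
      split_ifs with hk
      · rfl
      · rw [lSeries, PowerSeries.coeff_mk, symbolSum_eq_zero hq hD hs h1 (by omega)]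
    · have := PowerSeries.eval₂_trunc_eq_sum_range (1 : ℂ) (RingHom.id ℂ) D.natDegree (lSeries D)
      rw [Polynomial.eval₂_id] at this
      rw [this, ← sum_symbolSum_eq_zero hq hD hs he h1]
      simp [lSeries]
  have h2 : HasValueOne (1 - PowerSeries.C (Fintype.card F : ℂ) * PowerSeries.X)
      (1 - (Fintype.card F : ℂ)) := ⟨1 - C (Fintype.card F : ℂ) * X,
      by rw [Polynomial.coe_sub, Polynomial.coe_one, Polynomial.coe_mul, Polynomial.coe_C,
        Polynomial.coe_X], by simp⟩
  simpa using hz.mul h2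

end LFunction

/-! ### Splitting a prime off a generating series. -/

section Splitting

variable {F : Type*} [Field F] [Fintype F]

theorem exists_pow_mul_not_dvd {p : F[X]} (hp : p.Monic) (hi : Irreducible p) {f : F[X]}
    (hf : f.Monic) : ∃ (k : ℕ) (g : F[X]), f = p ^ k * g ∧ g.Monic ∧ ¬ p ∣ g := by
  have hfin : FiniteMultiplicity p f := FiniteMultiplicity.of_not_isUnit hi.not_isUnit hf.ne_zero
  obtain ⟨g, hg, hnd⟩ := hfin.exists_eq_pow_mul_and_not_dvd
  exact ⟨_, g, hg, (hp.pow _).of_mul_monic_left (hg ▸ hf), hnd⟩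

theorem pow_mul_inj {p g g' : F[X]} (hp : p ≠ 0) {k k' : ℕ} (hg : ¬ p ∣ g) (hg' : ¬ p ∣ g')
    (h : p ^ k * g = p ^ k' * g') : k = k' ∧ g = g' := by
  have key : ∀ {k k' : ℕ} {g g' : F[X]}, ¬ p ∣ g → p ^ k * g = p ^ k' * g' → k' ≤ k := by
    intro k k' g g' hg h
    by_contra hlt
    obtain ⟨l, rfl⟩ := Nat.exists_eq_add_of_lt (not_le.1 hlt)
    refine hg ⟨p ^ l * g', ?_⟩
    refine mul_left_cancel₀ (pow_ne_zero k hp) ?_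
    rw [h]; ring
  have hk : k = k' := le_antisymm (key hg' h.symm) (key hg h)
  subst hk
  exact ⟨rfl, mul_left_cancel₀ (pow_ne_zero k hp) h⟩

/-- The generating series of a function on monic polynomials. -/
def genSeries (φ : F[X] → ℂ) : PowerSeries ℂ :=
  PowerSeries.mk fun k => ∑ g ∈ monicPolys F k, φ g

theorem genSeries_congr {φ ψ : F[X] → ℂ} (h : ∀ g : F[X], g.Monic → φ g = ψ g) :
    genSeries φ = genSeries ψ := by
  ext k
  rw [genSeries, genSeries, PowerSeries.coeff_mk, PowerSeries.coeff_mk]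
  exact Finset.sum_congr rfl fun g hg => h g (mem_monicPolys.1 hg).1

/-- Each monic polynomial is uniquely `p ^ k * g` with `p ∤ g`. Because `ψ` vanishes on multiples of
`p`, the series in `g` needs no restriction. -/
theorem genSeries_split {p : F[X]} (hp : p.Monic) (hi : Irreducible p) {φ ψ : F[X] → ℂ}
    {b : ℕ → ℂ} (h : ∀ k g, g.Monic → ¬ p ∣ g → φ (p ^ k * g) = b k * ψ g)
    (h0 : ∀ g, p ∣ g → ψ g = 0) :
    genSeries φ =
      PowerSeries.expand p.natDegree hi.natDegree_pos.ne' (PowerSeries.mk b) * genSeries ψ := by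
  classical
  ext n
  rw [PowerSeries.coeff_mul, genSeries, PowerSeries.coeff_mk]
  have hd := hi.natDegree_pos
  set d := p.natDegree
  have hR : ∀ x ∈ Finset.HasAntidiagonal.antidiagonal n,
      PowerSeries.coeff x.1 (PowerSeries.expand d hd.ne' (PowerSeries.mk b)) *
        PowerSeries.coeff x.2 (genSeries ψ) =
      ∑ g ∈ (monicPolys F x.2).filter (fun g => ¬ p ∣ g ∧ d ∣ x.1), b (x.1 / d) * ψ g := by
    intro x _
    rw [PowerSeries.coeff_expand, genSeries, PowerSeries.coeff_mk]
    split_ifs with hdx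
    · rw [PowerSeries.coeff_mk, Finset.mul_sum, Finset.sum_filter]
      refine Finset.sum_congr rfl fun g _ => ?_
      split_ifs with hg
      · rfl
      · rw [h0 g (by tauto), mul_zero]
    · rw [zero_mul]
      symm
      refine Finset.sum_eq_zero fun g hg => ?_
      exact absurd (Finset.mem_filter.1 hg).2.2 hdx
  rw [Finset.sum_congr rfl hR, Finset.sum_sigma']
  symm
  refine Finset.sum_bij (fun x _ => p ^ (x.1.1 / d) * x.2) ?_ ?_ ?_ ?_
  · rintro ⟨⟨u, v⟩, g⟩ hx
    simp only [Finset.mem_sigma, Finset.HasAntidiagonal.mem_antidiagonal, Finset.mem_filter, mem_monicPolys] at hx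
    obtain ⟨huv, ⟨hg, hgv⟩, hnd, hdu⟩ := hx
    rw [mem_monicPolys]
    refine ⟨(hp.pow _).mul hg, ?_⟩
    rw [(hp.pow _).natDegree_mul hg, hp.natDegree_pow, hgv, ← huv]
    simp only
    rw [Nat.div_mul_cancel hdu]
  · rintro ⟨⟨u, v⟩, g⟩ hx ⟨⟨u', v'⟩, g'⟩ hx' heq
    simp only [Finset.mem_sigma, Finset.HasAntidiagonal.mem_antidiagonal, Finset.mem_filter, mem_monicPolys]
      at hx hx' heq
    obtain ⟨huv, ⟨hg, hgv⟩, hnd, hdu⟩ := hx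
    obtain ⟨huv', ⟨hg', hgv'⟩, hnd', hdu'⟩ := hx'
    obtain ⟨h1, rfl⟩ := pow_mul_inj hp.ne_zero hnd hnd' heq
    have : u = u' := by
      rw [← Nat.div_mul_cancel hdu, ← Nat.div_mul_cancel hdu', h1]
    subst this
    have : v = v' := by omega
    subst this
    rfl
  · intro f hf
    rw [mem_monicPolys] at hf
    obtain ⟨k, g, rfl, hg, hnd⟩ := exists_pow_mul_not_dvd hp hi hf.1
    refine ⟨⟨(k * d, g.natDegree), g⟩, ?_, ?_⟩
    · simp only [Finset.mem_sigma, Finset.HasAntidiagonal.mem_antidiagonal, Finset.mem_filter, mem_monicPolys]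
      refine ⟨?_, ⟨hg, trivial⟩, hnd, dvd_mul_left _ _⟩
      rw [← hf.2, (hp.pow _).natDegree_mul hg, hp.natDegree_pow]
    · simp only
      rw [Nat.mul_div_cancel _ hd]
  · rintro ⟨⟨u, v⟩, g⟩ hx
    simp only [Finset.mem_sigma, Finset.HasAntidiagonal.mem_antidiagonal, Finset.mem_filter, mem_monicPolys] at hx
    exact (h _ g hx.2.1.1 hx.2.2.1).symm

end Splitting

/-! ### Sums of weights over one entry: functional equation and value at `1`. -/

section Weights

variable {F : Type*} [Field F] [Fintype F] {n : ℕ}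

/-- The product of quadratic symbols in twisted multiplicativity. -/
def twist (f g : Fin (n + 1) → F[X]) : ℤ :=
  ∏ i, (residueSymbol (f i) (g (i + 1)) * residueSymbol (g i) (f (i + 1)))

/-- Twisted multiplicativity and the initial condition, over a single field. -/
structure IsWeight (H : (Fin (n + 1) → F[X]) → ℂ) : Prop where
  mul : ∀ f g : Fin (n + 1) → F[X], (∀ i, (f i).Monic) → (∀ i, (g i).Monic) →
    IsCoprime (∏ i, f i) (∏ i, g i) →
    H (fun i => f i * g i) = H f * H g * (twist f g : ℂ)
  initial : ∀ (i : Fin (n + 1)) (f : F[X]), f.Monic → H (fun j => if j = i then f else 1) = 1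

theorem succ_ne (hn : 2 ≤ n) (i : Fin (n + 1)) : i + 1 ≠ i := by
  intro h
  have : (1 : Fin (n + 1)) = 0 := by simpa using h
  rw [Fin.one_eq_zero_iff] at this
  omega

theorem pred_ne (hn : 2 ≤ n) (i : Fin (n + 1)) : i - 1 ≠ i := by
  intro h
  have := succ_ne hn (i - 1)
  rw [sub_add_cancel] at this
  exact this h.symm

variable {H : (Fin (n + 1) → F[X]) → ℂ} {i : Fin (n + 1)}

theorem twist_one_right (f : Fin (n + 1) → F[X]) : twist f 1 = 1 := by
  simp [twist, residueSymbol_one_left, residueSymbol_one_right]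

theorem twist_one_left (f : Fin (n + 1) → F[X]) : twist 1 f = 1 := by
  simp [twist, residueSymbol_one_left, residueSymbol_one_right]

/-- Only the factors at `i - 1` and `i` involve the entry `i`. Reciprocity collects their symbols
with the new entry on the left. -/
theorem twist_update (hq : Fintype.card F % 4 = 1) (hn : 2 ≤ n) {f g : Fin (n + 1) → F[X]}
    (hf : ∀ j, (f j).Monic) (hg : ∀ j, (g j).Monic) (hfi : f i = 1) (hgi : g i = 1)
    {x y : F[X]} (hx : x.Monic) (hy : y.Monic) :
    twist (Function.update f i x) (Function.update g i y) =
      twist f g * residueSymbol x (g (i - 1) * g (i + 1)) *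
        residueSymbol y (f (i - 1) * f (i + 1)) := by
  have hi1 := succ_ne hn i
  have hi2 := pred_ne hn i
  have hmem : i - 1 ∈ Finset.univ.erase i := by simp [hi2]
  rw [twist, twist, ← Finset.mul_prod_erase _ _ (Finset.mem_univ i),
    ← Finset.mul_prod_erase _ _ hmem, ← Finset.mul_prod_erase Finset.univ _ (Finset.mem_univ i),
    ← Finset.mul_prod_erase (Finset.univ.erase i) _ hmem]
  rw [Finset.prod_congr (s₁ := (Finset.univ.erase i).erase (i - 1)) rfl
    (g := fun j => residueSymbol (f j) (g (j + 1)) * residueSymbol (g j) (f (j + 1)))]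
  · rw [sub_add_cancel, Function.update_self, Function.update_self, Function.update_of_ne hi1,
      Function.update_of_ne hi1, Function.update_of_ne hi2, Function.update_of_ne hi2, hfi, hgi,
      residueSymbol_one_left, residueSymbol_one_left, residueSymbol_one_right,
      residueSymbol_one_right, residueSymbol_mul_right _ (hg _).ne_zero (hg _).ne_zero,
      residueSymbol_mul_right _ (hf _).ne_zero (hf _).ne_zero,
      residueSymbol_comm hq (hf (i - 1)) hy, residueSymbol_comm hq (hg (i - 1)) hx]
    ring
  · intro j hj
    simp only [Finset.mem_erase, Finset.mem_univ, and_true] at hj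
    have hj1 : j + 1 ≠ i := fun h => hj.1 (by rw [← h, add_sub_cancel_right])
    rw [Function.update_of_ne hj.2, Function.update_of_ne hj.2, Function.update_of_ne hj1,
      Function.update_of_ne hj1]

theorem isCoprime_tuple {p : F[X]} (hi : Irreducible p) {a : Fin (n + 1) → ℕ}
    {f : Fin (n + 1) → F[X]} (hf : ∀ j, ¬ p ∣ f j) :
    IsCoprime (∏ j, p ^ a j) (∏ j, f j) :=
  IsCoprime.prod_left fun _ _ => IsCoprime.prod_right fun j _ =>
    (isCoprime_of_irreducible hi (hf j)).pow_left

theorem monic_update {f : Fin (n + 1) → F[X]} (hf : ∀ j, (f j).Monic) {x : F[X]} (hx : x.Monic)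
    (j : Fin (n + 1)) : (Function.update f i x j).Monic := by
  by_cases h : j = i
  · subst h; rwa [Function.update_self]
  · rw [Function.update_of_ne h]; exact hf j

theorem IsWeight.update_pow_mul (hH : IsWeight H) (hq : Fintype.card F % 4 = 1) (hn : 2 ≤ n)
    {p : F[X]} (hp : p.Monic) (hi : Irreducible p) {a : Fin (n + 1) → ℕ} (ha : a i = 0)
    {f : Fin (n + 1) → F[X]} (hf : ∀ j, (f j).Monic) (hfi : f i = 1) (hpf : ∀ j, ¬ p ∣ f j)
    (k : ℕ) {g : F[X]} (hg : g.Monic) (hpg : ¬ p ∣ g) :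
    H (Function.update (fun j => p ^ a j * f j) i (p ^ k * g)) =
      H (fun j => p ^ Function.update a i k j) * H (Function.update f i g) *
        ((twist (fun j => p ^ a j) f * residueSymbol p (f (i - 1) * f (i + 1)) ^ k *
          residueSymbol g p ^ (a (i - 1) + a (i + 1)) : ℤ) : ℂ) := by
  have hpow : (fun j => p ^ Function.update a i k j) =
      Function.update (fun j => p ^ a j) i (p ^ k) := by
    ext1 j
    by_cases h : j = i
    · subst h; simp
    · simp [Function.update_of_ne h]
  have hprod : Function.update (fun j => p ^ a j * f j) i (p ^ k * g) =
      fun j => (p ^ Function.update a i k j) * Function.update f i g j := by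
    ext1 j
    by_cases h : j = i
    · subst h; simp
    · simp [Function.update_of_ne h]
  rw [hprod, hH.mul (fun j => p ^ Function.update a i k j) _ (fun j => hp.pow _)
    (monic_update hf hg)]
  · rw [hpow, twist_update hq hn (fun j => hp.pow _) hf (by rw [ha, pow_zero]) hfi (hp.pow k) hg,
      residueSymbol_pow_left, ← pow_add, residueSymbol_pow_right _ hp.ne_zero]
  · refine isCoprime_tuple hi fun j => ?_
    by_cases h : j = i
    · subst h; rwa [Function.update_self]
    · rw [Function.update_of_ne h]; exact hpf j

/-- The sum over `f_i`, for the other `f_j` fixed, twisted by the quadratic symbol modulo `E`. -/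
def sliceSeries (H : (Fin (n + 1) → F[X]) → ℂ) (i : Fin (n + 1)) (f : Fin (n + 1) → F[X])
    (E : F[X]) : PowerSeries ℂ :=
  genSeries fun g => H (Function.update f i g) * residueSymbol g E

/-- The local series `∑_k H(p ^ a with a_i = k) x ^ k`. -/
def localSeries (H : (Fin (n + 1) → F[X]) → ℂ) (i : Fin (n + 1)) (p : F[X])
    (a : Fin (n + 1) → ℕ) : PowerSeries ℂ :=
  PowerSeries.mk fun k => H fun j => p ^ Function.update a i k j

/-- The local functional equation. -/
def LocalDual (H : (Fin (n + 1) → F[X]) → ℂ) (i : Fin (n + 1)) (p : F[X])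
    (a : Fin (n + 1) → ℕ) : Prop :=
  SelfDual ((Fintype.card F : ℂ) ^ p.natDegree) ((a (i - 1) + a (i + 1)) / 2)
    (localSeries H i p a * poleFactor 1 (a (i - 1) + a (i + 1)))

theorem not_dvd_mul {p f g : F[X]} (hi : Irreducible p) (hf : ¬ p ∣ f) (hg : ¬ p ∣ g) :
    ¬ p ∣ f * g := fun h => (hi.prime.dvd_or_dvd h).elim hf hg

/-- The factor `(g/p) ^ 2` is the indicator of `p ∤ g` that `genSeries_split` requires. -/
theorem IsWeight.sliceSeries_split (hH : IsWeight H) (hq : Fintype.card F % 4 = 1) (hn : 2 ≤ n)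
    {p : F[X]} (hp : p.Monic) (hi : Irreducible p) {a : Fin (n + 1) → ℕ} (ha : a i = 0)
    {f : Fin (n + 1) → F[X]} (hf : ∀ j, (f j).Monic) (hfi : f i = 1) (hpf : ∀ j, ¬ p ∣ f j)
    {E : F[X]} (hE : E.Monic) :
    sliceSeries H i (fun j => p ^ a j * f j) E =
      PowerSeries.C (twist (fun j => p ^ a j) f : ℂ) *
        PowerSeries.expand p.natDegree hi.natDegree_pos.ne'
          (PowerSeries.rescale (residueSymbol p (f (i - 1) * f (i + 1) * E) : ℂ)
            (localSeries H i p a)) *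
        genSeries fun g => H (Function.update f i g) * residueSymbol g E *
          (residueSymbol g p : ℂ) ^ (a (i - 1) + a (i + 1)) *
            (residueSymbol g p : ℂ) ^ 2 := by
  rw [sliceSeries, genSeries_split hp hi (b := fun k => (twist (fun j => p ^ a j) f : ℂ) *
    ((residueSymbol p (f (i - 1) * f (i + 1) * E) : ℂ) ^ k *
      H fun j => p ^ Function.update a i k j))]
  · congr 1
    rw [← PowerSeries.expand_C p.natDegree hi.natDegree_pos.ne', ← map_mul]
    congr 1
    ext k
    rw [PowerSeries.coeff_C_mul, PowerSeries.coeff_rescale, localSeries, PowerSeries.coeff_mk,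
      PowerSeries.coeff_mk]
  · intro k g hg hpg
    have h2 := residueSymbol_sq (isCoprime_of_irreducible hi hpg).symm
    have h2' : (residueSymbol g p : ℂ) ^ 2 = 1 := by exact_mod_cast h2
    rw [hH.update_pow_mul hq hn hp hi ha hf hfi hpf k hg hpg, residueSymbol_mul_left,
      residueSymbol_pow_left,
      residueSymbol_mul_right p ((hf (i - 1)).mul (hf (i + 1))).ne_zero hE.ne_zero, h2']
    push_cast
    ring
  · intro g hpg
    rw [residueSymbol_eq_zero hp hi hp.ne_zero hpg dvd_rfl]
    simp

theorem IsWeight.localSeries_zero (hH : IsWeight H) {p : F[X]} (hp : p.Monic) :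
    localSeries H i p 0 * poleFactor 1 0 = 1 := by
  rw [poleFactor_of_even _ ⟨0, rfl⟩]
  have h1 : ∀ k, (H fun j => p ^ Function.update (0 : Fin (n + 1) → ℕ) i k j) = 1 := by
    intro k
    rw [← hH.initial i (p ^ k) (hp.pow k)]
    congr 1
    ext1 j
    by_cases h : j = i
    · subst h; simp
    · simp [h]
  ext k
  cases k with
  | zero => rw [coeff_zero_mul_one_sub, localSeries, PowerSeries.coeff_mk, h1]; simp
  | succ k =>
    rw [coeff_succ_mul_one_sub, localSeries, PowerSeries.coeff_mk, PowerSeries.coeff_mk, h1, h1,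
      PowerSeries.coeff_one, if_neg (by omega)]
    ring

/-- Put `M = a (i - 1) + a (i + 1)`. The part of `g` prime to `p` carries `(g/p) ^ M` and the
condition `p ∤ g`. For `M` odd this is just `(g/p)`, which enlarges the modulus to `p * E`. For `M`
even only the condition is left: it removes the Euler factor at `p` of the remaining slice, and that
is the local pole factor. -/
theorem IsWeight.sliceSeries_step (hH : IsWeight H) (hq : Fintype.card F % 4 = 1) (hn : 2 ≤ n)
    {p : F[X]} (hp : p.Monic) (hi : Irreducible p) {a : Fin (n + 1) → ℕ} (ha : a i = 0)
    {f : Fin (n + 1) → F[X]} (hf : ∀ j, (f j).Monic) (hfi : f i = 1) (hpf : ∀ j, ¬ p ∣ f j)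
    {E : F[X]} (hE : E.Monic) :
    sliceSeries H i (fun j => p ^ a j * f j) E =
      PowerSeries.C (twist (fun j => p ^ a j) f : ℂ) *
        PowerSeries.expand p.natDegree hi.natDegree_pos.ne'
          (PowerSeries.rescale (residueSymbol p (f (i - 1) * f (i + 1) * E) : ℂ)
            (localSeries H i p a * poleFactor 1 (a (i - 1) + a (i + 1)))) *
        sliceSeries H i f (if Even (a (i - 1) + a (i + 1)) then E else p * E) := by
  rw [hH.sliceSeries_split hq hn hp hi ha hf hfi hpf hE]
  have hsq : ∀ (g : F[X]) (m : ℕ), (residueSymbol g p : ℂ) ^ (2 * m) * (residueSymbol g p : ℂ) ^ 2 =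
      (residueSymbol g p : ℂ) ^ 2 := by
    intro g m
    by_cases hpg : p ∣ g
    · rw [residueSymbol_eq_zero hp hi hp.ne_zero hpg dvd_rfl]; simp
    · have h2 := residueSymbol_sq (isCoprime_of_irreducible hi hpg).symm
      have h2' : (residueSymbol g p : ℂ) ^ 2 = 1 := by exact_mod_cast h2
      rw [pow_mul, h2']; simp
  by_cases he : Even (a (i - 1) + a (i + 1))
  · rw [if_pos he]
    -- The same splitting with trivial exponents shows that the slice of `f` has a geometric Euler
    -- factor at `p`, whose inverse is the pole factor.
    have h0 := hH.sliceSeries_split hq hn hp hi (a := 0) (i := i) rfl hf hfi hpf hE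
    simp only [Pi.zero_apply, pow_zero, one_mul, add_zero, mul_one] at h0
    rw [show (fun j => f j) = f from rfl, show (fun _ : Fin (n + 1) => (1 : F[X])) = 1 from rfl,
      twist_one_left, Int.cast_one, map_one, one_mul] at h0
    have h1 : PowerSeries.expand p.natDegree hi.natDegree_pos.ne'
        (PowerSeries.rescale (residueSymbol p (f (i - 1) * f (i + 1) * E) : ℂ)
          (localSeries H i p 0)) * PowerSeries.expand p.natDegree hi.natDegree_pos.ne'
        (PowerSeries.rescale (residueSymbol p (f (i - 1) * f (i + 1) * E) : ℂ)
          (poleFactor 1 0)) = 1 := by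
      rw [← map_mul, ← map_mul, hH.localSeries_zero hp, map_one, map_one]
    rw [h0, map_mul (PowerSeries.rescale _), map_mul (PowerSeries.expand _ _),
      poleFactor_of_even _ he, ← poleFactor_of_even (1 : ℂ) (N := 0) ⟨0, rfl⟩]
    rw [genSeries_congr (ψ := fun g => H (Function.update f i g) * residueSymbol g E *
      (residueSymbol g p : ℂ) ^ 2)]
    · linear_combination (- (PowerSeries.C (twist (fun j => p ^ a j) f : ℂ) *
        PowerSeries.expand p.natDegree hi.natDegree_pos.ne'
          (PowerSeries.rescale (residueSymbol p (f (i - 1) * f (i + 1) * E) : ℂ)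
            (localSeries H i p a)) * genSeries fun g => H (Function.update f i g) *
              residueSymbol g E * (residueSymbol g p : ℂ) ^ 2)) * h1
    · intro g _
      obtain ⟨m, hm⟩ := he
      rw [hm, ← two_mul, mul_assoc, hsq]
  · rw [if_neg he, poleFactor_of_odd _ he, mul_one, sliceSeries]
    congr 1
    refine genSeries_congr fun g _ => ?_
    obtain ⟨m, hm⟩ := Nat.not_even_iff_odd.1 he
    rw [residueSymbol_mul_right g hp.ne_zero hE.ne_zero, hm, pow_succ]
    push_cast
    have h3 : (residueSymbol g p : ℂ) * (residueSymbol g p : ℂ) ^ 2 = residueSymbol g p := by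
      by_cases hpg : p ∣ g
      · rw [residueSymbol_eq_zero hp hi hp.ne_zero hpg dvd_rfl]; simp
      · have h2 := residueSymbol_sq (isCoprime_of_irreducible hi hpg).symm
        have h2' : (residueSymbol g p : ℂ) ^ 2 = 1 := by exact_mod_cast h2
        rw [h2', mul_one]
    linear_combination (H (Function.update f i g) * residueSymbol g E * residueSymbol g p) *
      hsq g m + (H (Function.update f i g) * residueSymbol g E) * h3

/-- Induction on the degree of the product: the full powers of one prime are removed from all
entries at once. -/
theorem tuple_induction {P : (Fin (n + 1) → F[X]) → Prop} (h1 : P 1)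
    (hstep : ∀ (p : F[X]) (a : Fin (n + 1) → ℕ) (f : Fin (n + 1) → F[X]), p.Monic →
      Irreducible p → a ≠ 0 → a i = 0 → (∀ j, (f j).Monic) → f i = 1 → (∀ j, ¬ p ∣ f j) → P f →
      P fun j => p ^ a j * f j)
    (f : Fin (n + 1) → F[X]) (hf : ∀ j, (f j).Monic) (hfi : f i = 1) : P f := by
  induction hd : (∏ j, f j).natDegree using Nat.strong_induction_on generalizing f with
  | _ d ih =>
    have hm : (∏ j, f j).Monic := monic_prod_of_monic _ _ fun j _ => hf j
    by_cases hu : IsUnit (∏ j, f j)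
    · have : f = 1 := by
        ext1 j
        exact (hf j).eq_one_of_isUnit (isUnit_of_dvd_unit (Finset.dvd_prod_of_mem f
          (Finset.mem_univ j)) hu)
      rwa [this]
    · obtain ⟨p, hp, hpi, hpd⟩ := exists_monic_irreducible_factor _ hu
      choose a g hfg hg hpg using fun j => exists_pow_mul_not_dvd hp hpi (hf j)
      have hai : a i = 0 := by
        by_contra h
        refine hpi.not_isUnit (isUnit_of_dvd_one ?_)
        rw [← hfi, hfg i]
        exact (dvd_pow_self p h).mul_right _
      have hgi : g i = 1 := by
        have := hfg i
        rw [hai, pow_zero, one_mul, hfi] at this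
        exact this.symm
      have ha0 : a ≠ 0 := by
        rintro rfl
        obtain ⟨j, _, hj⟩ := (Prime.dvd_finsetProd_iff hpi.prime _).1 hpd
        rw [hfg j] at hj
        simp only [Pi.zero_apply, pow_zero, one_mul] at hj
        exact hpg j hj
      have hgm : (∏ j, g j).Monic := monic_prod_of_monic _ _ fun j _ => hg j
      rw [show f = fun j => p ^ a j * g j from funext hfg]
      refine hstep p a g hp hpi ha0 hai hg hgi hpg (ih _ ?_ g hg hgi rfl)
      rw [← hd, Finset.prod_congr rfl fun j _ => hfg j, Finset.prod_mul_distrib,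
        Finset.prod_pow_eq_pow_sum, (hp.pow _).natDegree_mul hgm, hp.natDegree_pow]
      have h1 : 0 < ∑ j, a j := by
        obtain ⟨j, hj⟩ := Function.ne_iff.1 ha0
        exact lt_of_lt_of_le (Nat.pos_of_ne_zero hj)
          (Finset.single_le_sum (fun _ _ => Nat.zero_le _) (Finset.mem_univ j))
      have := Nat.mul_pos h1 hpi.natDegree_pos
      omega

theorem IsWeight.sliceSeries_one (hH : IsWeight H) (E : F[X]) :
    sliceSeries H i 1 E = lSeries E := by
  ext k
  rw [sliceSeries, genSeries, lSeries, PowerSeries.coeff_mk, PowerSeries.coeff_mk, symbolSum]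
  refine Finset.sum_congr rfl fun g hg => ?_
  rw [show Function.update (1 : Fin (n + 1) → F[X]) i g = fun j => if j = i then g else 1 by
    ext1 j; simp [Function.update_apply], hH.initial i g (mem_monicPolys.1 hg).1, one_mul]

theorem symbol_sq_eq_one {p f g E : F[X]} (hi : Irreducible p) (hf : ¬ p ∣ f) (hg : ¬ p ∣ g)
    (hE : ¬ p ∣ E) : (residueSymbol p (f * g * E) : ℂ) ^ 2 = 1 := by
  have := residueSymbol_sq
    (isCoprime_of_irreducible hi (not_dvd_mul hi (not_dvd_mul hi hf hg) hE))
  exact_mod_cast this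

/-- The functional equation of the sum over one variable follows from the local functional
equations. -/
theorem IsWeight.sliceSeries_selfDual (hH : IsWeight H) (hq : Fintype.card F % 4 = 1) (hn : 2 ≤ n)
    (f : Fin (n + 1) → F[X]) (hf : ∀ j, (f j).Monic) (hfi : f i = 1)
    (hloc : ∀ (p : F[X]) (b : Fin (n + 1) → ℕ), p.Monic → Irreducible p → b ≠ 0 →
      (∀ j, p ^ b j ∣ f j) → LocalDual H i p b)
    (E : F[X]) (hE : E.Monic) (hEs : Squarefree E) (hEf : ∀ j, IsCoprime E (f j)) :
    SelfDual (Fintype.card F : ℂ) ((f (i - 1) * f (i + 1) * E).natDegree / 2)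
      (sliceSeries H i f E *
        poleFactor (Fintype.card F : ℂ) (f (i - 1) * f (i + 1) * E).natDegree) := by
  revert hloc E
  refine tuple_induction (i := i) (P := fun f => (∀ (p : F[X]) (b : Fin (n + 1) → ℕ), p.Monic →
    Irreducible p → b ≠ 0 → (∀ j, p ^ b j ∣ f j) → LocalDual H i p b) → ∀ E : F[X], E.Monic →
    Squarefree E → (∀ j, IsCoprime E (f j)) →
    SelfDual (Fintype.card F : ℂ) ((f (i - 1) * f (i + 1) * E).natDegree / 2)
      (sliceSeries H i f E *
        poleFactor (Fintype.card F : ℂ) (f (i - 1) * f (i + 1) * E).natDegree)) ?_ ?_ f hf hfi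
  -- With no primes left, the slice is the `L`-series of the accumulated modulus `E`.
  · intro _ E hE hEs _
    simp only [Pi.one_apply, one_mul]
    rw [hH.sliceSeries_one]
    exact lSeries_selfDual hq hE hEs
  · intro p a f hp hi ha0 hai hf hfi hpf ih hloc E hE hEs hEf
    have hpE : ¬ p ∣ E := by
      intro h
      obtain ⟨j, hj⟩ := Function.ne_iff.1 ha0
      refine hi.not_isUnit ((hEf j).isUnit_of_dvd' h ?_)
      exact (dvd_pow_self p hj).mul_right _
    have hcop := isCoprime_of_irreducible hi hpE
    have hEf' : ∀ j, IsCoprime E (f j) := fun j => (hEf j).of_mul_right_right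
    have hl := hloc p a hp hi ha0 fun j => dvd_mul_right _ _
    have hη := symbol_sq_eq_one (E := E) hi (hpf (i - 1)) (hpf (i + 1)) hpE
    rw [LocalDual] at hl
    have h1 := (hl.rescale_expand hi.natDegree_pos.ne' hη).C_mul (twist (fun j => p ^ a j) f : ℂ)
    set M := a (i - 1) + a (i + 1) with hM
    set E' := if Even M then E else p * E with hE'
    have hE'm : E'.Monic := by
      rw [hE']; split_ifs
      exacts [hE, hp.mul hE]
    have hE's : Squarefree E' := by
      rw [hE']; split_ifs
      · exact hEs
      · exact (squarefree_mul_iff).2 ⟨hcop.isRelPrime, hi.squarefree, hEs⟩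
    have hE'f : ∀ j, IsCoprime E' (f j) := by
      intro j
      rw [hE']; split_ifs
      · exact hEf' j
      · exact (isCoprime_of_irreducible hi (hpf j)).mul_left (hEf' j)
    have h2 := ih (fun r b hr hri hb hd => hloc r b hr hri hb fun j => (hd j).mul_left _) E' hE'm
      hE's hE'f
    -- The local factor accounts for the even part of `M`, and an odd leftover goes into `E'`. The
    -- parity that decides the pole factor therefore does not change.
    have hdeg : (p ^ a (i - 1) * f (i - 1) * (p ^ a (i + 1) * f (i + 1)) * E).natDegree =
        2 * (p.natDegree * (M / 2)) + (f (i - 1) * f (i + 1) * E').natDegree := by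
      have hff := (hf (i - 1)).mul (hf (i + 1))
      rw [show p ^ a (i - 1) * f (i - 1) * (p ^ a (i + 1) * f (i + 1)) * E =
        p ^ M * (f (i - 1) * f (i + 1) * E) by rw [hM, pow_add]; ring,
        (hp.pow _).natDegree_mul (hff.mul hE), hp.natDegree_pow, hff.natDegree_mul hE,
        hff.natDegree_mul hE'm, hE']
      split_ifs with he
      · obtain ⟨m, hm⟩ := he
        rw [show M / 2 = m by omega, hm]; ring
      · obtain ⟨m, hm⟩ := Nat.not_even_iff_odd.1 he
        rw [hp.natDegree_mul hE, show M / 2 = m by omega, hm]; ring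
    rw [hH.sliceSeries_step hq hn hp hi hai hf hfi hpf hE, ← hM, ← hE', hdeg]
    have hpole : poleFactor (Fintype.card F : ℂ)
        (2 * (p.natDegree * (M / 2)) + (f (i - 1) * f (i + 1) * E').natDegree) =
        poleFactor (Fintype.card F : ℂ) (f (i - 1) * f (i + 1) * E').natDegree := by
      unfold poleFactor
      have : Even (2 * (p.natDegree * (M / 2))) := even_two_mul _
      simp only [Nat.even_add, this, true_iff]
    rw [hpole, Nat.mul_add_div two_pos, mul_assoc (PowerSeries.C _ * _)]
    exact h1.mul h2

/-- For an odd sum `M` of the neighbouring exponents, the local series is a polynomial of degree at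
most `2⌊M/2⌋ = M - 1`. -/
theorem IsWeight.localSeries_coeff_odd {p : F[X]} {a : Fin (n + 1) → ℕ}
    (hl : LocalDual H i p a) (ho : ¬ Even (a (i - 1) + a (i + 1))) :
    (H fun j => p ^ Function.update a i (a (i - 1) + a (i + 1)) j) = 0 := by
  rw [LocalDual, poleFactor_of_odd _ ho, mul_one] at hl
  obtain ⟨m, hm⟩ := Nat.not_even_iff_odd.1 ho
  have := hl.1 (a (i - 1) + a (i + 1)) (by omega)
  rwa [localSeries, PowerSeries.coeff_mk] at this

/-- On the diagonal `f_i = f_{i-1} f_{i+1}` the two symbols involving the entry `i` are equal by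
reciprocity, so they cancel. -/
theorem IsWeight.update_pow_mul_diag (hH : IsWeight H) (hq : Fintype.card F % 4 = 1) (hn : 2 ≤ n)
    {p : F[X]} (hp : p.Monic) (hi : Irreducible p) {a : Fin (n + 1) → ℕ} (ha : a i = 0)
    {f : Fin (n + 1) → F[X]} (hf : ∀ j, (f j).Monic) (hfi : f i = 1) (hpf : ∀ j, ¬ p ∣ f j) :
    H (Function.update (fun j => p ^ a j * f j) i
        (p ^ a (i - 1) * f (i - 1) * (p ^ a (i + 1) * f (i + 1)))) =
      H (fun j => p ^ Function.update a i (a (i - 1) + a (i + 1)) j) *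
        H (Function.update f i (f (i - 1) * f (i + 1))) * (twist (fun j => p ^ a j) f : ℂ) := by
  have hD := not_dvd_mul hi (hpf (i - 1)) (hpf (i + 1))
  have hDm := (hf (i - 1)).mul (hf (i + 1))
  rw [show p ^ a (i - 1) * f (i - 1) * (p ^ a (i + 1) * f (i + 1)) =
    p ^ (a (i - 1) + a (i + 1)) * (f (i - 1) * f (i + 1)) by rw [pow_add]; ring,
    hH.update_pow_mul hq hn hp hi ha hf hfi hpf _ hDm hD, residueSymbol_comm hq hDm hp, mul_assoc,
    mul_assoc (twist _ _), ← mul_pow, ← pow_two,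
    residueSymbol_sq (isCoprime_of_irreducible hi hD), one_pow, mul_one, mul_assoc]

/-- A prime with odd exponent in `f_{i-1} f_{i+1}` contributes a vanishing local weight. -/
theorem IsWeight.isSquare_of_ne_zero (hH : IsWeight H) (hq : Fintype.card F % 4 = 1) (hn : 2 ≤ n)
    (hloc : ∀ (p : F[X]) (b : Fin (n + 1) → ℕ), p.Monic → Irreducible p → b ≠ 0 → b i = 0 →
      LocalDual H i p b)
    (f : Fin (n + 1) → F[X]) (hf : ∀ j, (f j).Monic) (hfi : f i = 1)
    (hne : H (Function.update f i (f (i - 1) * f (i + 1))) ≠ 0) :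
    IsSquare (f (i - 1) * f (i + 1)) := by
  revert hne
  refine tuple_induction (i := i) (P := fun f => H (Function.update f i (f (i - 1) * f (i + 1))) ≠ 0
    → IsSquare (f (i - 1) * f (i + 1))) ?_ ?_ f hf hfi
  · intro _
    exact ⟨1, by simp⟩
  · intro p a f hp hi ha0 hai hf hfi hpf ih hne
    rw [hH.update_pow_mul_diag hq hn hp hi hai hf hfi hpf] at hne
    have hev : Even (a (i - 1) + a (i + 1)) := by
      by_contra ho
      rw [IsWeight.localSeries_coeff_odd (hloc p a hp hi ha0 hai) ho] at hne
      simp at hne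
    obtain ⟨r, hr⟩ := ih (right_ne_zero_of_mul (left_ne_zero_of_mul hne))
    obtain ⟨m, hm⟩ := hev
    refine ⟨p ^ m * r, ?_⟩
    rw [show p ^ a (i - 1) * f (i - 1) * (p ^ a (i + 1) * f (i + 1)) =
      p ^ (a (i - 1) + a (i + 1)) * (f (i - 1) * f (i + 1)) by rw [pow_add]; ring, hr, hm, pow_add]
    ring

open Classical in
/-- The residue of the sum over one variable. -/
theorem IsWeight.sliceSeries_hasValueOne (hH : IsWeight H) (hq : Fintype.card F % 4 = 1)
    (hn : 2 ≤ n)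
    (hloc : ∀ (p : F[X]) (b : Fin (n + 1) → ℕ), p.Monic → Irreducible p → b ≠ 0 → b i = 0 →
      LocalDual H i p b)
    (f : Fin (n + 1) → F[X]) (hf : ∀ j, (f j).Monic) (hfi : f i = 1)
    (E : F[X]) (hE : E.Monic) (hEs : Squarefree E) (hEf : ∀ j, IsCoprime E (f j))
    (he : Even (f (i - 1) * f (i + 1) * E).natDegree) :
    HasValueOne (sliceSeries H i f E *
        (1 - PowerSeries.C (Fintype.card F : ℂ) * PowerSeries.X))
      (if E = 1 then H (Function.update f i (f (i - 1) * f (i + 1))) else 0) := by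
  classical
  revert E
  refine tuple_induction (i := i) (P := fun f => ∀ E : F[X], E.Monic → Squarefree E →
    (∀ j, IsCoprime E (f j)) → Even (f (i - 1) * f (i + 1) * E).natDegree →
    HasValueOne (sliceSeries H i f E *
        (1 - PowerSeries.C (Fintype.card F : ℂ) * PowerSeries.X))
      (if E = 1 then H (Function.update f i (f (i - 1) * f (i + 1))) else 0)) ?_ ?_ f hf hfi
  -- Without primes the slice is an `L`-series: the zeta function for `E = 1`, and otherwise a
  -- series with a trivial zero at `x = 1`.
  · intro E hE hEs _ he
    simp only [Pi.one_apply, one_mul] at he ⊢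
    rw [hH.sliceSeries_one]
    split_ifs with h1
    · rw [h1, lSeries_one hq, show Function.update (1 : Fin (n + 1) → F[X]) i 1 =
        fun j => if j = i then 1 else 1 by ext1 j; simp [Function.update_apply],
        hH.initial i 1 monic_one]
      exact HasValueOne.one
    · exact lSeries_hasValueOne hq hE hEs h1 he
  · intro p a f hp hi ha0 hai hf hfi hpf ih E hE hEs hEf hev
    have hpE : ¬ p ∣ E := by
      intro h
      obtain ⟨j, hj⟩ := Function.ne_iff.1 ha0
      refine hi.not_isUnit ((hEf j).isUnit_of_dvd' h ?_)
      exact (dvd_pow_self p hj).mul_right _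
    have hcop := isCoprime_of_irreducible hi hpE
    have hEf' : ∀ j, IsCoprime E (f j) := fun j => (hEf j).of_mul_right_right
    have hl := hloc p a hp hi ha0 hai
    have hη := symbol_sq_eq_one (E := E) hi (hpf (i - 1)) (hpf (i + 1)) hpE
    have hff := (hf (i - 1)).mul (hf (i + 1))
    have hstep := hH.sliceSeries_step hq hn hp hi hai hf hfi hpf hE
    have hdeg : (p ^ a (i - 1) * f (i - 1) * (p ^ a (i + 1) * f (i + 1)) * E).natDegree =
        (a (i - 1) + a (i + 1)) * p.natDegree + (f (i - 1) * f (i + 1) * E).natDegree := by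
      rw [show p ^ a (i - 1) * f (i - 1) * (p ^ a (i + 1) * f (i + 1)) * E =
        p ^ (a (i - 1) + a (i + 1)) * (f (i - 1) * f (i + 1) * E) by rw [pow_add]; ring,
        (hp.pow _).natDegree_mul (hff.mul hE), hp.natDegree_pow]
    rw [hdeg] at hev
    rw [hH.update_pow_mul_diag hq hn hp hi hai hf hfi hpf, hstep, mul_assoc]
    set η : ℂ := (residueSymbol p (f (i - 1) * f (i + 1) * E) : ℂ) with hηdef
    have hloc' := (SelfDual.rescale_expand hi.natDegree_pos.ne' hη hl).hasValueOne
    set v := ∑ k ∈ Finset.range (2 * (p.natDegree * ((a (i - 1) + a (i + 1)) / 2)) + 1),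
      PowerSeries.coeff k (PowerSeries.expand p.natDegree hi.natDegree_pos.ne'
        (PowerSeries.rescale η
          (localSeries H i p a * poleFactor 1 (a (i - 1) + a (i + 1))))) with hv
    have hT := (HasValueOne.C (R := ℂ) (twist (fun j => p ^ a j) f : ℂ)).mul hloc'
    by_cases he : Even (a (i - 1) + a (i + 1))
    · rw [if_pos he]
      have hev' : Even (f (i - 1) * f (i + 1) * E).natDegree :=
        (Nat.even_add.1 hev).1 (he.mul_right _)
      have h2 := ih E hE hEs hEf' hev'
      have h3 := hT.mul h2
      convert h3 using 1
      split_ifs with hE1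
      · subst hE1
        -- If the remaining weight is nonzero then `f_{i-1} f_{i+1}` is a square, so `η = 1`. The
        -- local polynomial is then evaluated at `1`, where it equals the coefficient of the local
        -- series in degree `a_{i-1} + a_{i+1}`.
        by_cases hz : H (Function.update f i (f (i - 1) * f (i + 1))) = 0
        · rw [hz]; ring
        · obtain ⟨r, hr⟩ := hH.isSquare_of_ne_zero hq hn hloc f hf hfi hz
          have hη1 : η = 1 := by
            have hpr : ¬ p ∣ r := fun h => not_dvd_mul hi (hpf (i - 1)) (hpf (i + 1))
              (hr ▸ h.mul_right r)
            have hr0 : r ≠ 0 := by rintro rfl; simp at hpr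
            rw [hηdef, mul_one, hr, ← pow_two, residueSymbol_pow_right p hr0,
              residueSymbol_sq (isCoprime_of_irreducible hi hpr)]
            simp
          have hlv : v = H fun j => p ^ Function.update a i (a (i - 1) + a (i + 1)) j := by
            refine hloc'.unique ?_
            rw [hη1, PowerSeries.rescale_one, RingHom.id_apply]
            refine HasValueOne.expand _ ?_
            rw [LocalDual] at hl
            rw [poleFactor_of_even _ he] at hl ⊢
            have h5 := hl.hasValueOne_one_sub
            rwa [localSeries, PowerSeries.coeff_mk, Nat.two_mul_div_two_of_even he] at h5
          rw [hlv]
          ring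
      · ring
    -- For an odd exponent sum the modulus becomes `p * E ≠ 1`, so the value is zero. The predicted
    -- weight vanishes as well.
    · rw [if_neg he]
      have hE1 : p * E ≠ 1 := fun h => hi.not_isUnit (IsUnit.of_mul_eq_one _ h)
      have hev' : Even (f (i - 1) * f (i + 1) * (p * E)).natDegree := by
        rw [show f (i - 1) * f (i + 1) * (p * E) = p * (f (i - 1) * f (i + 1) * E) by ring,
          hp.natDegree_mul (hff.mul hE), Nat.even_add]
        rw [Nat.even_add, Nat.even_mul] at hev
        tauto
      have h2 := ih (p * E) (hp.mul hE)
        ((squarefree_mul_iff).2 ⟨hcop.isRelPrime, hi.squarefree, hEs⟩)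
        (fun j => (isCoprime_of_irreducible hi (hpf j)).mul_left (hEf' j)) hev'
      rw [if_neg hE1] at h2
      have h3 := hT.mul h2
      rw [IsWeight.localSeries_coeff_odd hl he]
      simpa using h3

end Weights

/-! ### Polynomial identities in `q` and the reflection argument. -/

section PolynomialIdentities

theorem eq_of_eval_primePower {P Q : ℂ[X]}
    (h : ∀ q : PrimePowerOneModFour, P.eval (q.1 : ℂ) = Q.eval (q.1 : ℂ)) : P = Q := by
  refine Polynomial.eq_of_infinite_eval_eq P Q ?_
  refine Set.infinite_of_injective_forall_mem (f := fun k : ℕ => ((5 ^ (k + 1) : ℕ) : ℂ)) ?_ ?_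
  · intro k l hkl
    have : (5 : ℕ) ^ (k + 1) = 5 ^ (l + 1) := Nat.cast_injective (R := ℂ) hkl
    have := Nat.pow_right_injective (by norm_num : 2 ≤ 5) this
    omega
  · intro k
    refine h ⟨5 ^ (k + 1), Nat.prime_five.isPrimePow.pow (by omega), ?_⟩
    rw [Nat.pow_mod]
    simp

/-- All terms of `P` have degree greater than `w / 2`. -/
def HighDegree (w : ℕ) (P : ℂ[X]) : Prop := ∀ j, P.coeff j ≠ 0 → w < 2 * j

namespace HighDegree

variable {w : ℕ} {P Q : ℂ[X]}

theorem sub (hP : HighDegree w P) (hQ : HighDegree w Q) : HighDegree w (P - Q) := by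
  intro j hj
  by_cases h : P.coeff j = 0
  · refine hQ j fun h' => hj ?_
    rw [coeff_sub, h, h', sub_zero]
  · exact hP j h

theorem X_pow_mul (m : ℕ) (hP : HighDegree w P) : HighDegree (w + 2 * m) (X ^ m * P) := by
  intro j hj
  rw [coeff_X_pow_mul'] at hj
  split_ifs at hj with h
  · have := hP _ hj
    omega
  · exact absurd rfl hj

theorem mono {w' : ℕ} (h : w' ≤ w) (hP : HighDegree w P) : HighDegree w' P :=
  fun j hj => h.trans_lt (hP j hj)

/-- A polynomial in `q` which is antisymmetric to its own reflection in its range of degrees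
vanishes. -/
theorem eq_zero (hP : HighDegree w P)
    (h : ∀ q : PrimePowerOneModFour,
      P.eval (q.1 : ℂ) = (q.1 : ℂ) ^ w * P.eval ((q.1 : ℂ)⁻¹)) : P = 0 := by
  have key : X ^ P.natDegree * P = X ^ w * reflect P.natDegree P := by
    refine eq_of_eval_primePower fun q => ?_
    have hq0 : (q.1 : ℂ) ≠ 0 := by
      have := q.2.1.pos
      exact_mod_cast this.ne'
    let _ : Invertible ((q.1 : ℂ)⁻¹) := invertibleOfNonzero (inv_ne_zero hq0)
    have h1 := eval₂_reflect_mul_pow (RingHom.id ℂ) ((q.1 : ℂ)⁻¹) P.natDegree P le_rfl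
    rw [invOf_eq_inv, inv_inv, eval₂_id, eval₂_id] at h1
    rw [eval_mul, eval_mul, eval_pow, eval_pow, eval_X, h q, ← h1, inv_pow]
    field_simp
  by_contra hne
  set L := P.natDegree
  have hL : P.coeff L ≠ 0 := leadingCoeff_ne_zero.2 hne
  have hw := hP L hL
  -- On the left this coefficient is the leading one. On the right it can only be the coefficient of
  -- `P` in degree `w - L`, below `w / 2`, where `P` has no terms.
  have h2 := congrArg (fun p => coeff p (L + L)) key
  simp only [coeff_X_pow_mul', Nat.le_add_left, if_true, Nat.add_sub_cancel] at h2
  rw [h2] at hL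
  split_ifs at hL with hle
  · rw [coeff_reflect] at hL
    by_cases hlt : L + L - w ≤ L
    · rw [revAt_le hlt] at hL
      have := hP _ hL
      omega
    · exact hlt (le_natDegree_of_ne_zero (by rwa [revAt_eq_self_of_lt (not_le.1 hlt)] at hL))
  · exact hL rfl

end HighDegree

end PolynomialIdentities

/-! ### Tuples of monic polynomials with one entry singled out. -/

section Enumeration

variable {F : Type*} [Field F] [Fintype F] {m : ℕ}

theorem mem_monicTuples {a : Fin m → ℕ} {f : Fin m → F[X]} :
    f ∈ monicTuples F a ↔ ∀ j, (f j).Monic ∧ (f j).natDegree = a j := by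
  simp [monicTuples]

theorem sum_monicTuples_update {M : Type*} [AddCommMonoid M] {a : Fin m → ℕ} {i : Fin m}
    (ha : a i = 0) (k : ℕ) (φ : (Fin m → F[X]) → M) :
    ∑ f ∈ monicTuples F (Function.update a i k), φ f =
      ∑ f ∈ monicTuples F a, ∑ g ∈ monicPolys F k, φ (Function.update f i g) := by
  rw [← Finset.sum_product']
  refine Finset.sum_nbij' (fun f => (Function.update f i 1, f i))
    (fun z => Function.update z.1 i z.2) ?_ ?_ ?_ ?_ ?_
  · intro f hf
    rw [mem_monicTuples] at hf
    rw [Finset.mem_product, mem_monicTuples, mem_monicPolys]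
    refine ⟨fun j => ?_, ?_⟩
    · by_cases h : j = i
      · subst h; simp [ha]
      · have := hf j
        rw [Function.update_of_ne h] at this
        simpa [Function.update_of_ne h] using this
    · have := hf i
      rwa [Function.update_self] at this
  · rintro ⟨f, g⟩ hz
    rw [Finset.mem_product, mem_monicTuples, mem_monicPolys] at hz
    rw [mem_monicTuples]
    intro j
    by_cases h : j = i
    · subst h; simpa using hz.2
    · simpa [Function.update_of_ne h] using hz.1 j
  · simp
  · rintro ⟨f, g⟩ hz
    rw [Finset.mem_product, mem_monicTuples, mem_monicPolys] at hz
    have h1 : f i = 1 := (hz.1 i).1.natDegree_eq_zero.1 ((hz.1 i).2.trans ha)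
    simp [← h1]
  · simp

theorem sum_update_of_eq_zero {a : Fin m → ℕ} {i : Fin m} (ha : a i = 0) (k : ℕ) :
    ∑ j, Function.update a i k j = ∑ j, a j + k := by
  rw [Finset.sum_update_of_mem (Finset.mem_univ i), ← Finset.sum_sdiff (Finset.subset_univ {i}),
    Finset.sum_singleton, ha, add_zero, add_comm]

end Enumeration

/-! ### The global functional equation from dominance. -/

section LocalToGlobal

variable {n : ℕ} {𝔽 : PrimePowerOneModFour → Type*} [∀ q, Field (𝔽 q)] [∀ q, Fintype (𝔽 q)]
  {H : ∀ q, (Fin (n + 1) → (𝔽 q)[X]) → ℂ} {c : (Fin (n + 1) → ℕ) → ℂ[X]} {i : Fin (n + 1)}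

theorem SatisfiesAxioms.isWeight (hH : SatisfiesAxioms H c) (q : PrimePowerOneModFour) :
    IsWeight (H q) where
  mul f g hf hg hfg := by
    rw [hH.twisted_mul q f g hf hg hfg, twist, Int.cast_prod]
  initial := hH.weight_initial q

/-- The series `∑_k c_a x ^ k`, where `a_i = k` and the other `a_j` are fixed. -/
def globalSeries (c : (Fin (n + 1) → ℕ) → ℂ[X]) (i : Fin (n + 1)) (a : Fin (n + 1) → ℕ) :
    PowerSeries ℂ[X] :=
  PowerSeries.mk fun k => c (Function.update a i k)

/-- The global functional equation. -/
def GlobalDual (c : (Fin (n + 1) → ℕ) → ℂ[X]) (i : Fin (n + 1)) (a : Fin (n + 1) → ℕ) : Prop :=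
  SelfDual (X : ℂ[X]) ((a (i - 1) + a (i + 1)) / 2)
    (globalSeries c i a * poleFactor X (a (i - 1) + a (i + 1)))

theorem SatisfiesAxioms.sum_sliceSeries (hH : SatisfiesAxioms H c) (q : PrimePowerOneModFour)
    {a : Fin (n + 1) → ℕ} (ha : a i = 0) :
    PowerSeries.map (evalRingHom (q.1 : ℂ)) (globalSeries c i a) =
      ∑ f ∈ monicTuples (𝔽 q) a, sliceSeries (H q) i f 1 := by
  ext k
  rw [PowerSeries.coeff_map, globalSeries, PowerSeries.coeff_mk, coe_evalRingHom,
    ← hH.global_coeff, sum_monicTuples_update ha, map_sum]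
  refine Finset.sum_congr rfl fun f _ => ?_
  rw [sliceSeries, genSeries, PowerSeries.coeff_mk]
  simp [residueSymbol_one_right]

/-- The local-to-global principle for generating series. Evaluating at `1/u` and substituting `u x`
turns the pole factor `1 - q x` into `1 - x`. -/
theorem SatisfiesAxioms.localSeries_eq (hH : SatisfiesAxioms H c) (q : PrimePowerOneModFour)
    {p : (𝔽 q)[X]} (hp : p.Monic) (hi : Irreducible p) {a : Fin (n + 1) → ℕ} (ha : a i = 0)
    {u : ℂ} (hu : u = (q.1 : ℂ) ^ p.natDegree) (hu0 : u ≠ 0) (M : ℕ) :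
    localSeries (H q) i p a * poleFactor 1 M =
      PowerSeries.C (u ^ ∑ j, a j) * PowerSeries.rescale u
        (PowerSeries.map (evalRingHom u⁻¹) (globalSeries c i a * poleFactor X M)) := by
  rw [map_mul, map_mul, map_poleFactor, rescale_poleFactor, coe_evalRingHom, eval_X,
    mul_inv_cancel₀ hu0, ← mul_assoc]
  congr 1
  ext k
  rw [PowerSeries.coeff_C_mul, PowerSeries.coeff_rescale, PowerSeries.coeff_map, globalSeries,
    localSeries, PowerSeries.coeff_mk, PowerSeries.coeff_mk,
    hH.local_global q ⟨p, hp, hi⟩ (Function.update a i k), sum_update_of_eq_zero ha, pow_add,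
    ← hu, mul_assoc]
  rfl

theorem natCast_ne_zero (q : PrimePowerOneModFour) : (q.1 : ℂ) ≠ 0 := by
  have := q.2.1.pos
  exact_mod_cast this.ne'

theorem GlobalDual.localDual (hH : SatisfiesAxioms H c) (q : PrimePowerOneModFour)
    (hq : Fintype.card (𝔽 q) = q.1) {a : Fin (n + 1) → ℕ} (ha : a i = 0) (hc : GlobalDual c i a)
    {p : (𝔽 q)[X]} (hp : p.Monic) (hi : Irreducible p) : LocalDual (H q) i p a := by
  have hu0 : (q.1 : ℂ) ^ p.natDegree ≠ 0 := pow_ne_zero _ (natCast_ne_zero q)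
  rw [LocalDual, hH.localSeries_eq q hp hi ha rfl hu0, hq]
  refine (SelfDual.rescale_inv hu0 ?_).C_mul _
  have := SelfDual.map (evalRingHom ((q.1 : ℂ) ^ p.natDegree)⁻¹) hc
  rwa [coe_evalRingHom, eval_X] at this

/-- Removing the only prime leaves the `L`-series of modulus `1` or `p`. Once its pole is cleared it
equals `1`, the `L`-polynomial of a linear modulus being constant. -/
theorem sliceSeries_linear_power {F : Type*} [Field F] [Fintype F]
    {H : (Fin (n + 1) → F[X]) → ℂ} (hH : IsWeight H) (hq : Fintype.card F % 4 = 1) (hn : 2 ≤ n)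
    {p : F[X]} (hp : p.Monic) (hi : Irreducible p) (hd : p.natDegree = 1)
    {a : Fin (n + 1) → ℕ} (ha : a i = 0) :
    sliceSeries H i (fun j => p ^ a j) 1 *
        poleFactor (Fintype.card F : ℂ) (a (i - 1) + a (i + 1)) =
      localSeries H i p a * poleFactor 1 (a (i - 1) + a (i + 1)) := by
  have hstep := hH.sliceSeries_step hq hn hp hi ha (f := 1) (fun _ => monic_one) rfl
    (fun _ h => hi.not_isUnit (isUnit_of_dvd_one h)) (E := 1) monic_one
  simp only [Pi.one_apply, mul_one, residueSymbol_one_right, Int.cast_one, PowerSeries.rescale_one,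
    RingHom.id_apply, twist_one_right, map_one, one_mul] at hstep
  have hexp : ∀ Q : PowerSeries ℂ, PowerSeries.expand p.natDegree hi.natDegree_pos.ne' Q = Q := by
    intro Q
    ext k
    rw [PowerSeries.coeff_expand]
    simp [hd]
  rw [hstep, hexp, hH.sliceSeries_one, mul_assoc]
  refine (congrArg _ ?_).trans (mul_one _)
  split_ifs with he
  · rw [poleFactor_of_even _ he, lSeries_one hq]
  · have h := lSeries_selfDual hq hp hi.squarefree
    rw [hd, poleFactor_of_odd _ (by decide)] at h
    rw [poleFactor_of_odd _ he, mul_one]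
    rw [mul_one] at h
    refine h.eq_one ?_
    rw [lSeries, PowerSeries.coeff_mk, symbolSum_zero]

/-- A comparison of degrees that isolates the tuples whose local functional equations are not
covered by the induction hypothesis. -/
theorem eq_pow_of_pow_dvd {F : Type*} [Field F] [Fintype F] {a b : Fin (n + 1) → ℕ}
    {f : Fin (n + 1) → F[X]} (hf : f ∈ monicTuples F a) {p : F[X]} (hp : p.Monic)
    (hi : Irreducible p) (hb : b ≠ 0) (hd : ∀ j, p ^ b j ∣ f j) (hab : ∑ j, a j ≤ ∑ j, b j) :
    p.natDegree = 1 ∧ b = a ∧ ∀ j, f j = p ^ a j := by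
  rw [mem_monicTuples] at hf
  have hle : ∀ j, b j * p.natDegree ≤ a j := by
    intro j
    rw [← (hf j).2, ← hp.natDegree_pow]
    exact natDegree_le_of_dvd (hd j) (hf j).1.ne_zero
  have hpos := hi.natDegree_pos
  have hle' : ∀ j, b j ≤ a j := fun j => (Nat.le_mul_of_pos_right _ hpos).trans (hle j)
  have hba : b = a := by
    ext1 j
    exact (Finset.sum_eq_sum_iff_of_le fun j _ => hle' j).1
      (le_antisymm (Finset.sum_le_sum fun j _ => hle' j) hab) j (Finset.mem_univ j)
  subst hba
  have h1 : p.natDegree = 1 := by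
    obtain ⟨j, hj⟩ := Function.ne_iff.1 hb
    have hj0 : 0 < b j := Nat.pos_of_ne_zero hj
    have h2 : b j * p.natDegree ≤ b j * 1 := by simpa using hle j
    have := Nat.le_of_mul_le_mul_left h2 hj0
    omega
  refine ⟨h1, rfl, fun j => ?_⟩
  refine eq_of_monic_of_dvd_of_natDegree_le (hp.pow _) (hf j).1 (hd j) ?_
  rw [hp.natDegree_pow, (hf j).2, h1, mul_one]

/-- The subtracted term is the total contribution of the `q` tuples of powers of one linear prime.
Every other tuple involves only local functional equations of smaller total exponent, so its slice
is self-dual. -/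
theorem SatisfiesAxioms.selfDual_sub (hn : 2 ≤ n) (hH : SatisfiesAxioms H c)
    (hcard : ∀ q, Fintype.card (𝔽 q) = q.1) {a : Fin (n + 1) → ℕ} (ha : a i = 0) (ha0 : a ≠ 0)
    (ih : ∀ b : Fin (n + 1) → ℕ, b i = 0 → ∑ j, b j < ∑ j, a j → GlobalDual c i b)
    (q : PrimePowerOneModFour) :
    SelfDual (q.1 : ℂ) ((a (i - 1) + a (i + 1)) / 2)
      (PowerSeries.map (evalRingHom (q.1 : ℂ))
          (globalSeries c i a * poleFactor X (a (i - 1) + a (i + 1))) -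
        PowerSeries.C (q.1 : ℂ) * (PowerSeries.C ((q.1 : ℂ) ^ ∑ j, a j) *
          PowerSeries.rescale (q.1 : ℂ) (PowerSeries.map (evalRingHom (q.1 : ℂ)⁻¹)
            (globalSeries c i a * poleFactor X (a (i - 1) + a (i + 1)))))) := by
  classical
  have hq4 : Fintype.card (𝔽 q) % 4 = 1 := by rw [hcard]; exact q.2.2
  have hW := hH.isWeight q
  set M := a (i - 1) + a (i + 1) with hM
  set pure : Finset (Fin (n + 1) → (𝔽 q)[X]) :=
    Finset.univ.image (fun r : 𝔽 q => fun j => (X - C r) ^ a j) with hpure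
  have hsub : pure ⊆ monicTuples (𝔽 q) a := by
    intro f hf
    obtain ⟨r, _, rfl⟩ := Finset.mem_image.1 hf
    rw [mem_monicTuples]
    intro j
    exact ⟨(monic_X_sub_C r).pow _, by rw [(monic_X_sub_C r).natDegree_pow]; simp⟩
  have hinj : Function.Injective (fun r : 𝔽 q => fun j => (X - C r) ^ a j) := by
    intro r s hrs
    obtain ⟨j, hj⟩ := Function.ne_iff.1 ha0
    have h1 := congrArg (eval r) (congrFun hrs j)
    simp only [eval_pow, eval_sub, eval_X, eval_C, sub_self] at h1
    rw [zero_pow hj] at h1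
    exact sub_eq_zero.1 (pow_eq_zero_iff hj |>.1 h1.symm)
  have hsum : PowerSeries.C (q.1 : ℂ) * (PowerSeries.C ((q.1 : ℂ) ^ ∑ j, a j) *
      PowerSeries.rescale (q.1 : ℂ) (PowerSeries.map (evalRingHom (q.1 : ℂ)⁻¹)
        (globalSeries c i a * poleFactor X M))) =
      ∑ f ∈ pure, sliceSeries (H q) i f 1 * poleFactor (q.1 : ℂ) M := by
    rw [hpure, Finset.sum_image fun _ _ _ _ h => hinj h]
    rw [Finset.sum_congr rfl (g := fun _ => (PowerSeries.C ((q.1 : ℂ) ^ ∑ j, a j) *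
      PowerSeries.rescale (q.1 : ℂ) (PowerSeries.map (evalRingHom (q.1 : ℂ)⁻¹)
        (globalSeries c i a * poleFactor X M))))]
    · rw [Finset.sum_const, Finset.card_univ, hcard, nsmul_eq_mul, map_natCast]
    · intro r _
      have h := sliceSeries_linear_power hW hq4 hn (monic_X_sub_C r) (irreducible_X_sub_C r)
        (natDegree_X_sub_C r) ha
      rw [hcard] at h
      rw [h]
      exact hH.localSeries_eq q (monic_X_sub_C r) (irreducible_X_sub_C r) ha
        (by rw [natDegree_X_sub_C, pow_one]) (natCast_ne_zero q) M
  rw [hsum, map_mul, map_poleFactor, coe_evalRingHom, eval_X, hH.sum_sliceSeries q ha,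
    Finset.sum_mul, ← Finset.sum_sdiff hsub, add_sub_cancel_right]
  refine SelfDual.sum _ fun f hf => ?_
  obtain ⟨hft, hfp⟩ := Finset.mem_sdiff.1 hf
  have hft' := mem_monicTuples.1 hft
  have hfi : f i = 1 := (hft' i).1.natDegree_eq_zero.1 ((hft' i).2.trans ha)
  have h := hW.sliceSeries_selfDual hq4 hn f (fun j => (hft' j).1) hfi ?_ 1 monic_one
    squarefree_one (fun _ => isCoprime_one_left)
  · rwa [hcard, mul_one, (hft' _).1.natDegree_mul (hft' _).1, (hft' _).2, (hft' _).2] at h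
  · intro p b hp hi hb hd
    have hbi : b i = 0 := by
      by_contra hbi
      have := hd i
      rw [hfi] at this
      exact hi.not_isUnit (isUnit_of_dvd_one ((dvd_pow_self p hbi).trans this))
    refine (ih b hbi ?_).localDual hH q (hcard q) hbi hp hi
    by_contra hlt
    obtain ⟨h1, h2, h3⟩ := eq_pow_of_pow_dvd hft hp hi hb hd (not_lt.1 hlt)
    -- A monic linear `p` is `X - C r`, where `r` is minus its constant term.
    refine hfp (Finset.mem_image.2 ⟨-p.coeff 0, Finset.mem_univ _, ?_⟩)
    ext1 j
    rw [h3 j]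
    congr 1
    have := hp.eq_X_add_C h1
    rw [this]
    simp

theorem SatisfiesAxioms.highDegree (hH : SatisfiesAxioms H c) {a : Fin (n + 1) → ℕ}
    (ha : 2 ≤ ∑ j, a j) : HighDegree (∑ j, a j + 1) (c a) := by
  intro k hk
  have := hH.dominance a ha k hk
  rw [div_lt_iff₀ two_pos] at this
  have h2 : ∑ j, a j + 1 < k * 2 := by exact_mod_cast this
  omega

theorem SatisfiesAxioms.coeff_single (hH : SatisfiesAxioms H c) (j : Fin (n + 1)) (d : ℕ) :
    c (fun l => if l = j then d else 0) = X ^ d :=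
  eq_of_eval_primePower fun q => by rw [hH.coeff_initial]; simp

theorem eq_single_of_sum_eq_one {m : ℕ} {a : Fin m → ℕ} (ha : ∑ j, a j = 1) :
    ∃ j, a = fun l => if l = j then 1 else 0 := by
  obtain ⟨j, _, hj⟩ : ∃ j ∈ Finset.univ, a j ≠ 0 := by
    by_contra! h
    rw [Finset.sum_eq_zero h] at ha
    omega
  refine ⟨j, funext fun l => ?_⟩
  have h1 := Finset.add_sum_erase Finset.univ a (Finset.mem_univ j)
  split_ifs with h
  · subst h; omega
  · have : a l ≤ ∑ x ∈ Finset.univ.erase j, a x :=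
      Finset.single_le_sum (fun _ _ => Nat.zero_le _) (by simp [h])
    omega

/-- Clearing the pole subtracts `X` times the preceding coefficient. The factor `X` raises the bound
by two while only one is needed. -/
theorem SatisfiesAxioms.highDegree_coeff (hH : SatisfiesAxioms H c) {a : Fin (n + 1) → ℕ}
    (ha : a i = 0) (ha0 : 1 ≤ ∑ j, a j) {k : ℕ} (hk : 2 ≤ ∑ j, a j + k) (M : ℕ) :
    HighDegree (∑ j, a j + k + 1)
      (PowerSeries.coeff k (globalSeries c i a * poleFactor X M)) := by
  have h1 : ∀ k, 2 ≤ ∑ j, a j + k → HighDegree (∑ j, a j + k + 1) (c (Function.update a i k)) := by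
    intro k hk
    have := hH.highDegree (a := Function.update a i k) (by rwa [sum_update_of_eq_zero ha])
    rwa [sum_update_of_eq_zero ha] at this
  by_cases he : Even M
  · rw [poleFactor_of_even _ he]
    cases k with
    | zero =>
      rw [coeff_zero_mul_one_sub, globalSeries, PowerSeries.coeff_mk]
      exact h1 0 hk
    | succ k =>
      rw [coeff_succ_mul_one_sub, globalSeries, PowerSeries.coeff_mk, PowerSeries.coeff_mk]
      refine (h1 _ hk).sub ?_
      by_cases h2 : 2 ≤ ∑ j, a j + k
      · have := (h1 k h2).X_pow_mul 1
        rw [pow_one] at this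
        exact this.mono (by omega)
      -- Dominance says nothing about the preceding coefficient when its total exponent is `1`. The
      -- initial condition gives `X` for it, and the subtracted term `X ^ 2` is still high enough.
      · obtain ⟨j, hj⟩ := eq_single_of_sum_eq_one (a := a) (by omega)
        have hk0 : k = 0 := by omega
        have hup : Function.update a i 0 = a := by rw [← ha, Function.update_eq_self]
        rw [hk0, hup, hj, hH.coeff_single, pow_one]
        intro l hl
        rw [← pow_two, coeff_X_pow] at hl
        have hl2 : l = 2 := by
          by_contra h
          exact hl (if_neg h)
        have : (∑ x, if x = j then 1 else 0) = 1 := by simp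
        rw [this]
        omega
  · rw [poleFactor_of_odd _ he, mul_one, globalSeries, PowerSeries.coeff_mk]
    exact h1 k hk

theorem pred_ne_succ (hn : 2 ≤ n) (i : Fin (n + 1)) : i - 1 ≠ i + 1 := by
  intro h
  have h2 : (1 : Fin (n + 1)) + 1 = 0 := by
    have : i + 1 - (i - 1) = 0 := by rw [h, sub_self]
    rw [← this]; abel
  have h3 := congrArg Fin.val h2
  rw [Fin.val_add, Fin.val_one', Fin.val_zero, ← Nat.add_mod, Nat.mod_eq_of_lt (by omega)] at h3
  omega

/-- By `selfDual_sub`, the defect of the functional equation is unchanged by a reflection of its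
degrees in `q`. Dominance puts all its terms above the centre, so `HighDegree.eq_zero` applies. The
excess coefficients are treated in the same way. -/
theorem SatisfiesAxioms.globalDual (hn : 2 ≤ n) (hH : SatisfiesAxioms H c)
    (hcard : ∀ q, Fintype.card (𝔽 q) = q.1) (a : Fin (n + 1) → ℕ) (ha : a i = 0) :
    GlobalDual c i a := by
  induction hK : ∑ j, a j using Nat.strong_induction_on generalizing a with
  | _ K IH =>
    by_cases ha0 : a = 0
    · subst ha0
      have h1 : globalSeries c i 0 * poleFactor X 0 = 1 := by
        have hc : ∀ k, c (Function.update 0 i k) = X ^ k := by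
          intro k
          rw [← hH.coeff_single i k]
          congr 1
          ext1 j
          simp [Function.update_apply]
        ext1 k
        rw [poleFactor_of_even _ ⟨0, rfl⟩]
        cases k with
        | zero => rw [coeff_zero_mul_one_sub, globalSeries, PowerSeries.coeff_mk, hc]; simp
        | succ k =>
          rw [coeff_succ_mul_one_sub, globalSeries, PowerSeries.coeff_mk, PowerSeries.coeff_mk, hc,
            hc, PowerSeries.coeff_one, if_neg (by omega)]
          ring
      rw [GlobalDual]
      simp only [Pi.zero_apply, add_zero]
      rw [h1]
      exact SelfDual.one
    have hK1 : 1 ≤ ∑ j, a j := by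
      by_contra h
      refine ha0 (funext fun j => ?_)
      have := Finset.single_le_sum (f := a) (fun _ _ => Nat.zero_le _) (Finset.mem_univ j)
      simp only [Pi.zero_apply]
      omega
    have hdual := hH.selfDual_sub hn hcard ha ha0
      (fun b hb hlt => IH (∑ j, b j) (hK ▸ hlt) b hb rfl)
    have hhigh := fun k hk => hH.highDegree_coeff ha hK1 (k := k) hk (a (i - 1) + a (i + 1))
    -- For total exponent `1` dominance does not reach the constant coefficient. The two neighbours
    -- are distinct indices, so then `m = 0` and the symmetry is trivial.
    have hM1 : ∑ j, a j = 1 → (a (i - 1) + a (i + 1)) / 2 = 0 := by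
      intro h
      obtain ⟨j, hj⟩ := eq_single_of_sum_eq_one h
      have := pred_ne_succ hn i
      rw [hj]
      simp only
      split_ifs with h1 h2
      · exact absurd (h1.trans h2.symm) this
      all_goals rfl
    rw [GlobalDual]
    set m := (a (i - 1) + a (i + 1)) / 2
    set T := globalSeries c i a * poleFactor X (a (i - 1) + a (i + 1)) with hT
    have hcoeff : ∀ (q : PrimePowerOneModFour) (k : ℕ),
        PowerSeries.coeff k (PowerSeries.map (evalRingHom (q.1 : ℂ)) T -
          PowerSeries.C (q.1 : ℂ) * (PowerSeries.C ((q.1 : ℂ) ^ ∑ j, a j) *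
            PowerSeries.rescale (q.1 : ℂ) (PowerSeries.map (evalRingHom (q.1 : ℂ)⁻¹) T))) =
        (PowerSeries.coeff k T).eval (q.1 : ℂ) - (q.1 : ℂ) * ((q.1 : ℂ) ^ (∑ j, a j) *
          ((q.1 : ℂ) ^ k * (PowerSeries.coeff k T).eval (q.1 : ℂ)⁻¹)) := by
      intro q k
      rw [map_sub, PowerSeries.coeff_C_mul, PowerSeries.coeff_C_mul, PowerSeries.coeff_rescale,
        PowerSeries.coeff_map, PowerSeries.coeff_map, coe_evalRingHom, coe_evalRingHom]
    refine ⟨fun k hk => ?_, fun k hk => ?_⟩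
    · refine (hhigh k (by omega)).eq_zero fun q => ?_
      have h := (hdual q).1 k hk
      rw [hcoeff] at h
      rw [pow_succ, pow_add]
      linear_combination h
    · by_cases htriv : m = 0
      · have hk0 : k = 0 := by omega
        rw [hk0, htriv]
      · have hK2 : 2 ≤ ∑ j, a j := by
          by_contra h
          exact htriv (hM1 (by omega))
        -- Both terms of the defect obey this same bound: the shift by `m` adds `2m` to `k`, and the
        -- shift by `k` adds `2k` to `2m - k`.
        refine sub_eq_zero.1 (HighDegree.eq_zero (w := ∑ j, a j + k + 1 + 2 * m) ?_ fun q => ?_)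
        · refine ((hhigh k (by omega)).X_pow_mul m).sub ?_
          exact ((hhigh (2 * m - k) (by omega)).X_pow_mul k).mono (by omega)
        · have h := (hdual q).2 k hk
          rw [hcoeff, hcoeff] at h
          have hq0 := natCast_ne_zero q
          simp only [eval_sub, eval_mul, eval_pow, eval_X]
          set A := (PowerSeries.coeff k T).eval (q.1 : ℂ)
          set B := (PowerSeries.coeff (2 * m - k) T).eval (q.1 : ℂ)
          set A' := (PowerSeries.coeff k T).eval (q.1 : ℂ)⁻¹
          set B' := (PowerSeries.coeff (2 * m - k) T).eval (q.1 : ℂ)⁻¹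
          have e1 : (q.1 : ℂ) ^ k * (q.1 : ℂ) ^ (2 * m - k) = (q.1 : ℂ) ^ m * (q.1 : ℂ) ^ m := by
            rw [← pow_add, ← pow_add]; congr 1; omega
          have e2 : (q.1 : ℂ) ^ (∑ j, a j + k + 1 + 2 * m) * (((q.1 : ℂ)⁻¹) ^ m * A' -
              ((q.1 : ℂ)⁻¹) ^ k * B') = (q.1 : ℂ) ^ (∑ j, a j) * (q.1 : ℂ) *
                ((q.1 : ℂ) ^ k * (q.1 : ℂ) ^ m * A' - (q.1 : ℂ) ^ m * (q.1 : ℂ) ^ m * B') := by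
            rw [two_mul, pow_add, pow_add, pow_add, pow_add, pow_one, inv_pow, inv_pow]
            field_simp
          rw [e2]
          linear_combination h + (-(q.1 : ℂ) * (q.1 : ℂ) ^ (∑ j, a j) * B') * e1

theorem SatisfiesAxioms.localDual (hn : 2 ≤ n) (hH : SatisfiesAxioms H c)
    (hcard : ∀ q, Fintype.card (𝔽 q) = q.1) (q : PrimePowerOneModFour) {a : Fin (n + 1) → ℕ}
    (ha : a i = 0) {p : (𝔽 q)[X]} (hp : p.Monic) (hi : Irreducible p) : LocalDual (H q) i p a :=
  (hH.globalDual hn hcard a ha).localDual hH q (hcard q) ha hp hi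

end LocalToGlobal

/-! ### Squarefree parts. -/

section SquarefreePart

variable {F : Type*} [Field F] [Fintype F]

theorem exists_squarefree_part (f : F[X]) (hf : f.Monic) :
    ∃ s h : F[X], s.Monic ∧ h.Monic ∧ Squarefree s ∧ f = s * h ^ 2 := by
  refine monic_induction (P := fun f => ∃ s h : F[X], s.Monic ∧ h.Monic ∧ Squarefree s ∧
    f = s * h ^ 2) ⟨1, 1, monic_one, monic_one, squarefree_one, by simp⟩ ?_ f hf
  rintro p f hp hi hf ⟨s, h, hs, hh, hsq, rfl⟩
  by_cases hps : p ∣ s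
  · obtain ⟨t, rfl⟩ := hps
    exact ⟨t, p * h, hp.of_mul_monic_left hs, hp.mul hh, hsq.squarefree_of_dvd (dvd_mul_left _ _),
      by ring⟩
  · exact ⟨p * s, h, hp.mul hs, hh, (squarefree_mul_iff).2
      ⟨(isCoprime_of_irreducible hi hps).isRelPrime, hi.squarefree, hsq⟩, by ring⟩

/-- If `s'` is the squarefree part of `g`, then `s * s'` is a square. Squarefreeness of `s` gives
`s' = s * u ^ 2`, and that of `s'` makes `u` a unit. -/
theorem exists_eq_mul_sq_of_isSquare {s h g : F[X]} (hs : s.Monic) (hsq : Squarefree s)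
    (hh : h.Monic) (hg : g.Monic) (hfg : IsSquare (s * h ^ 2 * g)) :
    ∃ k : F[X], k.Monic ∧ g = s * k ^ 2 := by
  obtain ⟨r, hr⟩ := hfg
  obtain ⟨s', h', hs', hh', hsq', rfl⟩ := exists_squarefree_part g hg
  have h1 : h * h' ∣ r := by
    refine (IsIntegrallyClosed.pow_dvd_pow_iff two_ne_zero).1 ⟨s * s', ?_⟩
    rw [pow_two r, ← hr]
    ring
  obtain ⟨t, rfl⟩ := h1
  have h2 : s * s' = t ^ 2 := by
    refine mul_left_cancel₀ (pow_ne_zero 2 (hh.mul hh').ne_zero) ?_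
    linear_combination hr
  have h3 : s ∣ t := (hsq.dvd_pow_iff_dvd two_ne_zero).1 ⟨s', h2.symm⟩
  obtain ⟨u, rfl⟩ := h3
  have h4 : s' = s * u ^ 2 := mul_left_cancel₀ hs.ne_zero (by rw [h2]; ring)
  have hu : IsUnit u := hsq' u ⟨s, by rw [h4]; ring⟩
  have h5 : u ^ 2 = 1 := by
    have : (u ^ 2).Monic := hs.of_mul_monic_left (h4 ▸ hs')
    exact this.eq_one_of_isUnit (hu.pow 2)
  exact ⟨h', hh', by rw [h4, h5, mul_one]⟩

end SquarefreePart

/-! ### Index arithmetic for the tuple `(f_0, f_0 f_2, f_2, …)`. -/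

section ResidueTuple

variable {n : ℕ}

theorem residueTuple_evenIndex {M : Type*} [Mul M] (g : Fin (n / 2 + 1) → M)
    (j : Fin (n / 2 + 1)) : residueTuple g (evenIndex j) = g j := by
  have h : Even (evenIndex j : Fin (n + 1)).1 := even_two_mul _
  rw [residueTuple, if_pos h]
  congr 1
  ext
  simp only [evenIndex, Fin.ofNat]
  rw [Nat.mul_div_cancel_left _ two_pos, Nat.mod_eq_of_lt j.2]

theorem val_pred_of_odd {i : Fin (n + 1)} (hi : Odd i.1) : (i - 1).1 = i.1 - 1 := by
  obtain ⟨m, hm⟩ := hi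
  have h0 : i ≠ 0 := by
    rintro rfl
    simp at hm
  rw [Fin.val_sub_one_of_ne_zero h0]

/-- For an odd index, the two neighbours are even indices. -/
theorem pred_eq_evenIndex {i : Fin (n + 1)} (hi : Odd i.1) :
    i - 1 = evenIndex (Fin.ofNat (n / 2 + 1) (i.1 / 2)) := by
  ext
  rw [val_pred_of_odd hi]
  obtain ⟨m, hm⟩ := hi
  have := i.2
  simp only [evenIndex, Fin.ofNat]
  rw [Nat.mod_eq_of_lt (by omega)]
  omega

theorem succ_eq_evenIndex {i : Fin (n + 1)} (hi : Odd i.1) :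
    i + 1 = evenIndex (Fin.ofNat (n / 2 + 1) (i.1 / 2 + 1)) := by
  ext
  obtain ⟨m, hm⟩ := hi
  have := i.2
  rw [Fin.val_add_one]
  simp only [evenIndex, Fin.ofNat]
  split_ifs with h
  -- Here `n` is odd: the successor of the last index wraps around to `0`, and so does `n / 2 + 1`.
  · have h' : i.1 = n := by rw [h]; rfl
    rw [show i.1 / 2 + 1 = n / 2 + 1 by omega, Nat.mod_self]
  · have h' : i.1 ≠ n := fun h' => h (Fin.ext h')
    rw [Nat.mod_eq_of_lt (by omega)]
    omega

theorem residueTuple_odd {M : Type*} [Mul M] (g : Fin (n / 2 + 1) → M) {i : Fin (n + 1)}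
    (hi : Odd i.1) : residueTuple g i = residueTuple g (i - 1) * residueTuple g (i + 1) := by
  rw [pred_eq_evenIndex hi, succ_eq_evenIndex hi, residueTuple_evenIndex, residueTuple_evenIndex,
    residueTuple, if_neg (Nat.not_even_iff_odd.2 hi)]

theorem exists_evenIndex {i : Fin (n + 1)} (hi : Even i.1) :
    ∃ j : Fin (n / 2 + 1), i = evenIndex j := by
  obtain ⟨m, hm⟩ := hi
  have := i.2
  exact ⟨⟨m, by omega⟩, Fin.ext (by simp only [evenIndex]; omega)⟩

theorem residueTuple_mul {M : Type*} [CommMonoid M] (f g : Fin (n / 2 + 1) → M) :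
    residueTuple (fun j => f j * g j) = fun i => residueTuple f i * residueTuple g i := by
  ext1 i
  simp only [residueTuple]
  split_ifs
  · rfl
  · exact mul_mul_mul_comm _ _ _ _

theorem residueTuple_induction {M : Type*} [Mul M] {P : M → Prop}
    (hmul : ∀ a b, P a → P b → P (a * b)) {g : Fin (n / 2 + 1) → M} (h : ∀ j, P (g j))
    (i : Fin (n + 1)) : P (residueTuple g i) := by
  unfold residueTuple
  split_ifs
  exacts [h _, hmul _ _ (h _) (h _)]

end ResidueTuple

/-! ### Collapsing one entry; squares and multiplicativity on the diagonal. -/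

section OneVariable

variable {F : Type*} [Field F] [Fintype F] {n : ℕ} {H : (Fin (n + 1) → F[X]) → ℂ}
  {i : Fin (n + 1)}

/-- The sum over the polynomials `f_i` of degree `deg (f_{i-1} f_{i+1})` is governed by the single
weight with `f_i = f_{i-1} f_{i+1}`. -/
theorem IsWeight.sum_update_eq (hH : IsWeight H) (hq : Fintype.card F % 4 = 1) (hn : 2 ≤ n)
    (hloc : ∀ (p : F[X]) (b : Fin (n + 1) → ℕ), p.Monic → Irreducible p → b ≠ 0 → b i = 0 →
      LocalDual H i p b)
    (f : Fin (n + 1) → F[X]) (hf : ∀ j, (f j).Monic) :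
    ∑ g ∈ monicPolys F (f (i - 1) * f (i + 1)).natDegree, H (Function.update f i g) =
      (((Fintype.card F : ℝ) ^ (((f (i - 1) * f (i + 1)).natDegree : ℝ) / 2) : ℝ) : ℂ) *
        H (Function.update f i (f (i - 1) * f (i + 1))) := by
  classical
  -- Neither side depends on the entry `f i`.
  wlog hfi : f i = 1 generalizing f
  · have := this (Function.update f i 1) (monic_update hf monic_one) (Function.update_self ..)
    simpa only [Function.update_of_ne (pred_ne hn i), Function.update_of_ne (succ_ne hn i),
      Function.update_idem] using this
  have hcop : ∀ j, IsCoprime (1 : F[X]) (f j) := fun _ => isCoprime_one_left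
  have hself := hH.sliceSeries_selfDual hq hn f hf hfi (fun p b hp hi hb hd => by
    refine hloc p b hp hi hb ?_
    by_contra hbi
    have := hd i
    rw [hfi] at this
    exact hi.not_isUnit (isUnit_of_dvd_one ((dvd_pow_self p hbi).trans this)))
    1 monic_one squarefree_one hcop
  have hcoeff : ∀ k, PowerSeries.coeff k (sliceSeries H i f 1) =
      ∑ g ∈ monicPolys F k, H (Function.update f i g) := by
    intro k
    rw [sliceSeries, genSeries, PowerSeries.coeff_mk]
    simp [residueSymbol_one_right]
  rw [mul_one] at hself
  set N := (f (i - 1) * f (i + 1)).natDegree with hN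
  rw [← hcoeff]
  by_cases he : Even N
  · have hval := hH.sliceSeries_hasValueOne hq hn hloc f hf hfi 1 monic_one squarefree_one hcop
      (by rwa [mul_one])
    rw [if_pos rfl] at hval
    rw [poleFactor_of_even _ he] at hself
    -- The functional equation expresses the coefficient, which is governed by the pole at `1/q`,
    -- through the value at `1`.
    have h := hself.coeff_eq_of_hasValueOne hval
    obtain ⟨m, hm⟩ := he
    have hm2 : N / 2 = m := by omega
    rw [hm2, two_mul, ← hm] at h
    rw [h]
    congr 1
    rw [hm, show (((m + m : ℕ) : ℝ) / 2) = (m : ℝ) by push_cast; ring, Real.rpow_natCast]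
    push_cast
    rfl
  -- In odd degree both sides vanish: the left lies beyond the degree of the polynomial, and on the
  -- right a polynomial of odd degree is not a square.
  · rw [poleFactor_of_odd _ he, mul_one] at hself
    obtain ⟨m, hm⟩ := Nat.not_even_iff_odd.1 he
    rw [hself.1 N (by omega)]
    have hz : H (Function.update f i (f (i - 1) * f (i + 1))) = 0 := by
      by_contra hne
      obtain ⟨r, hr⟩ := hH.isSquare_of_ne_zero hq hn hloc f hf hfi hne
      refine he ⟨r.natDegree, ?_⟩
      rw [hN, hr, ← pow_two, natDegree_pow, two_mul]
    rw [hz, mul_zero]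

variable (hH : IsWeight H) (hq : Fintype.card F % 4 = 1) (hn : 2 ≤ n)
    (hloc : ∀ (i : Fin (n + 1)) (p : F[X]) (b : Fin (n + 1) → ℕ), p.Monic → Irreducible p →
      b i = 0 → LocalDual H i p b)

include hH hq hn hloc

theorem isSquare_residueTuple {f : Fin (n / 2 + 1) → F[X]} (hf : ∀ j, (f j).Monic)
    (hne : H (residueTuple f) ≠ 0) {i : Fin (n + 1)} (hi : Odd i.1) :
    IsSquare (residueTuple f i) := by
  have hm := residueTuple_induction (P := Monic) (fun a b ha hb => ha.mul hb) hf
  have h := hH.isSquare_of_ne_zero hq hn (i := i) (fun p b hp hi _ hb => hloc i p b hp hi hb)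
    (Function.update (residueTuple f) i 1) (monic_update hm monic_one) (Function.update_self ..)
  rw [Function.update_of_ne (pred_ne hn i), Function.update_of_ne (succ_ne hn i),
    Function.update_idem, ← residueTuple_odd f hi, Function.update_eq_self] at h
  exact h hne

theorem exists_common_squarefree_part {f : Fin (n / 2 + 1) → F[X]} (hf : ∀ j, (f j).Monic)
    (hne : H (residueTuple f) ≠ 0) :
    ∃ s : F[X], s.Monic ∧ Squarefree s ∧ ∀ j, ∃ h : F[X], h.Monic ∧ f j = s * h ^ 2 := by
  obtain ⟨s, h, hs, hh, hsq, hfs⟩ := exists_squarefree_part (f 0) (hf 0)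
  refine ⟨s, hs, hsq, fun j => ?_⟩
  induction j using Fin.induction with
  | zero => exact ⟨h, hh, hfs⟩
  | succ j ih =>
    obtain ⟨k, hk, hfk⟩ := ih
    have hlt := j.2
    have hsqr := isSquare_residueTuple hH hq hn hloc hf hne
      (i := ⟨2 * j.1 + 1, by omega⟩) ⟨j.1, rfl⟩
    rw [residueTuple, if_neg (by simp [parity_simps])] at hsqr
    have e1 : Fin.ofNat (n / 2 + 1) ((2 * j.1 + 1) / 2) = j.castSucc := by
      ext
      simp only [Fin.ofNat, Fin.val_castSucc]
      rw [show (2 * j.1 + 1) / 2 = j.1 by omega, Nat.mod_eq_of_lt (by omega)]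
    have e2 : Fin.ofNat (n / 2 + 1) ((2 * j.1 + 1) / 2 + 1) = j.succ := by
      ext
      simp only [Fin.ofNat, Fin.val_succ]
      rw [show (2 * j.1 + 1) / 2 = j.1 by omega, Nat.mod_eq_of_lt (by omega)]
    simp only [e1, e2] at hsqr
    rw [hfk] at hsqr
    exact exists_eq_mul_sq_of_isSquare hs hsq hk (hf _) hsqr

omit hH hq hn hloc

theorem residueSymbol_mul_sq {s h s' h' : F[X]} (hs' : s'.Monic) (hh' : h'.Monic)
    (hcop : IsCoprime (s * h ^ 2) (s' * h' ^ 2)) :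
    residueSymbol (s * h ^ 2) (s' * h' ^ 2) = residueSymbol s s' := by
  have h1 : IsCoprime s h' := (hcop.of_mul_left_left.of_mul_right_right).of_isCoprime_of_dvd_right
    (dvd_pow_self h' two_ne_zero)
  have h2 : IsCoprime h (s' * h' ^ 2) := (hcop.of_mul_left_right).of_isCoprime_of_dvd_left
    (dvd_pow_self h two_ne_zero)
  rw [residueSymbol_mul_left, residueSymbol_pow_left, residueSymbol_sq h2, mul_one,
    residueSymbol_mul_right _ hs'.ne_zero (hh'.pow 2).ne_zero,
    residueSymbol_pow_right _ hh'.ne_zero, residueSymbol_sq h1, mul_one]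

theorem residueSymbol_sq_left {f g : F[X]} (hf : IsSquare f) (hcop : IsCoprime f g) :
    residueSymbol f g = 1 := by
  obtain ⟨r, rfl⟩ := hf
  rw [residueSymbol_mul_left, ← pow_two, residueSymbol_sq hcop.of_mul_left_left]

theorem residueSymbol_sq_right {f g : F[X]} (hg0 : g ≠ 0) (hg : IsSquare g)
    (hcop : IsCoprime f g) : residueSymbol f g = 1 := by
  obtain ⟨r, rfl⟩ := hg
  have hr := left_ne_zero_of_mul hg0
  rw [residueSymbol_mul_right _ hr hr, ← pow_two, residueSymbol_sq hcop.of_mul_right_left]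

include hH hq hn hloc

/-- When a weight on the right vanishes, so do both sides. Otherwise the odd entries are squares and
every symbol involving one of them is `1`. The remaining symbols join two adjacent even indices, and
common squarefree parts make these cancel by reciprocity. -/
theorem residueTuple_weight_mul {f g : Fin (n / 2 + 1) → F[X]} (hf : ∀ j, (f j).Monic)
    (hg : ∀ j, (g j).Monic) (hfg : IsCoprime (∏ j, f j) (∏ j, g j)) :
    H (residueTuple fun j => f j * g j) = H (residueTuple f) * H (residueTuple g) := by
  have hfm := residueTuple_induction (P := Monic) (fun a b ha hb => ha.mul hb) hf
  have hgm := residueTuple_induction (P := Monic) (fun a b ha hb => ha.mul hb) hg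
  have hcop0 : ∀ j k, IsCoprime (f j) (g k) := fun j k =>
    (hfg.of_prod_left j (Finset.mem_univ j)).of_prod_right k (Finset.mem_univ k)
  have hcop : ∀ i k, IsCoprime (residueTuple f i) (residueTuple g k) := fun i k =>
    residueTuple_induction (P := fun x => IsCoprime x (residueTuple g k))
      (fun a b ha hb => ha.mul_left hb) (fun j => residueTuple_induction
        (P := fun y => IsCoprime (f j) y) (fun a b ha hb => ha.mul_right hb) (hcop0 j) k) i
  rw [residueTuple_mul, hH.mul _ _ hfm hgm
    (IsCoprime.prod_left fun i _ => IsCoprime.prod_right fun k _ => hcop i k)]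
  by_cases hfz : H (residueTuple f) = 0
  · rw [hfz]; ring
  by_cases hgz : H (residueTuple g) = 0
  · rw [hgz]; ring
  have hfs := fun i hi => isSquare_residueTuple hH hq hn hloc hf hfz (i := i) hi
  have hgs := fun i hi => isSquare_residueTuple hH hq hn hloc hg hgz (i := i) hi
  have ht : twist (residueTuple f) (residueTuple g) = 1 := by
    refine Finset.prod_eq_one fun i _ => ?_
    rcases Nat.even_or_odd i.1 with he | ho
    · rcases Nat.even_or_odd (i + 1).1 with he1 | ho1
      -- Two cyclically adjacent even indices occur only for `n` even, as the pair `n`, `0`. Up to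
      -- squares the symbols there are `(s/s')` and `(s'/s)`.
      · obtain ⟨s, hs, _, hsf⟩ := exists_common_squarefree_part hH hq hn hloc hf hfz
        obtain ⟨s', hs', _, hsg⟩ := exists_common_squarefree_part hH hq hn hloc hg hgz
        obtain ⟨j, hj⟩ := exists_evenIndex he
        obtain ⟨k, hk⟩ := exists_evenIndex he1
        have c1 := hcop0 j k
        have c2 := (hcop0 k j).symm
        rw [hj] at hk
        rw [hj, hk, residueTuple_evenIndex, residueTuple_evenIndex, residueTuple_evenIndex,
          residueTuple_evenIndex]
        obtain ⟨h1, hm1, e1⟩ := hsf j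
        obtain ⟨h2, hm2, e2⟩ := hsf k
        obtain ⟨h3, hm3, e3⟩ := hsg j
        obtain ⟨h4, hm4, e4⟩ := hsg k
        rw [e1, e4] at c1
        rw [e2, e3] at c2
        rw [e1, e2, e3, e4, residueSymbol_mul_sq hs' hm4 c1, residueSymbol_mul_sq hs hm2 c2,
          residueSymbol_comm hq hs' hs, ← pow_two,
          residueSymbol_sq c1.of_mul_left_left.of_mul_right_left]
      · rw [residueSymbol_sq_right (hgm _).ne_zero (hgs _ ho1) (hcop _ _),
          residueSymbol_sq_right (hfm _).ne_zero (hfs _ ho1) (hcop _ _).symm, one_mul]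
    · rw [residueSymbol_sq_left (hfs _ ho) (hcop _ _),
        residueSymbol_sq_left (hgs _ ho) (hcop _ _).symm, one_mul]
  rw [ht, Int.cast_one, mul_one]

theorem residueTerm_mul {q : ℕ} (hq0 : 0 < q) {f g : Fin (n / 2 + 1) → F[X]}
    (hf : ∀ j, (f j).Monic) (hg : ∀ j, (g j).Monic) (hfg : IsCoprime (∏ j, f j) (∏ j, g j)) :
    residueTerm q H (fun j => f j * g j) = residueTerm q H f * residueTerm q H g := by
  rw [residueTerm, residueTerm, residueTerm, residueTuple_weight_mul hH hq hn hloc hf hg hfg]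
  have : ∑ j, endWeight j * ((f j * g j).natDegree : ℝ) =
      ∑ j, endWeight (n := n) j * ((f j).natDegree : ℝ) + ∑ j, endWeight j * ((g j).natDegree : ℝ) := by
    rw [← Finset.sum_add_distrib]
    refine Finset.sum_congr rfl fun j _ => ?_
    rw [(hf j).natDegree_mul (hg j)]
    push_cast; ring
  rw [this, Real.rpow_add (by exact_mod_cast hq0), Complex.ofReal_mul, mul_div_mul_comm]

end OneVariable

/-! ### Degrees on the diagonal. -/

section Indices

variable {n : ℕ}

theorem mem_oddIndices {i : Fin (n + 1)} : i ∈ oddIndices n ↔ Odd i.1 := by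
  simp [oddIndices]

theorem odd_ne_evenIndex {i : Fin (n + 1)} (hi : Odd i.1) (j : Fin (n / 2 + 1)) :
    i ≠ evenIndex j := by
  rintro rfl
  exact Nat.not_even_iff_odd.2 hi (even_two_mul _)

theorem odd_ne_pred {i j : Fin (n + 1)} (hi : Odd i.1) (hj : Odd j.1) : j ≠ i - 1 := by
  rw [pred_eq_evenIndex hi]
  exact odd_ne_evenIndex hj _

theorem odd_ne_succ {i j : Fin (n + 1)} (hi : Odd i.1) (hj : Odd j.1) : j ≠ i + 1 := by
  rw [succ_eq_evenIndex hi]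
  exact odd_ne_evenIndex hj _

/-- The degrees of the tuple `(f_0, f_0 f_2, f_2, …)` when `deg f_{2j} = e j`. -/
def residueDegree (e : Fin (n / 2 + 1) → ℕ) : Fin (n + 1) → ℕ := fun i =>
  Multiplicative.toAdd (residueTuple (fun j => Multiplicative.ofAdd (e j)) i)

theorem residueDegree_evenIndex (e : Fin (n / 2 + 1) → ℕ) (j : Fin (n / 2 + 1)) :
    residueDegree e (evenIndex j) = e j := by
  rw [residueDegree, residueTuple_evenIndex, toAdd_ofAdd]

theorem residueDegree_odd (e : Fin (n / 2 + 1) → ℕ) {i : Fin (n + 1)} (hi : Odd i.1) :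
    residueDegree e i = residueDegree e (i - 1) + residueDegree e (i + 1) := by
  rw [residueDegree, residueTuple_odd _ hi, toAdd_mul]
  rfl

theorem residueDegree_odd' (e : Fin (n / 2 + 1) → ℕ) {i : Fin (n + 1)} (hi : Odd i.1) :
    residueDegree e i =
      e (Fin.ofNat (n / 2 + 1) (i.1 / 2)) + e (Fin.ofNat (n / 2 + 1) (i.1 / 2 + 1)) := by
  rw [residueDegree_odd e hi, pred_eq_evenIndex hi, succ_eq_evenIndex hi,
    residueDegree_evenIndex, residueDegree_evenIndex]

end Indices

/-! ### The formal residue of a series with geometric coefficients. -/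

section Poles

variable {n : ℕ} {q : ℂ} {i j : Fin (n + 1)} {V : MvPowerSeries (Fin (n + 1)) ℂ}

/-- The coefficients of `V` are eventually geometric in the `i`-th exponent. -/
def Stable (q : ℂ) (i : Fin (n + 1)) (V : MvPowerSeries (Fin (n + 1)) ℂ) : Prop :=
  ∀ a : Fin (n + 1) →₀ ℕ, a (i - 1) + a (i + 1) ≤ a i →
    MvPowerSeries.coeff (a + Finsupp.single i 1) V = q * MvPowerSeries.coeff a V

/-- The coefficients of `V` eventually vanish in the `i`-th exponent. -/
def Vanishing (i : Fin (n + 1)) (V : MvPowerSeries (Fin (n + 1)) ℂ) : Prop :=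
  ∀ a : Fin (n + 1) →₀ ℕ, a (i - 1) + a (i + 1) < a i → MvPowerSeries.coeff a V = 0

theorem coeff_one_sub_mul {σ : Type*} (q : ℂ) (i : σ) (V : MvPowerSeries σ ℂ) (a : σ →₀ ℕ) :
    MvPowerSeries.coeff a ((1 - MvPowerSeries.C q * MvPowerSeries.X i) * V) =
      MvPowerSeries.coeff a V - if Finsupp.single i 1 ≤ a then
        q * MvPowerSeries.coeff (a - Finsupp.single i 1) V else 0 := by
  rw [sub_mul, one_mul, map_sub, mul_assoc, MvPowerSeries.coeff_C_mul, MvPowerSeries.X_def,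
    MvPowerSeries.coeff_monomial_mul]
  split_ifs <;> simp

theorem Stable.vanishing (hn : 2 ≤ n) (h : Stable q i V) :
    Vanishing i ((1 - MvPowerSeries.C q * MvPowerSeries.X i) * V) := by
  intro a ha
  have h1 : Finsupp.single i 1 ≤ a := by
    rw [Finsupp.single_le_iff]; omega
  rw [coeff_one_sub_mul, if_pos h1, ← h, tsub_add_cancel_of_le h1, sub_self]
  rw [Finsupp.tsub_apply, Finsupp.tsub_apply, Finsupp.tsub_apply, Finsupp.single_eq_same,
    Finsupp.single_eq_of_ne (pred_ne hn i), Finsupp.single_eq_of_ne (succ_ne hn i)]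
  omega

theorem Vanishing.mul (h : Vanishing i V) (h1 : j ≠ i) (h2 : j ≠ i - 1) (h3 : j ≠ i + 1) :
    Vanishing i ((1 - MvPowerSeries.C q * MvPowerSeries.X j) * V) := by
  intro a ha
  rw [coeff_one_sub_mul, h a ha, zero_sub, neg_eq_zero]
  split_ifs
  · rw [h, mul_zero]
    rw [Finsupp.tsub_apply, Finsupp.tsub_apply, Finsupp.tsub_apply,
      Finsupp.single_eq_of_ne h1.symm, Finsupp.single_eq_of_ne h2.symm,
      Finsupp.single_eq_of_ne h3.symm]
    exact ha
  · rfl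

theorem Stable.mul (h : Stable q i V) (h1 : j ≠ i) (h2 : j ≠ i - 1) (h3 : j ≠ i + 1) :
    Stable q i ((1 - MvPowerSeries.C q * MvPowerSeries.X j) * V) := by
  intro a ha
  have hle : Finsupp.single j 1 ≤ a + Finsupp.single i 1 ↔ Finsupp.single j 1 ≤ a := by
    rw [Finsupp.single_le_iff, Finsupp.single_le_iff, Finsupp.add_apply,
      Finsupp.single_eq_of_ne h1, add_zero]
  rw [coeff_one_sub_mul, coeff_one_sub_mul, h a ha, mul_sub]
  simp only [hle]
  split_ifs with hj
  · rw [tsub_add_eq_add_tsub hj |>.symm, h]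
    rw [Finsupp.tsub_apply, Finsupp.tsub_apply, Finsupp.tsub_apply,
      Finsupp.single_eq_of_ne h1.symm, Finsupp.single_eq_of_ne h2.symm,
      Finsupp.single_eq_of_ne h3.symm]
    exact ha
  · rw [mul_zero]

/-- The factors are multiplied in one at a time. Odd indices are never adjacent, so the factor at
`j` leaves alone the three exponents that govern the condition at another odd `i`. -/
theorem vanishing_prod (hn : 2 ≤ n) (hV : ∀ i : Fin (n + 1), Odd i.1 → Stable q i V)
    (O : Finset (Fin (n + 1))) (hO : O ⊆ oddIndices n) (i : Fin (n + 1)) (hi : Odd i.1) :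
    (i ∈ O → Vanishing i ((∏ j ∈ O, (1 - MvPowerSeries.C q * MvPowerSeries.X j)) * V)) ∧
      (i ∉ O → Stable q i ((∏ j ∈ O, (1 - MvPowerSeries.C q * MvPowerSeries.X j)) * V)) := by
  classical
  induction O using Finset.induction_on with
  | empty => simpa using hV i hi
  | insert j O hj ih =>
    have hjo : Odd j.1 := mem_oddIndices.1 (hO (Finset.mem_insert_self j O))
    have ih' := ih fun x hx => hO (Finset.mem_insert_of_mem hx)
    rw [Finset.prod_insert hj, mul_assoc]
    by_cases hij : j = i
    · subst hij
      exact ⟨fun _ => (ih'.2 hj).vanishing hn, fun h => absurd (Finset.mem_insert_self _ _) h⟩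
    · refine ⟨fun h => ?_, fun h => ?_⟩
      · exact (ih'.1 ((Finset.mem_insert.1 h).resolve_left (Ne.symm hij))).mul hij
          (odd_ne_pred hi hjo) (odd_ne_succ hi hjo)
      · exact (ih'.2 fun h' => h (Finset.mem_insert_of_mem h')).mul hij
          (odd_ne_pred hi hjo) (odd_ne_succ hi hjo)

theorem le_residueDegree_of_coeff_ne_zero (hn : 2 ≤ n) {N : ℕ}
    (hV : ∀ i : Fin (n + 1), Odd i.1 → Stable (N : ℂ) i V) {e : Fin (n / 2 + 1) →₀ ℕ}
    {a : Fin (n + 1) →₀ ℕ} (ha : a ∈ residueSupport N V e) (i : Fin (n + 1)) :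
    a i ≤ residueDegree e i := by
  rcases Nat.even_or_odd i.1 with hi | hi
  · obtain ⟨j, rfl⟩ := exists_evenIndex hi
    rw [residueDegree_evenIndex, ha.1 j]
  · by_contra hlt
    refine ha.2 ?_
    have h := (vanishing_prod hn hV (oddIndices n) subset_rfl i hi).1 (mem_oddIndices.2 hi)
    refine h a ?_
    rw [residueDegree_odd e hi, pred_eq_evenIndex hi, succ_eq_evenIndex hi,
      residueDegree_evenIndex, residueDegree_evenIndex] at hlt
    rw [pred_eq_evenIndex hi, succ_eq_evenIndex hi, ha.1, ha.1]
    omega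

theorem hasFormalResidue_of_stable (hn : 2 ≤ n) {N : ℕ}
    (hV : ∀ i : Fin (n + 1), Odd i.1 → Stable (N : ℂ) i V) : HasFormalResidue N V := by
  intro e
  refine (Set.finite_Iic (Finsupp.equivFunOnFinite.symm (residueDegree e))).subset fun a ha => ?_
  exact fun i => le_residueDegree_of_coeff_ne_zero hn hV ha i

open Classical in
/-- The inverse of `∏_{i ∈ O} (1 - q x_i)`. -/
def geometricSeries {σ : Type*} (q : ℂ) (O : Finset σ) : MvPowerSeries σ ℂ := fun u =>
  if u.support ⊆ O then ∏ i ∈ O, q ^ u i else 0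

theorem coeff_geometricSeries {σ : Type*} [DecidableEq σ] (q : ℂ) (O : Finset σ) (u : σ →₀ ℕ) :
    MvPowerSeries.coeff u (geometricSeries q O) =
      if u.support ⊆ O then ∏ i ∈ O, q ^ u i else 0 := by
  rw [MvPowerSeries.coeff_apply, geometricSeries]
  congr

theorem prod_mul_geometricSeries {σ : Type*} (q : ℂ) (O : Finset σ) :
    (∏ j ∈ O, (1 - MvPowerSeries.C q * MvPowerSeries.X j)) * geometricSeries q O = 1 := by
  classical
  induction O using Finset.induction_on with
  | empty =>
    ext u
    rw [Finset.prod_empty, one_mul, coeff_geometricSeries, MvPowerSeries.coeff_one]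
    simp
  | insert i O hi ih =>
    rw [Finset.prod_insert hi, mul_comm (_ * _ : MvPowerSeries σ ℂ), mul_comm (1 - _), mul_left_comm,
      mul_comm (geometricSeries q (insert i O))]
    rw [show (1 - MvPowerSeries.C q * MvPowerSeries.X i) * geometricSeries q (insert i O) =
      geometricSeries q O from ?_, ih]
    ext u
    rw [coeff_one_sub_mul, coeff_geometricSeries, coeff_geometricSeries, coeff_geometricSeries,
      Finset.prod_insert hi]
    by_cases hu : u i = 0
    · have h1 : ¬ Finsupp.single i 1 ≤ u := by rw [Finsupp.single_le_iff]; omega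
      have h2 : u.support ⊆ insert i O ↔ u.support ⊆ O :=
        Finset.subset_insert_iff_of_notMem (by simpa using hu)
      rw [if_neg h1, hu, pow_zero, one_mul, sub_zero]
      simp only [h2]
    · have h1 : Finsupp.single i 1 ≤ u := by rw [Finsupp.single_le_iff]; omega
      have h2 : ¬ u.support ⊆ O := fun h => hi (h (by simpa using hu))
      have h3 : (u - Finsupp.single i 1).support ⊆ insert i O ↔ u.support ⊆ insert i O := by
        constructor
        · intro h x hx
          by_cases hxi : x = i
          · exact hxi ▸ Finset.mem_insert_self _ _
          · refine h ?_
            rw [Finsupp.mem_support_iff, Finsupp.tsub_apply, Finsupp.single_eq_of_ne hxi]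
            simpa using hx
        · exact (Finsupp.support_tsub).trans
      rw [if_pos h1, if_neg h2, Finset.prod_insert hi]
      simp only [h3]
      split_ifs
      · have h4 : ∏ x ∈ O, q ^ ((u - Finsupp.single i 1 : σ →₀ ℕ) x) = ∏ x ∈ O, q ^ u x :=
          Finset.prod_congr rfl fun x hx => by
            rw [Finsupp.tsub_apply, Finsupp.single_eq_of_ne (ne_of_mem_of_not_mem hx hi), Nat.sub_zero]
        obtain ⟨m, hm⟩ := Nat.exists_eq_succ_of_ne_zero hu
        rw [h4, Finsupp.tsub_apply, Finsupp.single_eq_same, hm, Nat.succ_sub_one, pow_succ]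
        ring
      · simp

/-- Let `P` be the series with its poles cleared. All its relevant exponents lie below `b =
residueDegree e`. Expanding `V = P / ∏ (1 - q x_i)` geometrically, the coefficient at `b` is the sum
of the coefficients of `P` times `∏ q ^ (b_i - a_i)` over odd `i`, which is the evaluation at `x_i =
1/q` up to `∏ q ^ b_i`. -/
theorem formalResidue_eq (hn : 2 ≤ n) {N : ℕ} (hN : N ≠ 0)
    (hV : ∀ i : Fin (n + 1), Odd i.1 → Stable (N : ℂ) i V) (e : Fin (n / 2 + 1) →₀ ℕ) :
    MvPowerSeries.coeff e (formalResidue N V) =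
      (∏ i ∈ oddIndices n, ((N : ℂ)⁻¹) ^ residueDegree e i) *
        MvPowerSeries.coeff (Finsupp.equivFunOnFinite.symm (residueDegree e)) V := by
  classical
  have hN0 : (N : ℂ) ≠ 0 := by exact_mod_cast hN
  set b : Fin (n + 1) →₀ ℕ := Finsupp.equivFunOnFinite.symm (residueDegree e) with hb
  have hbi : ∀ i, b i = residueDegree e i := fun i => rfl
  set T : Finset (Fin (n + 1) →₀ ℕ) :=
    (Finset.Iic b).filter fun a => ∀ j, a (evenIndex j) = e j with hT
  have hsub : residueSupport N V e ⊆ T := by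
    intro a ha
    rw [hT, Finset.coe_filter, Set.mem_ofPred_eq, Finset.mem_Iic]
    exact ⟨fun i => le_residueDegree_of_coeff_ne_zero hn hV ha i, ha.1⟩
  have h1 : MvPowerSeries.coeff e (formalResidue N V) = ∑ a ∈ T,
      MvPowerSeries.coeff a (clearPoles N V) * ∏ i ∈ oddIndices n, ((N : ℂ)⁻¹) ^ a i := by
    rw [MvPowerSeries.coeff_apply, formalResidue]
    rw [finsum_mem_eq_finite_toFinset_sum _ (hasFormalResidue_of_stable hn hV e)]
    refine Finset.sum_subset (fun a ha => hsub (by simpa using ha)) fun a ha hna => ?_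
    have : MvPowerSeries.coeff a (clearPoles N V) = 0 := by
      by_contra hne
      refine hna ?_
      rw [Set.Finite.mem_toFinset]
      exact ⟨(Finset.mem_filter.1 ha).2, hne⟩
    rw [this, zero_mul]
  have h2 : V = geometricSeries (N : ℂ) (oddIndices n) * clearPoles N V := by
    rw [clearPoles, ← mul_assoc, mul_comm (geometricSeries _ _), prod_mul_geometricSeries, one_mul]
  have h3 : MvPowerSeries.coeff b V = ∑ a ∈ Finset.Iic b,
      MvPowerSeries.coeff (b - a) (geometricSeries (N : ℂ) (oddIndices n)) *
        MvPowerSeries.coeff a (clearPoles N V) := by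
    conv_lhs => rw [h2, MvPowerSeries.coeff_mul]
    refine Finset.sum_nbij' (fun x => x.2) (fun a => (b - a, a)) ?_ ?_ ?_ ?_ ?_
    · rintro ⟨x, y⟩ hxy
      rw [Finset.HasAntidiagonal.mem_antidiagonal] at hxy
      rw [Finset.mem_Iic, ← hxy]
      exact le_add_self
    · intro a ha
      rw [Finset.mem_Iic] at ha
      rw [Finset.HasAntidiagonal.mem_antidiagonal]
      exact tsub_add_cancel_of_le ha
    · rintro ⟨x, y⟩ hxy
      rw [Finset.HasAntidiagonal.mem_antidiagonal] at hxy
      simp only at hxy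
      simp [← hxy]
    · intro a _
      rfl
    · rintro ⟨x, y⟩ hxy
      rw [Finset.HasAntidiagonal.mem_antidiagonal] at hxy
      simp only at hxy
      simp [← hxy]
  rw [h1, h3, Finset.mul_sum, hT, Finset.sum_filter]
  refine Finset.sum_congr rfl fun a ha => ?_
  rw [Finset.mem_Iic] at ha
  have hiff : (b - a).support ⊆ oddIndices n ↔ ∀ j, a (evenIndex j) = e j := by
    constructor
    · intro h j
      have hle := ha (evenIndex j)
      rw [hbi, residueDegree_evenIndex] at hle
      by_contra hne
      have hmem : evenIndex j ∈ (b - a).support := by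
        rw [Finsupp.mem_support_iff, Finsupp.tsub_apply, hbi, residueDegree_evenIndex]
        omega
      exact odd_ne_evenIndex (mem_oddIndices.1 (h hmem)) j rfl
    · intro h i hi
      rw [mem_oddIndices]
      by_contra hodd
      obtain ⟨j, rfl⟩ := exists_evenIndex (Nat.not_odd_iff_even.1 hodd)
      rw [Finsupp.mem_support_iff, Finsupp.tsub_apply, hbi, residueDegree_evenIndex, h j] at hi
      exact hi (Nat.sub_self _)
  rw [coeff_geometricSeries]
  simp only [hiff]
  split_ifs
  · rw [← mul_assoc, ← Finset.prod_mul_distrib, mul_comm]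
    congr 1
    refine Finset.prod_congr rfl fun i _ => ?_
    have hle := ha i
    rw [hbi] at hle
    rw [Finsupp.tsub_apply, hbi, inv_pow, inv_pow, ← Nat.sub_add_cancel hle]
    rw [Nat.add_sub_cancel, pow_add]
    field_simp
  · simp

end Poles

/-! ### Collapsing all the odd entries. -/

section Assembly

variable {F : Type*} [Field F] [Fintype F] {n : ℕ} {H : (Fin (n + 1) → F[X]) → ℂ}

theorem natDegree_residueTuple {f : Fin (n / 2 + 1) → F[X]} (hf : ∀ j, (f j).Monic)
    {e : Fin (n / 2 + 1) → ℕ} (he : ∀ j, (f j).natDegree = e j) (i : Fin (n + 1)) :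
    (residueTuple f i).natDegree = residueDegree e i := by
  rcases Nat.even_or_odd i.1 with hi | hi
  · obtain ⟨j, rfl⟩ := exists_evenIndex hi
    rw [residueTuple_evenIndex, residueDegree_evenIndex, he]
  · rw [residueTuple_odd f hi, residueDegree_odd e hi, pred_eq_evenIndex hi, succ_eq_evenIndex hi]
    simp only [residueTuple_evenIndex, residueDegree_evenIndex]
    rw [(hf _).natDegree_mul (hf _), he, he]

variable (hH : IsWeight H) (hq : Fintype.card F % 4 = 1) (hn : 2 ≤ n)
    (hloc : ∀ (i : Fin (n + 1)) (p : F[X]) (b : Fin (n + 1) → ℕ), p.Monic → Irreducible p →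
      b i = 0 → LocalDual H i p b)

include hH hq hn hloc

-- The odd entries are collapsed one after another by `IsWeight.sum_update_eq`. Conditions already
-- imposed at other odd indices do not involve `f i`, since odd indices are not adjacent.
open Classical in
theorem sum_monicTuples_eq_sum_filter (e : Fin (n / 2 + 1) → ℕ) (O : Finset (Fin (n + 1)))
    (hO : O ⊆ oddIndices n) :
    ∑ f ∈ monicTuples F (residueDegree e), H f =
      (∏ i ∈ O, (((Fintype.card F : ℝ) ^ ((residueDegree e i : ℝ) / 2) : ℝ) : ℂ)) *
        ∑ f ∈ (monicTuples F (residueDegree e)).filter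
          (fun f => ∀ i ∈ O, f i = f (i - 1) * f (i + 1)), H f := by
  induction O using Finset.induction_on with
  | empty => simp
  | insert i O hi ih =>
    have hio : Odd i.1 := mem_oddIndices.1 (hO (Finset.mem_insert_self i O))
    have hOo : ∀ j ∈ O, Odd j.1 := fun j hj => mem_oddIndices.1 (hO (Finset.mem_insert_of_mem hj))
    have hi1 := pred_ne hn i
    have hi2 := succ_ne hn i
    rw [ih fun x hx => hO (Finset.mem_insert_of_mem hx), Finset.prod_insert hi,
      mul_comm (((Fintype.card F : ℝ) ^ ((residueDegree e i : ℝ) / 2) : ℝ) : ℂ), mul_assoc]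
    congr 1
    have hup : ∀ (f : Fin (n + 1) → F[X]) (g : F[X]), ∀ j ∈ O,
        (Function.update f i g j = Function.update f i g (j - 1) * Function.update f i g (j + 1) ↔
          f j = f (j - 1) * f (j + 1)) := by
      intro f g j hj
      rw [Function.update_of_ne (ne_of_mem_of_not_mem hj hi),
        Function.update_of_ne (odd_ne_pred (hOo j hj) hio).symm,
        Function.update_of_ne (odd_ne_succ (hOo j hj) hio).symm]
    rw [Finset.mul_sum]
    rw [← Finset.sum_fiberwise_of_maps_to (g := fun f : Fin (n + 1) → F[X] =>
      Function.update f i (f (i - 1) * f (i + 1)))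
      (t := (monicTuples F (residueDegree e)).filter
          (fun f => ∀ j ∈ insert i O, f j = f (j - 1) * f (j + 1)))]
    · refine Finset.sum_congr rfl fun f hf => ?_
      obtain ⟨hft, hfO⟩ := Finset.mem_filter.1 hf
      rw [mem_monicTuples] at hft
      have hfi := hfO i (Finset.mem_insert_self i O)
      have hdeg : (f (i - 1) * f (i + 1)).natDegree = residueDegree e i := by
        rw [← hfi, (hft i).2]
      have key := hH.sum_update_eq hq hn (i := i) (fun p b hp hi _ hb => hloc i p b hp hi hb) f
        (fun j => (hft j).1)
      rw [hdeg, ← hfi, Function.update_eq_self] at key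
      rw [← key]
      refine Finset.sum_nbij' (fun f' => f' i) (fun g => Function.update f i g) ?_ ?_ ?_ ?_ ?_
      · intro f' hf'
        simp only [Finset.mem_filter, mem_monicTuples] at hf'
        rw [mem_monicPolys]
        exact hf'.1.1 i
      · intro g hg
        rw [mem_monicPolys] at hg
        simp only [Finset.mem_filter, mem_monicTuples]
        refine ⟨⟨fun j => ?_, fun j hj => (hup f g j hj).2 (hfO j (Finset.mem_insert_of_mem hj))⟩, ?_⟩
        · by_cases h : j = i
          · subst h; rwa [Function.update_self]
          · rw [Function.update_of_ne h]; exact hft j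
        · rw [Function.update_idem, Function.update_of_ne hi1, Function.update_of_ne hi2, ← hfi,
            Function.update_eq_self]
      · intro f' hf'
        simp only [Finset.mem_filter] at hf'
        rw [← hf'.2, Function.update_idem, Function.update_eq_self]
      · intro g _
        exact Function.update_self ..
      · intro f' hf'
        simp only [Finset.mem_filter] at hf'
        rw [← hf'.2, Function.update_idem, Function.update_eq_self]
    · intro f hf
      simp only [Finset.mem_filter, mem_monicTuples] at hf ⊢
      refine ⟨fun j => ?_, fun j hj => ?_⟩
      · by_cases h : j = i
        · subst h
          rw [Function.update_self]
          refine ⟨(hf.1 _).1.mul (hf.1 _).1, ?_⟩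
          rw [(hf.1 _).1.natDegree_mul (hf.1 _).1, (hf.1 _).2, (hf.1 _).2,
            residueDegree_odd e hio]
        · rw [Function.update_of_ne h]; exact hf.1 j
      · rcases Finset.mem_insert.1 hj with rfl | hj
        · rw [Function.update_self, Function.update_of_ne hi1, Function.update_of_ne hi2]
        · exact (hup f _ j hj).2 (hf.2 j hj)

theorem sum_monicTuples_residueDegree (e : Fin (n / 2 + 1) → ℕ) :
    ∑ f ∈ monicTuples F (residueDegree e), H f =
      (∏ i ∈ oddIndices n, (((Fintype.card F : ℝ) ^ ((residueDegree e i : ℝ) / 2) : ℝ) : ℂ)) *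
        ∑ g ∈ monicTuples F e, H (residueTuple g) := by
  classical
  rw [sum_monicTuples_eq_sum_filter hH hq hn hloc e _ subset_rfl]
  congr 1
  refine Finset.sum_nbij' (fun f j => f (evenIndex j)) (fun g => residueTuple g) ?_ ?_ ?_ ?_ ?_
  · intro f hf
    simp only [Finset.mem_filter, mem_monicTuples] at hf
    rw [mem_monicTuples]
    intro j
    rw [← residueDegree_evenIndex e j]
    exact hf.1 _
  · intro g hg
    rw [mem_monicTuples] at hg
    simp only [Finset.mem_filter, mem_monicTuples]
    exact ⟨fun i => ⟨residueTuple_induction (P := Monic) (fun a b ha hb => ha.mul hb)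
      (fun j => (hg j).1) i, natDegree_residueTuple (fun j => (hg j).1) (fun j => (hg j).2) i⟩,
      fun i hi => residueTuple_odd g (mem_oddIndices.1 hi)⟩
  all_goals
    try
      intro g _
      ext1 j
      exact residueTuple_evenIndex g j
  · intro f hf
    simp only [Finset.mem_filter, mem_oddIndices] at hf
    ext1 i
    rcases Nat.even_or_odd i.1 with hi | hi
    · obtain ⟨j, rfl⟩ := exists_evenIndex hi
      rw [residueTuple_evenIndex]
    · rw [residueTuple_odd _ hi, hf.2 i hi, pred_eq_evenIndex hi, succ_eq_evenIndex hi,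
        residueTuple_evenIndex, residueTuple_evenIndex]
  · intro f hf
    simp only [Finset.mem_filter, mem_oddIndices] at hf
    congr 1
    ext1 i
    rcases Nat.even_or_odd i.1 with hi | hi
    · obtain ⟨j, rfl⟩ := exists_evenIndex hi
      rw [residueTuple_evenIndex]
    · rw [residueTuple_odd _ hi, hf.2 i hi, pred_eq_evenIndex hi, succ_eq_evenIndex hi,
        residueTuple_evenIndex, residueTuple_evenIndex]

end Assembly

/-! ### The power of `q`. -/

section Exponents

variable {n : ℕ}

/-- Each even index is counted by its two odd neighbours. The index `(n + 1) / 2` wraps to `0` for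
`n` odd, cancelling the correction, and is the last even index for `n` even. -/
theorem sum_residueDegree_odd (e : Fin (n / 2 + 1) → ℕ) :
    ∑ i ∈ oddIndices n, (residueDegree e i : ℝ) =
      2 * (∑ k ∈ Finset.range ((n + 1) / 2), (e (Fin.ofNat (n / 2 + 1) k) : ℝ)) +
        e (Fin.ofNat (n / 2 + 1) ((n + 1) / 2)) - e 0 := by
  have h1 : ∑ i ∈ oddIndices n, (residueDegree e i : ℝ) =
      ∑ k ∈ Finset.range ((n + 1) / 2), ((e (Fin.ofNat (n / 2 + 1) k) : ℝ) +
        e (Fin.ofNat (n / 2 + 1) (k + 1))) := by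
    refine Finset.sum_bij (fun i _ => i.1 / 2) ?_ ?_ ?_ ?_
    · intro i hi
      obtain ⟨m, hm⟩ := mem_oddIndices.1 hi
      have := i.2
      rw [Finset.mem_range]
      omega
    · intro i hi j hj hij
      obtain ⟨m, hm⟩ := mem_oddIndices.1 hi
      obtain ⟨l, hl⟩ := mem_oddIndices.1 hj
      ext
      omega
    · intro k hk
      rw [Finset.mem_range] at hk
      refine ⟨⟨2 * k + 1, by omega⟩, mem_oddIndices.2 ⟨k, rfl⟩, ?_⟩
      simp only
      omega
    · intro i hi
      rw [residueDegree_odd' e (mem_oddIndices.1 hi)]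
      push_cast
      rfl
  have h2 := Finset.sum_range_succ (fun k => (e (Fin.ofNat (n / 2 + 1) k) : ℝ)) ((n + 1) / 2)
  have h3 := Finset.sum_range_succ' (fun k => (e (Fin.ofNat (n / 2 + 1) k) : ℝ)) ((n + 1) / 2)
  have h0 : Fin.ofNat (n / 2 + 1) 0 = 0 := rfl
  rw [h0] at h3
  rw [h1, Finset.sum_add_distrib]
  linear_combination h2 - h3

theorem sum_eq_sum_range_ofNat (e : Fin (n / 2 + 1) → ℕ) :
    ∑ j, (e j : ℝ) = ∑ k ∈ Finset.range (n / 2 + 1), (e (Fin.ofNat (n / 2 + 1) k) : ℝ) := by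
  rw [← Fin.sum_univ_eq_sum_range (fun k => (e (Fin.ofNat (n / 2 + 1) k) : ℝ))]
  refine Finset.sum_congr rfl fun j _ => ?_
  congr 2
  ext
  simp [Fin.ofNat, Nat.mod_eq_of_lt j.2]

/-- The exponent of `q` in the rescaling of the variable `x_i`. -/
def rescaleExponent (i : Fin (n + 1)) : ℝ :=
  if Even n ∧ (i = 0 ∨ i = Fin.last n) then -(1 / 4) else 0

/-- Each odd index contributes `1/2` from the collapsed sum and `-1` from the evaluation. An even
index with two odd neighbours therefore receives `-1`. For `n` even the two end indices have only
one, and the rescaling turns `-1/2` into `-3/4`. -/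
theorem exponent_identity (hn : 2 ≤ n) (e : Fin (n / 2 + 1) → ℕ) :
    ∑ i ∈ oddIndices n, (residueDegree e i : ℝ) / 2 - ∑ i ∈ oddIndices n, (residueDegree e i : ℝ) +
      ∑ i, rescaleExponent i * (residueDegree e i : ℝ) = - ∑ j, endWeight j * (e j : ℝ) := by
  rw [← Finset.sum_div, sum_residueDegree_odd]
  have hs := sum_eq_sum_range_ofNat e
  by_cases he : Even n
  · obtain ⟨m, hm⟩ := he
    have he : Even n := ⟨m, hm⟩
    have h0l : (0 : Fin (n + 1)) ≠ Fin.last n := by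
      intro h
      have := congrArg Fin.val h
      simp at this
      omega
    have h0l' : (0 : Fin (n / 2 + 1)) ≠ Fin.last (n / 2) := by
      intro h
      have := congrArg Fin.val h
      simp at this
      omega
    have hd0 : residueDegree e 0 = e 0 := residueDegree_evenIndex e 0
    have hdl : residueDegree e (Fin.last n) = e (Fin.last (n / 2)) := by
      rw [← residueDegree_evenIndex e (Fin.last (n / 2))]
      congr 1
      ext
      simp [evenIndex]
      omega
    have ht : ∑ i, rescaleExponent i * (residueDegree e i : ℝ) =
        -(1 / 4) * e 0 + -(1 / 4) * e (Fin.last (n / 2)) := by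
      have h1 : ∀ i : Fin (n + 1), rescaleExponent i * (residueDegree e i : ℝ) =
          (if i = 0 then -(1 / 4) * (residueDegree e i : ℝ) else 0) +
          (if i = Fin.last n then -(1 / 4) * (residueDegree e i : ℝ) else 0) := by
        intro i
        unfold rescaleExponent
        by_cases h0 : i = 0
        · subst h0; simp [he, h0l]
        · by_cases hl : i = Fin.last n
          · simp [he, hl, h0l.symm]
          · simp [h0, hl]
      rw [Finset.sum_congr rfl fun i _ => h1 i, Finset.sum_add_distrib, Finset.sum_ite_eq',
        Finset.sum_ite_eq', if_pos (Finset.mem_univ _), if_pos (Finset.mem_univ _), hd0, hdl]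
    have hw : ∑ j, endWeight (n := n) j * (e j : ℝ) =
        ∑ j, (e j : ℝ) - 1 / 4 * e 0 - 1 / 4 * e (Fin.last (n / 2)) := by
      have h1 : ∀ j : Fin (n / 2 + 1), endWeight j * (e j : ℝ) = (e j : ℝ) -
          (if j = 0 then 1 / 4 * (e j : ℝ) else 0) -
          (if j = Fin.last (n / 2) then 1 / 4 * (e j : ℝ) else 0) := by
        intro j
        unfold endWeight
        by_cases h0 : j = 0
        · subst h0; simp [he, h0l']; ring
        · by_cases hl : j = Fin.last (n / 2)
          · rw [if_pos ⟨he, Or.inr hl⟩, if_neg h0, if_pos hl]; ring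
          · simp [h0, hl]
      rw [Finset.sum_congr rfl fun i _ => h1 i, Finset.sum_sub_distrib, Finset.sum_sub_distrib,
        Finset.sum_ite_eq', Finset.sum_ite_eq', if_pos (Finset.mem_univ _),
        if_pos (Finset.mem_univ _)]
    have hlast : Fin.ofNat (n / 2 + 1) (n / 2) = Fin.last (n / 2) := by
      ext
      simp [Fin.ofNat]
    rw [Finset.sum_range_succ, hlast] at hs
    rw [ht, hw, show (n + 1) / 2 = n / 2 by omega, hlast]
    linear_combination hs
  · obtain ⟨m, hm⟩ := Nat.not_even_iff_odd.1 he
    have ht : ∑ i, rescaleExponent i * (residueDegree e i : ℝ) = 0 :=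
      Finset.sum_eq_zero fun i _ => by simp [rescaleExponent, he]
    have hw : ∑ j, endWeight (n := n) j * (e j : ℝ) = ∑ j, (e j : ℝ) :=
      Finset.sum_congr rfl fun i _ => by simp [endWeight, he]
    have hlast : Fin.ofNat (n / 2 + 1) (n / 2 + 1) = 0 := by
      ext
      simp [Fin.ofNat]
    rw [ht, hw, show (n + 1) / 2 = n / 2 + 1 by omega, hlast]
    linear_combination hs

end Exponents

/-! ### Geometric coefficients of `Z` and the formula for the residue. -/

section Stability

variable {n : ℕ}

theorem Stable.rescale {q : ℂ} {i : Fin (n + 1)} {V : MvPowerSeries (Fin (n + 1)) ℂ}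
    (h : Stable q i V) {w : Fin (n + 1) → ℂ} (hw : w i = 1) :
    Stable q i (MvPowerSeries.rescale w V) := by
  intro a ha
  rw [MvPowerSeries.coeff_rescale, MvPowerSeries.coeff_rescale, h a ha,
    Finsupp.prod_add_index' (h := fun s m => w s ^ m) (fun _ => pow_zero _) (fun _ _ _ => pow_add _ _ _),
    Finsupp.prod_single_index (h := fun s m => w s ^ m) (pow_zero _), hw, one_pow]
  ring

theorem Stable.normalizedSeries {q : ℂ} {i : Fin (n + 1)} {V : MvPowerSeries (Fin (n + 1)) ℂ}
    (h : Stable q i V) (hi : Odd i.1) (N : ℕ) : Stable q i (normalizedSeries N V) := by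
  refine h.rescale (if_neg ?_)
  rintro ⟨he, rfl | rfl⟩
  · simp at hi
  · exact Nat.not_even_iff_odd.2 hi he

variable {𝔽 : PrimePowerOneModFour → Type*} [∀ q, Field (𝔽 q)] [∀ q, Fintype (𝔽 q)]
  {H : ∀ q, (Fin (n + 1) → (𝔽 q)[X]) → ℂ} {c : (Fin (n + 1) → ℕ) → ℂ[X]}

/-- By the global functional equation the slice with its pole cleared is a polynomial of degree at
most `a_{i-1} + a_{i+1}`. For an odd sum there is no pole, and the coefficients in question are
zero. -/
theorem SatisfiesAxioms.stable_dirichletSeries (hH : SatisfiesAxioms H c) (hn : 2 ≤ n)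
    (hcard : ∀ q, Fintype.card (𝔽 q) = q.1) (q : PrimePowerOneModFour) (i : Fin (n + 1)) :
    Stable (q.1 : ℂ) i (dirichletSeries (H q)) := by
  have hco : ∀ a : Fin (n + 1) →₀ ℕ, MvPowerSeries.coeff a (dirichletSeries (H q)) =
      (c a).eval (q.1 : ℂ) := fun a => hH.global_coeff q a
  intro a ha
  have hG := hH.globalDual hn hcard (Function.update a i 0) (i := i) (Function.update_self ..)
  unfold GlobalDual at hG
  rw [Function.update_of_ne (pred_ne hn i), Function.update_of_ne (succ_ne hn i)] at hG
  have hgs : ∀ k, PowerSeries.coeff k (globalSeries c i (Function.update a i 0)) =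
      c (Function.update a i k) := by
    intro k
    rw [globalSeries, PowerSeries.coeff_mk, Function.update_idem]
  have h0 : c a = c (Function.update a i (a i)) := by rw [Function.update_eq_self]
  have h1 : c (a + Finsupp.single i 1 : Fin (n + 1) →₀ ℕ) = c (Function.update a i (a i + 1)) := by
    congr 1
    ext j
    by_cases hj : j = i
    · subst hj; simp
    · simp [hj]
  rw [hco, hco, h0, h1]
  by_cases he : Even (a (i - 1) + a (i + 1))
  · rw [poleFactor_of_even _ he] at hG
    have := hG.1 (a i + 1) (by omega)
    rw [coeff_succ_mul_one_sub, hgs, hgs, sub_eq_zero] at this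
    rw [this, eval_mul, eval_X]
  · rw [poleFactor_of_odd _ he, mul_one] at hG
    obtain ⟨m, hm⟩ := Nat.not_even_iff_odd.1 he
    have e1 := hG.1 (a i + 1) (by omega)
    have e2 := hG.1 (a i) (by omega)
    rw [hgs] at e1 e2
    rw [e1, e2, eval_zero, mul_zero]

theorem SatisfiesAxioms.residueSeries_eq (hH : SatisfiesAxioms H c) (hn : 2 ≤ n)
    (hcard : ∀ q, Fintype.card (𝔽 q) = q.1) (q : PrimePowerOneModFour) :
    residueSeries q.1 (dirichletSeries (H q)) = residueSum q.1 (H q) := by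
  have hq0 : 0 < q.1 := q.2.1.pos
  have hqr : (0 : ℝ) < q.1 := by exact_mod_cast hq0
  have hq4 : Fintype.card (𝔽 q) % 4 = 1 := by rw [hcard]; exact q.2.2
  ext e
  rw [residueSeries, formalResidue_eq hn hq0.ne'
    fun i hi => (hH.stable_dirichletSeries hn hcard q i).normalizedSeries hi q.1]
  have hZ : MvPowerSeries.coeff (Finsupp.equivFunOnFinite.symm (residueDegree e))
      (dirichletSeries (H q)) = ∑ f ∈ monicTuples (𝔽 q) (residueDegree e), H q f := rfl
  have hw : ∀ i : Fin (n + 1), (if Even n ∧ (i = 0 ∨ i = Fin.last n) then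
      (((q.1 : ℝ) ^ (-(1 / 4) : ℝ) : ℝ) : ℂ) else 1) =
      (((q.1 : ℝ) ^ rescaleExponent i : ℝ) : ℂ) := by
    intro i
    unfold rescaleExponent
    split_ifs <;> simp
  rw [normalizedSeries, MvPowerSeries.coeff_rescale, hZ, sum_monicTuples_residueDegree
    (hH.isWeight q) hq4 hn (fun i p b hp hi hb => hH.localDual hn hcard q hb hp hi) e,
    Finsupp.prod_fintype _ _ fun _ => pow_zero _, hcard]
  simp only [hw, Finsupp.coe_equivFunOnFinite_symm]
  have hR : MvPowerSeries.coeff e (residueSum q.1 (H q)) =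
      (((q.1 : ℝ) ^ (-∑ j, endWeight (n := n) j * (e j : ℝ)) : ℝ) : ℂ) *
        ∑ g ∈ monicTuples (𝔽 q) e, H q (residueTuple g) := by
    rw [Finset.mul_sum]
    refine Finset.sum_congr rfl fun f hf => ?_
    rw [mem_monicTuples] at hf
    rw [residueTerm, Finset.sum_congr rfl fun j _ => by rw [(hf j).2], Real.rpow_neg hqr.le,
      Complex.ofReal_inv, div_eq_mul_inv, mul_comm]
  have k1 : ∏ i ∈ oddIndices n, ((q.1 : ℂ)⁻¹) ^ residueDegree e i =
      (((q.1 : ℝ) ^ (-∑ i ∈ oddIndices n, (residueDegree e i : ℝ)) : ℝ) : ℂ) := by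
    rw [← Finset.sum_neg_distrib, Real.rpow_sum_of_pos hqr, Complex.ofReal_prod]
    refine Finset.prod_congr rfl fun i _ => ?_
    rw [Real.rpow_neg hqr.le, Real.rpow_natCast]
    push_cast
    rw [inv_pow]
  have k2 : ∏ i, (((q.1 : ℝ) ^ rescaleExponent i : ℝ) : ℂ) ^ residueDegree e i =
      (((q.1 : ℝ) ^ (∑ i, rescaleExponent i * (residueDegree e i : ℝ)) : ℝ) : ℂ) := by
    rw [Real.rpow_sum_of_pos hqr, Complex.ofReal_prod]
    refine Finset.prod_congr rfl fun i _ => ?_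
    rw [Real.rpow_mul hqr.le, Real.rpow_natCast, Complex.ofReal_pow]
  have k3 : ∏ i ∈ oddIndices n, (((q.1 : ℝ) ^ ((residueDegree e i : ℝ) / 2) : ℝ) : ℂ) =
      (((q.1 : ℝ) ^ (∑ i ∈ oddIndices n, (residueDegree e i : ℝ) / 2) : ℝ) : ℂ) := by
    rw [Real.rpow_sum_of_pos hqr, Complex.ofReal_prod]
  rw [hR, k1, k2, k3, ← exponent_identity hn e, ← mul_assoc, ← mul_assoc, ← Complex.ofReal_mul,
    ← Complex.ofReal_mul, ← Real.rpow_add hqr, ← Real.rpow_add hqr]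
  congr 3
  ring

end Stability

/-! ### The Euler product. -/

section EulerProduct

variable {F : Type*} [Field F] [Fintype F] {n q : ℕ} {H : (Fin (n + 1) → F[X]) → ℂ}

theorem IsWeight.residueTerm_one (hH : IsWeight H) (q : ℕ) :
    residueTerm q H (fun _ => 1) = 1 := by
  have h1 : residueTuple (n := n) (fun _ => (1 : F[X])) = fun _ => 1 := by
    ext1 i
    unfold residueTuple
    split_ifs <;> simp
  have h2 := hH.initial 0 1 monic_one
  simp only [ite_self] at h2
  rw [residueTerm, h1, h2]
  simp

-- A finite product collects the tuples all of whose prime factors lie in `S`. Adding a prime to `S`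
-- amounts to splitting its powers off every entry.
open Classical in
theorem coeff_prod_eulerFactor (hone : residueTerm q H (fun _ => 1) = 1)
    (hmul : ∀ f g : Fin (n / 2 + 1) → F[X], (∀ j, (f j).Monic) → (∀ j, (g j).Monic) →
      IsCoprime (∏ j, f j) (∏ j, g j) →
      residueTerm q H (fun j => f j * g j) = residueTerm q H f * residueTerm q H g)
    (S : Finset (PrimePoly F)) (e : Fin (n / 2 + 1) →₀ ℕ) :
    MvPowerSeries.coeff e (∏ p ∈ S, eulerFactor q H p) =
      ∑ f ∈ (monicTuples F e).filter (fun f => ∀ p : PrimePoly F, (∃ j, p.1 ∣ f j) → p ∈ S),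
        residueTerm q H f := by
  induction S using Finset.induction_on generalizing e with
  | empty =>
    rw [Finset.prod_empty, MvPowerSeries.coeff_one]
    have hmem : ∀ f, f ∈ (monicTuples F e).filter
        (fun f => ∀ p : PrimePoly F, (∃ j, p.1 ∣ f j) → p ∈ (∅ : Finset (PrimePoly F))) →
        f = fun _ => 1 := by
      intro f hf
      rw [Finset.mem_filter, mem_monicTuples] at hf
      ext1 j
      by_contra hne
      have hu : ¬ IsUnit (f j) := fun h => hne ((hf.1 j).1.eq_one_of_isUnit h)
      obtain ⟨g, hg, hgi, hgd⟩ := exists_monic_irreducible_factor (f j) hu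
      exact absurd (hf.2 ⟨g, hg, hgi⟩ ⟨j, hgd⟩) (Finset.notMem_empty _)
    split_ifs with he
    · subst he
      rw [Finset.sum_eq_single (fun _ => 1), hone]
      · exact fun f hf hne => absurd (hmem f hf) hne
      · intro h
        refine absurd (Finset.mem_filter.2 ⟨mem_monicTuples.2 fun j => ⟨monic_one, ?_⟩, ?_⟩) h
        · simp
        · rintro p ⟨j, hj⟩
          exact absurd (isUnit_of_dvd_one hj) p.2.2.not_isUnit
    · symm
      refine Finset.sum_eq_zero fun f hf => absurd ?_ he
      have h1 := hmem f hf
      rw [Finset.mem_filter, mem_monicTuples] at hf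
      ext j
      rw [← (hf.1 j).2, h1]
      simp
  | insert p S hp ih =>
    rw [Finset.prod_insert hp, MvPowerSeries.coeff_mul]
    have hd := p.2.2.natDegree_pos
    set d := p.1.natDegree with hdd
    have hnd : ∀ {g : Fin (n / 2 + 1) → F[X]},
        (∀ p : PrimePoly F, (∃ j, p.1 ∣ g j) → p ∈ S) → ∀ j, ¬ p.1 ∣ g j :=
      fun h j hj => hp (h p ⟨j, hj⟩)
    have hR : ∀ x ∈ Finset.HasAntidiagonal.antidiagonal e,
        MvPowerSeries.coeff x.1 (eulerFactor q H p) *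
          MvPowerSeries.coeff x.2 (∏ p ∈ S, eulerFactor q H p) =
        ∑ g ∈ (monicTuples F x.2).filter (fun g =>
          (∀ p : PrimePoly F, (∃ j, p.1 ∣ g j) → p ∈ S) ∧ ∀ j, d ∣ x.1 j),
          residueTerm q H (fun j => p.1 ^ (x.1 j / d)) * residueTerm q H g := by
      intro x _
      rw [ih, MvPowerSeries.coeff_apply, eulerFactor]
      split_ifs with hdx
      · rw [Finset.mul_sum]
        refine Finset.sum_congr (Finset.filter_congr fun g _ => ?_) fun _ _ => rfl
        exact ⟨fun h => ⟨h, hdx⟩, fun h => h.1⟩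
      · rw [zero_mul]
        symm
        exact Finset.sum_eq_zero fun g hg => absurd (Finset.mem_filter.1 hg).2.2 hdx
    rw [Finset.sum_congr rfl hR, Finset.sum_sigma']
    refine Finset.sum_bij (fun x _ j => p.1 ^ (x.1.1 j / d) * x.2 j) ?_ ?_ ?_ ?_
    · rintro ⟨⟨u, v⟩, g⟩ hx
      simp only [Finset.mem_sigma, Finset.HasAntidiagonal.mem_antidiagonal, Finset.mem_filter,
        mem_monicTuples] at hx
      obtain ⟨huv, hg, hgS, hdu⟩ := hx
      rw [Finset.mem_filter, mem_monicTuples]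
      refine ⟨fun j => ⟨(p.2.1.pow _).mul (hg j).1, ?_⟩, ?_⟩
      · rw [(p.2.1.pow _).natDegree_mul (hg j).1, p.2.1.natDegree_pow, (hg j).2, ← huv]
        simp only [Finsupp.add_apply]
        rw [Nat.div_mul_cancel (hdu j)]
      · rintro r ⟨j, hj⟩
        rw [Finset.mem_insert]
        rcases r.2.2.prime.dvd_or_dvd hj with h | h
        · left
          have h2 := r.2.2.prime.dvd_of_dvd_pow h
          exact Subtype.ext (eq_of_monic_of_associated r.2.1 p.2.1
            (r.2.2.associated_of_dvd p.2.2 h2))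
        · exact Or.inr (hgS r ⟨j, h⟩)
    · rintro ⟨⟨u, v⟩, g⟩ hx ⟨⟨u', v'⟩, g'⟩ hx' heq
      simp only [Finset.mem_sigma, Finset.HasAntidiagonal.mem_antidiagonal, Finset.mem_filter,
        mem_monicTuples] at hx hx' heq
      obtain ⟨huv, hg, hgS, hdu⟩ := hx
      obtain ⟨huv', hg', hgS', hdu'⟩ := hx'
      have key := fun j => pow_mul_inj p.2.1.ne_zero (hnd hgS j) (hnd hgS' j) (congrFun heq j)
      have hu : u = u' := by
        ext j
        rw [← Nat.div_mul_cancel (hdu j), ← Nat.div_mul_cancel (hdu' j), (key j).1]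
      have hgg : g = g' := funext fun j => (key j).2
      subst hu hgg
      have hv : v = v' := add_left_cancel (huv.trans huv'.symm)
      subst hv
      rfl
    · intro f hf
      rw [Finset.mem_filter, mem_monicTuples] at hf
      choose k g hkg hg hgn using fun j => exists_pow_mul_not_dvd p.2.1 p.2.2 (hf.1 j).1
      refine ⟨⟨(Finsupp.equivFunOnFinite.symm fun j => k j * d,
        Finsupp.equivFunOnFinite.symm fun j => (g j).natDegree), g⟩, ?_, ?_⟩
      · simp only [Finset.mem_sigma, Finset.HasAntidiagonal.mem_antidiagonal, Finset.mem_filter,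
          mem_monicTuples]
        refine ⟨?_, fun j => ⟨hg j, rfl⟩, ?_, fun j => dvd_mul_left _ _⟩
        · ext j
          rw [← (hf.1 j).2, hkg j, (p.2.1.pow _).natDegree_mul (hg j), p.2.1.natDegree_pow]
          rfl
        · rintro r ⟨j, hj⟩
          have h1 := hf.2 r ⟨j, by rw [hkg j]; exact hj.mul_left _⟩
          refine (Finset.mem_insert.1 h1).resolve_left ?_
          rintro rfl
          exact hgn j hj
      · ext1 j
        simp only [Finsupp.coe_equivFunOnFinite_symm]
        rw [Nat.mul_div_cancel _ hd, ← hkg j]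
    · rintro ⟨⟨u, v⟩, g⟩ hx
      simp only [Finset.mem_sigma, Finset.HasAntidiagonal.mem_antidiagonal, Finset.mem_filter,
        mem_monicTuples] at hx
      refine (hmul _ g (fun j => p.2.1.pow _) (fun j => (hx.2.1 j).1) ?_).symm
      exact IsCoprime.prod_left fun _ _ => IsCoprime.prod_right fun j _ =>
        (isCoprime_of_irreducible p.2.2 (hnd hx.2.2.1 j)).pow_left

theorem isFormalProduct_eulerFactor (hone : residueTerm q H (fun _ => 1) = 1)
    (hmul : ∀ f g : Fin (n / 2 + 1) → F[X], (∀ j, (f j).Monic) → (∀ j, (g j).Monic) →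
      IsCoprime (∏ j, f j) (∏ j, g j) →
      residueTerm q H (fun j => f j * g j) = residueTerm q H f * residueTerm q H g) :
    IsFormalProduct (eulerFactor q H) (residueSum q H) := by
  classical
  intro e
  -- A prime dividing an entry of a tuple of degrees `e` has degree at most `∑ j, e j`, and there
  -- are finitely many of these.
  have hfin : {p : PrimePoly F | p.1 ∈ (Finset.range (∑ j, e j + 1)).biUnion
      (monicPolys F)}.Finite :=
    (Finset.finite_toSet _).preimage Subtype.val_injective.injOn
  filter_upwards [Filter.eventually_ge_atTop hfin.toFinset] with S hS
  rw [coeff_prod_eulerFactor hone hmul, Finset.filter_true_of_mem]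
  · rfl
  · rintro f hf p ⟨j, hj⟩
    rw [mem_monicTuples] at hf
    refine hS (hfin.mem_toFinset.2 ?_)
    rw [Set.mem_ofPred_eq, Finset.mem_biUnion]
    refine ⟨p.1.natDegree, ?_, mem_monicPolys.2 ⟨p.2.1, rfl⟩⟩
    rw [Finset.mem_range, Nat.lt_succ_iff]
    calc p.1.natDegree ≤ (f j).natDegree := natDegree_le_of_dvd hj (hf j).1.ne_zero
      _ = e j := (hf j).2
      _ ≤ ∑ j, e j := Finset.single_le_sum (fun _ _ => Nat.zero_le _) (Finset.mem_univ j)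

end EulerProduct

end AffineMDS

end

theorem mainTheorem5 {n : ℕ} (hn : 2 ≤ n)
    (𝔽 : AffineMDS.PrimePowerOneModFour → Type*) [∀ q, Field (𝔽 q)] [∀ q, Finite (𝔽 q)]
    (hcard : ∀ q, Nat.card (𝔽 q) = q.1)
    (H : ∀ q, (Fin (n + 1) → (𝔽 q)[X]) → ℂ) (c : (Fin (n + 1) → ℕ) → ℂ[X])
    (hH : AffineMDS.SatisfiesAxioms H c) (q : AffineMDS.PrimePowerOneModFour) :
    -- the residue is a well-defined formal power series
    AffineMDS.HasFormalResidue q.1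
      (AffineMDS.normalizedSeries q.1 (AffineMDS.dirichletSeries (H q))) ∧
    -- the formula for the residue
    AffineMDS.residueSeries q.1 (AffineMDS.dirichletSeries (H q)) =
      AffineMDS.residueSum q.1 (H q) ∧
    -- only tuples with all `f_i f_{i+2}` square, i.e. with the same squarefree part, contribute
    (∀ f : Fin (n / 2 + 1) → (𝔽 q)[X], (∀ j, (f j).Monic) →
      H q (AffineMDS.residueTuple f) ≠ 0 →
        (∀ i : Fin (n + 1), Odd i.1 → IsSquare (AffineMDS.residueTuple f i)) ∧
        ∃ s : (𝔽 q)[X], s.Monic ∧ Squarefree s ∧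
          ∀ j, ∃ h : (𝔽 q)[X], h.Monic ∧ f j = s * h ^ 2) ∧
    -- the coefficients are multiplicative
    (∀ f g : Fin (n / 2 + 1) → (𝔽 q)[X], (∀ j, (f j).Monic) → (∀ j, (g j).Monic) →
      IsCoprime (∏ j, f j) (∏ j, g j) →
        H q (AffineMDS.residueTuple fun j => f j * g j) =
          H q (AffineMDS.residueTuple f) * H q (AffineMDS.residueTuple g) ∧
        AffineMDS.residueTerm q.1 (H q) (fun j => f j * g j) =
          AffineMDS.residueTerm q.1 (H q) f * AffineMDS.residueTerm q.1 (H q) g) ∧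
    -- the Euler product
    AffineMDS.IsFormalProduct (AffineMDS.eulerFactor q.1 (H q))
      (AffineMDS.residueSeries q.1 (AffineMDS.dirichletSeries (H q))) := by

  let _ : ∀ q, Fintype (𝔽 q) := fun q => Fintype.ofFinite _
  have hcard' : ∀ q, Fintype.card (𝔽 q) = q.1 := fun q => by
    rw [← Nat.card_eq_fintype_card, hcard]
  have hq4 : Fintype.card (𝔽 q) % 4 = 1 := by rw [hcard']; exact q.2.2
  have hW := hH.isWeight q
  have hloc : ∀ (i : Fin (n + 1)) (p : (𝔽 q)[X]) (b : Fin (n + 1) → ℕ), p.Monic →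
      Irreducible p → b i = 0 → AffineMDS.LocalDual (H q) i p b :=
    fun i p b hp hi hb => hH.localDual hn hcard' q hb hp hi
  have hmul := fun f g hf hg hfg =>
    AffineMDS.residueTerm_mul hW hq4 hn hloc q.2.1.pos (f := f) (g := g) hf hg hfg
  have hres := hH.residueSeries_eq hn hcard' q
  refine ⟨AffineMDS.hasFormalResidue_of_stable hn fun i hi =>
    (hH.stable_dirichletSeries hn hcard' q i).normalizedSeries hi q.1, hres, fun f hf hne =>
    ⟨fun i hi => AffineMDS.isSquare_residueTuple hW hq4 hn hloc hf hne hi,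
      AffineMDS.exists_common_squarefree_part hW hq4 hn hloc hf hne⟩, fun f g hf hg hfg =>
    ⟨AffineMDS.residueTuple_weight_mul hW hq4 hn hloc hf hg hfg, hmul f g hf hg hfg⟩, ?_⟩
  rw [hres]
  exact AffineMDS.isFormalProduct_eulerFactor (hW.residueTerm_one q.1) hmul
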